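/- Let $n\ge 1$ and let $(M,\omega)$ be a connected pre-$n$-plectic manifold: $M$ is a connected (Hausdorff, second countable, finite-dimensional) smooth manifold and $\omega\in\Omega^{n+1}(M)$ is a closed form. A vector field $v$ is *Hamiltonian* if $d\alpha=-\iota_v\omega$ for some $\alpha\in\Omega^{n-1}(M)$; the Hamiltonian vector fields form a Lie algebra $\mathfrak X_{\mathrm{Ham}}(M)$. Let the real Lie algebra $\mathfrak g$ act on $M$ by Hamiltonian vector fields, i.e. let $v_-\colon\mathfrak g\to\mathfrak X_{\mathrm{Ham}}(M)$, $x\mapsto v_x$, be a Lie algebra morphism (for example, for an action of a Lie group $G$ with Lie algebra $\mathfrak g$ whose fundamental vector fields $v_x|_q=\frac{d}{dt}\exp(-tx)\cdot q|_{t=0}$ are Hamiltonian). Let $p\in M$ and assume $H^k_{\mathrm{dR}}(M)=0$ for $1\le k\le n-1$. Notation: $\varsigma(k)=-(-1)^{k(k+1)/2}$ and $\iota(v_1\wedge\dots\wedge v_k)=\iota_{v_k}\cdots\iota_{v_1}$. * $\mathsf{Ham}_\infty(M,\omega)$ is the graded vector space $L$ with $L^0=\{(v,\alpha)\in\mathfrak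 X(M)\times\Omega^{n-1}(M): d\alpha=-\iota_v\omega\}$, $L^i=\Omega^{n-1+i}(M)$ for $1-n\le i<0$ and $L^i=0$ otherwise, with brackets $l_1(\alpha)=(0,d\alpha)$ for $\deg\alpha=-1$, $l_1(\alpha)=d\alpha$ for $\deg\alpha<-1$, $l_1=0$ on $L^0$; $l_2((v_1,\alpha_1),(v_2,\alpha_2))=([v_1,v_2],\,\iota(v_1\wedge v_2)\omega)$; $l_k((v_1,\alpha_1),\dots,(v_k,\alpha_k))=\varsigma(k)\,\iota(v_1\wedge\dots\wedge v_k)\omega$ for $k\ge3$ (so it is $0$ for $k>n+1$); and $l_k=0$ for $k\ge2$ whenever some argument has negative degree. The projection $\pi\colon\mathsf{Ham}_\infty(M,\omega)\to\mathfrak X_{\mathrm{Ham}}(M)$ is $(v,\alpha)\mapsto v$ in degree $0$ and $0$ in negative degrees. * $c_p^{\mathfrak g}\colon\Lambda^{n+1}\mathfrak g\to\mathbb R$ is $c_p^{\mathfrak g}(x_1,\dots,x_{n+1})=(-1)^n\varsigma(n+1)\,\iota(v_{x_1}\wedge\dots\wedge v_{x_{n+1}})\omega|_p$. * $\widehat{\mathfrak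 g}$ is the central $n$-extension: $\mathfrak g$ in degree $0$ and $\mathbb R$ in degree $1-n$, with $l_2(x_1,x_2)=[x_1,x_2]$ and $l_{n+1}(x_1,\dots,x_{n+1})=c^{\mathfrak g}_p(x_1,\dots,x_{n+1})$ on $\mathfrak g$, all other brackets zero (if $n=1$: $l_2=[\cdot,\cdot]+c^{\mathfrak g}_p$ on the space $\mathfrak g\oplus\mathbb R$ in degree $0$). $\pi^{\mathfrak g}\colon\widehat{\mathfrak g}\to\mathfrak g$ is the projection. Here an $L_\infty$-algebra is a graded real vector space with graded skew-symmetric multilinear brackets $l_k$ ($k\ge1$) of degree $2-k$ satisfying, for all $m\ge1$, $$\sum_{i+j=m+1}\ \sum_{\sigma\in \mathrm{Sh}(i,m-i)}(-1)^{\sigma}\epsilon(\sigma)(-1)^{i(j-1)}\,l_j\big(l_i(x_{\sigma(1)},\dots,x_{\sigma(i)}),x_{\sigma(i+1)},\dots,x_{\sigma(m)}\big)=0$$ for homogeneous $x_1,\dots,x_m$ ($\epsilon$ = Koszul sign); it is a Lie $n$-algebra if it is concentrated in degrees $1-n,\dots,0$. An $L_\infty$-morphism $(f_k)_{k\ge1}\colon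 L\to L'$ consists of graded skew-symmetric multilinear maps $f_k\colon L^{\otimes k}\to L'$ of degree $1-k$ whose induced morphism of reduced symmetric coalgebras on the desuspensions $s^{-1}L\to s^{-1}L'$ commutes with the codifferentials given by the brackets. A Lie algebra is an $L_\infty$-algebra concentrated in degree $0$, and a degree-$0$ linear map commuting with all brackets is a strict $L_\infty$-morphism ($f_k=0$ for $k\ge2$). Then $\widehat{\mathfrak g}$ and $\mathsf{Ham}_\infty(M,\omega)$ are Lie $n$-algebras, the maps $\pi^{\mathfrak g}$, $\pi$ and $v_-$ are strict $L_\infty$-morphisms, and there exists an $L_\infty$-morphism $(f_k)\colon\widehat{\mathfrak g}\to\mathsf{Ham}_\infty(M,\omega)$ such that, strictly as $L_\infty$-morphisms $\widehat{\mathfrak g}\to\mathfrak X_{\mathrm{Ham}}(M)$, $$\pi\circ(f_k)=v_-\circ\pi^{\mathfrak g}.$$ -/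

import Mathlib

noncomputable section

namespace NPlectic

section Forms

variable {A : Type*} [CommRing A] [Algebra ℝ A]

/-- Vector fields on the "space" with algebra of functions `A`: the derivations of `A`. -/
abbrev VF (A : Type*) [CommRing A] [Algebra ℝ A] : Type _ := Derivation ℝ A A

/-- Differential forms of degree `k`: alternating `A`-multilinear maps `VF A ^ k → A`. -/
abbrev Form (A : Type*) [CommRing A] [Algebra ℝ A] (k : ℕ) : Type _ := (VF A) [⋀^Fin k]→ₗ[A] A

/-- Interior product: `(ι_X α)(Y₁, …, Y_k) = α(X, Y₁, …, Y_k)`. -/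
def iota {k : ℕ} (X : VF A) (α : Form A (k + 1)) : Form A k := α.curryLeft X

lemma iota_apply {k : ℕ} (X : VF A) (α : Form A (k + 1)) (Y : Fin k → VF A) :
    iota X α Y = α (Fin.cons X Y) := rfl

lemma iota_add_left {k : ℕ} (X X' : VF A) (α : Form A (k + 1)) :
    iota (X + X') α = iota X α + iota X' α := by simp [iota]

lemma iota_smul_left {k : ℕ} (f : A) (X : VF A) (α : Form A (k + 1)) :
    iota (f • X) α = f • iota X α := by simp [iota]

lemma iota_add {k : ℕ} (X : VF A) (α β : Form A (k + 1)) :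
    iota X (α + β) = iota X α + iota X β := rfl

lemma iota_sub {k : ℕ} (X : VF A) (α β : Form A (k + 1)) :
    iota X (α - β) = iota X α - iota X β := rfl

lemma iota_smul {k : ℕ} (f : A) (X : VF A) (α : Form A (k + 1)) :
    iota X (f • α) = f • iota X α := rfl

lemma iota_iota_self {k : ℕ} (X : VF A) (α : Form A (k + 2)) : iota X (iota X α) = 0 :=
  AlternatingMap.curryLeft_same α X

lemma iota_iota_comm {k : ℕ} (X Y : VF A) (α : Form A (k + 2)) :
    iota X (iota Y α) = - iota Y (iota X α) := by
  have h := iota_iota_self (X + Y) α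
  simp only [iota_add_left, iota_add, iota_iota_self, zero_add, add_zero] at h
  exact eq_neg_of_add_eq_zero_right h

lemma form_ext {k : ℕ} {α β : Form A (k + 1)} (h : ∀ X, iota X α = iota X β) : α = β := by
  ext Y
  have := congrArg (fun γ : Form A k => γ (Fin.tail Y)) (h (Y 0))
  simpa [iota_apply] using this

lemma lie_smul_VF (X Y : VF A) (f : A) : ⁅X, f • Y⁆ = (X f) • Y + f • ⁅X, Y⁆ := by
  ext g
  simp only [Derivation.commutator_apply, Derivation.smul_apply, Derivation.leibniz,
    Derivation.add_apply, smul_eq_mul]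
  ring

lemma smul_lie_VF (X Y : VF A) (f : A) : ⁅f • X, Y⁆ = f • ⁅X, Y⁆ - (Y f) • X := by
  ext g
  simp only [Derivation.commutator_apply, Derivation.smul_apply, Derivation.leibniz,
    Derivation.sub_apply, smul_eq_mul]
  ring

/-- Lie derivative of a form along a vector field:
`(L_X α)(Y₁, …, Y_k) = X (α(Y₁, …, Y_k)) - ∑ i, α(Y₁, …, [X, Y_i], …, Y_k)`. -/
def lieDeriv {k : ℕ} (X : VF A) (α : Form A k) : Form A k where
  toFun Y := X (α Y) - ∑ i, α (Function.update Y i ⁅X, Y i⁆)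
  map_update_add' Y i a b := by
    rename_i inst
    obtain rfl : inst = instDecidableEqFin k := Subsingleton.elim _ _
    rw [← Finset.add_sum_erase _ _ (Finset.mem_univ i),
      ← Finset.add_sum_erase _ _ (Finset.mem_univ i),
      ← Finset.add_sum_erase _ _ (Finset.mem_univ i)]
    have h : ∀ c : VF A, ∑ j ∈ Finset.univ.erase i,
        α (Function.update (Function.update Y i c) j ⁅X, Function.update Y i c j⁆) =
        ∑ j ∈ Finset.univ.erase i, α (Function.update (Function.update Y j ⁅X, Y j⁆) i c) := by
      intro c
      refine Finset.sum_congr rfl fun j hj => ?_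
      have hj' : j ≠ i := Finset.ne_of_mem_erase hj
      rw [Function.update_of_ne hj', Function.update_comm hj']
    simp only [h, Function.update_self, Function.update_idem, lie_add, AlternatingMap.map_update_add,
      Finset.sum_add_distrib, map_add]
    ring
  map_update_smul' Y i f a := by
    rename_i inst
    obtain rfl : inst = instDecidableEqFin k := Subsingleton.elim _ _
    rw [← Finset.add_sum_erase _ _ (Finset.mem_univ i),
      ← Finset.add_sum_erase _ _ (Finset.mem_univ i)]
    have h : ∀ c : VF A, ∑ j ∈ Finset.univ.erase i,
        α (Function.update (Function.update Y i c) j ⁅X, Function.update Y i c j⁆) =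
        ∑ j ∈ Finset.univ.erase i, α (Function.update (Function.update Y j ⁅X, Y j⁆) i c) := by
      intro c
      refine Finset.sum_congr rfl fun j hj => ?_
      have hj' : j ≠ i := Finset.ne_of_mem_erase hj
      rw [Function.update_of_ne hj', Function.update_comm hj']
    simp only [h, Function.update_self, Function.update_idem, lie_smul_VF,
      AlternatingMap.map_update_add, AlternatingMap.map_update_smul, Derivation.leibniz,
      smul_eq_mul, ← Finset.mul_sum]
    ring
  map_eq_zero_of_eq' Y i j hY hij := by
    rw [α.map_eq_zero_of_eq Y hY hij, map_zero, zero_sub, neg_eq_zero,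
      ← Finset.add_sum_erase _ _ (Finset.mem_univ i),
      ← Finset.add_sum_erase _ _ (Finset.mem_erase.2 ⟨hij.symm, Finset.mem_univ j⟩),
      Finset.sum_eq_zero, add_zero]
    · have : Function.update Y j ⁅X, Y j⁆ = Function.update Y i ⁅X, Y i⁆ ∘ Equiv.swap i j := by
        ext1 l
        rcases eq_or_ne l i with rfl | hli
        · simp [hij, hij.symm, hY]
        · rcases eq_or_ne l j with rfl | hlj
          · simp [hY]
          · simp [Equiv.swap_apply_of_ne_of_ne hli hlj, hli, hlj]
      rw [this, α.map_swap _ hij, add_neg_cancel]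
    · intro l hl
      simp only [Finset.mem_erase, Finset.mem_univ, and_true] at hl
      refine α.map_eq_zero_of_eq _ ?_ hij
      rw [Function.update_of_ne hl.2.symm, Function.update_of_ne hl.1.symm, hY]

lemma lieDeriv_apply {k : ℕ} (X : VF A) (α : Form A k) (Y : Fin k → VF A) :
    lieDeriv X α Y = X (α Y) - ∑ i, α (Function.update Y i ⁅X, Y i⁆) := rfl

lemma lieDeriv_add {k : ℕ} (X : VF A) (α β : Form A k) :
    lieDeriv X (α + β) = lieDeriv X α + lieDeriv X β := by
  ext Y; simp [lieDeriv_apply, Finset.sum_add_distrib]; ring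

lemma lieDeriv_smul {k : ℕ} (X : VF A) (r : ℝ) (α : Form A k) :
    lieDeriv X (r • α) = r • lieDeriv X α := by
  ext Y; simp [lieDeriv_apply, Finset.smul_sum, smul_sub]

lemma lieDeriv_add_left {k : ℕ} (X X' : VF A) (α : Form A k) :
    lieDeriv (X + X') α = lieDeriv X α + lieDeriv X' α := by
  ext Y; simp [lieDeriv_apply, Finset.sum_add_distrib]; ring

/-- `ι_Y L_X = L_X ι_Y - ι_[X,Y]`. -/
lemma iota_lieDeriv {k : ℕ} (X Y : VF A) (α : Form A (k + 1)) :
    iota Y (lieDeriv X α) = lieDeriv X (iota Y α) - iota ⁅X, Y⁆ α := by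
  ext Z
  simp only [iota_apply, lieDeriv_apply, AlternatingMap.sub_apply, Fin.sum_univ_succ,
    Fin.cons_zero, Fin.cons_succ, Fin.update_cons_zero, Fin.cons_update]
  ring

lemma update_eq_insertNth_removeNth {k : ℕ} (α : Form A (k + 1)) (Y : Fin (k + 1) → VF A)
    (i : Fin (k + 1)) (X : VF A) :
    α (Function.update Y i X) = (-1) ^ (i : ℕ) * α (Fin.cons X (i.removeNth Y)) := by
  rw [← Fin.insertNth_removeNth i X Y, α.map_insertNth]
  rcases neg_one_pow_eq_or ℤ (i : ℕ) with h | h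
  · rcases neg_one_pow_eq_or A (i : ℕ) with h' | h' <;>
    simp [Matrix.vecCons]
  · simp [Matrix.vecCons]

lemma lieDeriv_smul_left {k : ℕ} (f : A) (X : VF A) (α : Form A (k + 1))
    (Y : Fin (k + 1) → VF A) :
    lieDeriv (f • X) α Y = f * lieDeriv X α Y +
      ∑ i : Fin (k + 1), (-1) ^ (i : ℕ) * (Y i f * α (Fin.cons X (i.removeNth Y))) := by
  simp only [lieDeriv_apply, smul_lie_VF, Derivation.smul_apply, smul_eq_mul]
  simp only [sub_eq_add_neg, ← neg_smul, AlternatingMap.map_update_add,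
    AlternatingMap.map_update_smul, Finset.sum_add_distrib, update_eq_insertNth_removeNth α Y _ X,
    smul_eq_mul, mul_add, Finset.mul_sum, neg_add, neg_mul, Finset.sum_neg_distrib, neg_neg,
    mul_neg]
  rw [add_assoc]
  congr 2
  exact Finset.sum_congr rfl fun i _ => by ring

lemma lieDeriv_fsmul {k : ℕ} (f : A) (X : VF A) (α : Form A k) :
    lieDeriv X (f • α) = X f • α + f • lieDeriv X α := by
  ext Y
  simp only [lieDeriv_apply, AlternatingMap.smul_apply, AlternatingMap.add_apply, smul_eq_mul,
    Derivation.leibniz, mul_sub, Finset.mul_sum]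
  ring

/-- The Leibniz rule `d(f α) = f dα + df ∧ α`, evaluated on vector fields. -/
def IsLeibniz {k : ℕ} (D : Form A k →ₗ[ℝ] Form A (k + 1)) : Prop :=
  ∀ (f : A) (α : Form A k) (Y : Fin (k + 1) → VF A),
    D (f • α) Y = f * D α Y + ∑ i : Fin (k + 1), (-1) ^ (i : ℕ) * (Y i f * α (i.removeNth Y))

/-- Build a form of degree `k + 1` from its contractions. -/
def uncurryForm {k : ℕ} (φ : VF A →ₗ[A] Form A k)
    (h : ∀ (X : VF A) (Y : Fin k → VF A) (i : Fin k), Y i = X → φ X Y = 0) : Form A (k + 1) where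
  toFun Y := φ (Y 0) (Fin.tail Y)
  map_update_add' Y i a b := by
    rename_i inst
    obtain rfl : inst = instDecidableEqFin (k + 1) := Subsingleton.elim _ _
    refine Fin.cases ?_ (fun i => ?_) i
    · simp
    · have h0 : ∀ c : VF A, Function.update Y i.succ c 0 = Y 0 :=
        fun c => Function.update_of_ne (Fin.succ_ne_zero i).symm _ _
      simp [Fin.tail_update_succ, h0]
  map_update_smul' Y i f a := by
    rename_i inst
    obtain rfl : inst = instDecidableEqFin (k + 1) := Subsingleton.elim _ _
    refine Fin.cases ?_ (fun i => ?_) i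
    · simp
    · have h0 : ∀ c : VF A, Function.update Y i.succ c 0 = Y 0 :=
        fun c => Function.update_of_ne (Fin.succ_ne_zero i).symm _ _
      simp [Fin.tail_update_succ, h0]
  map_eq_zero_of_eq' Y i j hY hij := by
    induction i using Fin.cases with
    | zero =>
      induction j using Fin.cases with
      | zero => exact absurd rfl hij
      | succ j => exact h _ _ j hY.symm
    | succ i =>
      induction j using Fin.cases with
      | zero => exact h _ _ i hY
      | succ j => exact (φ (Y 0)).map_eq_zero_of_eq _ (i := i) (j := j) hY (by simpa using hij)

lemma iota_uncurryForm {k : ℕ} (φ : VF A →ₗ[A] Form A k) (h) (X : VF A) :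
    iota X (uncurryForm φ h) = φ X := by
  ext Y; simp [iota_apply, uncurryForm]

lemma form_eq_zero_of_iota {k : ℕ} {X : VF A} {α : Form A (k + 1)} (h : iota X α = 0)
    (Y : Fin (k + 1) → VF A) (i : Fin (k + 1)) (hi : Y i = X) : α Y = 0 := by
  have h1 : α (Function.update Y i X) = 0 := by
    rw [update_eq_insertNth_removeNth, ← iota_apply, h]; simp
  rwa [← hi, Function.update_eq_self] at h1

/-- Data of the exterior derivative in degree `k`, with the properties needed for the recursion. -/
def IsGoodD {k : ℕ} (D : Form A k →ₗ[ℝ] Form A (k + 1)) : Prop :=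
  IsLeibniz D ∧ ∀ (X : VF A) (α : Form A (k + 1)), iota X (D (iota X α)) = lieDeriv X (iota X α)


/-- In degree `0`: `df (X) = X f`. -/
def extDZero : Form A 0 →ₗ[ℝ] Form A 1 where
  toFun α := uncurryForm
    { toFun := fun X => lieDeriv X α
      map_add' := fun X X' => lieDeriv_add_left X X' α
      map_smul' := fun f X => by ext Y; simp [lieDeriv_apply] }
    (fun _ _ i _ => i.elim0)
  map_add' α β := form_ext fun X => lieDeriv_add X α β
  map_smul' r α := form_ext fun X => lieDeriv_smul X r α

lemma iota_extDZero (X : VF A) (α : Form A 0) : iota X (extDZero α) = lieDeriv X α :=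
  AlternatingMap.ext fun _ => rfl

lemma isGoodD_extDZero : IsGoodD (extDZero (A := A)) := by
  refine ⟨fun f α Y => ?_, fun X α => iota_extDZero X _⟩
  have h := fun β : Form A 0 => congrArg (fun γ : Form A 0 => γ (Fin.tail Y))
    (iota_extDZero (Y 0) β)
  simp only [iota_apply, Fin.cons_self_tail] at h
  rw [h, h, Fin.sum_univ_one, lieDeriv_fsmul, Fin.removeNth_zero]
  simp only [AlternatingMap.add_apply, AlternatingMap.smul_apply, smul_eq_mul, Fin.val_zero,
    pow_zero, one_mul]
  ring

/-- From degree `k` to degree `k + 1`: `ι_X (dα) = L_X α - d (ι_X α)`. -/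
def extDSucc {k : ℕ} (D : Form A k →ₗ[ℝ] Form A (k + 1)) (hD : IsGoodD D) :
    Form A (k + 1) →ₗ[ℝ] Form A (k + 2) where
  toFun α := uncurryForm
    { toFun := fun X => lieDeriv X α - D (iota X α)
      map_add' := fun X X' => by
        rw [lieDeriv_add_left, iota_add_left, map_add]; abel
      map_smul' := fun f X => by
        ext Y
        simp only [AlternatingMap.sub_apply, lieDeriv_smul_left, iota_smul_left, hD.1 f,
          iota_apply, RingHom.id_apply, AlternatingMap.smul_apply, smul_eq_mul]
        ring }
    (fun X Y i hi => form_eq_zero_of_iota (X := X) (by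
      change iota X (lieDeriv X α - D (iota X α)) = 0
      rw [iota_sub, hD.2, iota_lieDeriv, lie_self]
      ext; simp [iota_apply, AlternatingMap.map_coord_zero α (0 : Fin (k + 1))]) Y i hi)
  map_add' α β := form_ext fun X => by
    change lieDeriv X (α + β) - D (iota X (α + β)) =
      (lieDeriv X α - D (iota X α)) + (lieDeriv X β - D (iota X β))
    rw [lieDeriv_add, iota_add, map_add]; abel
  map_smul' r α := form_ext fun X => by
    change lieDeriv X (r • α) - D (r • iota X α) = r • (lieDeriv X α - D (iota X α))
    rw [lieDeriv_smul, map_smul, smul_sub]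

lemma iota_extDSucc {k : ℕ} (D : Form A k →ₗ[ℝ] Form A (k + 1)) (hD : IsGoodD D) (X : VF A)
    (α : Form A (k + 1)) : iota X (extDSucc D hD α) = lieDeriv X α - D (iota X α) :=
  AlternatingMap.ext fun _ => rfl

lemma isGoodD_extDSucc {k : ℕ} (D : Form A k →ₗ[ℝ] Form A (k + 1)) (hD : IsGoodD D) :
    IsGoodD (extDSucc D hD) := by
  refine ⟨fun f α Y => ?_, fun X α => by rw [iota_extDSucc, iota_iota_self, map_zero, sub_zero]⟩
  have h := fun β : Form A (k + 1) => congrArg (fun γ : Form A (k + 1) => γ (Fin.tail Y))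
    (iota_extDSucc D hD (Y 0) β)
  simp only [iota_apply, Fin.cons_self_tail] at h
  have h2 : ∀ i : Fin (k + 1), i.succ.removeNth Y = Fin.cons (Y 0) (i.removeNth (Fin.tail Y)) := by
    intro i
    ext1 j
    refine Fin.cases ?_ (fun j => ?_) j
    · simp [Fin.removeNth]
    · simp [Fin.removeNth, Fin.tail]
  rw [h, h, Fin.sum_univ_succ]
  simp only [AlternatingMap.sub_apply, iota_smul, hD.1 f, lieDeriv_fsmul, iota_apply, h2,
    AlternatingMap.add_apply, AlternatingMap.smul_apply, smul_eq_mul, Fin.val_succ, pow_succ,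
    Fin.val_zero, Fin.removeNth_zero]
  simp only [Fin.tail, mul_neg, mul_one, neg_mul, Finset.sum_neg_distrib, pow_zero, one_mul]
  ring

/-- The exterior derivatives, built degree by degree. -/
def extDAux : (k : ℕ) → {D : Form A k →ₗ[ℝ] Form A (k + 1) // IsGoodD D}
  | 0 => ⟨extDZero, isGoodD_extDZero⟩
  | k + 1 => ⟨extDSucc (extDAux k).1 (extDAux k).2, isGoodD_extDSucc _ _⟩

/-- The exterior derivative `d : Ω^k → Ω^(k+1)`. It is the operator with `(df)(X) = X f` for
functions and `ι_X dα = L_X α - d ι_X α` (Cartan's formula) in positive degree. -/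
def extD (k : ℕ) : Form A k →ₗ[ℝ] Form A (k + 1) := (extDAux k).1

lemma iota_extD_zero (X : VF A) (α : Form A 0) : iota X (extD 0 α) = lieDeriv X α :=
  iota_extDZero X α

lemma iota_extD_succ {k : ℕ} (X : VF A) (α : Form A (k + 1)) :
    iota X (extD (k + 1) α) = lieDeriv X α - extD k (iota X α) :=
  iota_extDSucc (extDAux k).1 (extDAux k).2 X α

lemma lieDeriv_sub {k : ℕ} (X : VF A) (α β : Form A k) :
    lieDeriv X (α - β) = lieDeriv X α - lieDeriv X β := by
  ext Y; simp [lieDeriv_apply, Finset.sum_sub_distrib]; ring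

lemma lieDeriv_lie {k : ℕ} (X Y : VF A) (α : Form A k) :
    lieDeriv ⁅X, Y⁆ α = lieDeriv X (lieDeriv Y α) - lieDeriv Y (lieDeriv X α) := by
  induction k with
  | zero => ext Z; simp [lieDeriv_apply, Derivation.commutator_apply]
  | succ k ih =>
    refine form_ext fun Z => ?_
    have hl : ⁅⁅X, Y⁆, Z⁆ = ⁅X, ⁅Y, Z⁆⁆ - ⁅Y, ⁅X, Z⁆⁆ := lie_lie X Y Z
    have hs : iota (⁅X, ⁅Y, Z⁆⁆ - ⁅Y, ⁅X, Z⁆⁆) α = iota ⁅X, ⁅Y, Z⁆⁆ α - iota ⁅Y, ⁅X, Z⁆⁆ α := by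
      simp [iota]
    simp only [iota_sub, iota_lieDeriv, ih, lieDeriv_sub, hl, hs]
    abel

lemma lieDeriv_extD {k : ℕ} (X : VF A) (α : Form A k) :
    lieDeriv X (extD k α) = extD k (lieDeriv X α) := by
  induction k with
  | zero =>
    refine form_ext fun Y => ?_
    rw [iota_lieDeriv, iota_extD_zero, iota_extD_zero, iota_extD_zero, lieDeriv_lie]
    abel
  | succ k ih =>
    refine form_ext fun Y => ?_
    rw [iota_lieDeriv, iota_extD_succ, iota_extD_succ, iota_extD_succ, lieDeriv_lie, iota_lieDeriv,
      map_sub, ← ih, lieDeriv_sub]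
    abel

lemma extD_extD {k : ℕ} (α : Form A k) : extD (k + 1) (extD k α) = 0 := by
  induction k with
  | zero =>
    refine form_ext fun X => ?_
    rw [iota_extD_succ, iota_extD_zero, lieDeriv_extD, sub_self]; rfl
  | succ k ih =>
    refine form_ext fun X => ?_
    rw [iota_extD_succ, iota_extD_succ, map_sub, ih, lieDeriv_extD, sub_zero, sub_self]; rfl

lemma iota_smul_left_real {k : ℕ} (r : ℝ) (X : VF A) (α : Form A (k + 1)) :
    iota (r • X) α = r • iota X α := by
  have h : r • X = (algebraMap ℝ A r) • X := by
    ext g; simp [Algebra.smul_def]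
  rw [h, iota_smul_left]
  ext Y; simp [Algebra.smul_def]

lemma iota_neg {k : ℕ} (X : VF A) (α : Form A (k + 1)) : iota X (-α) = -iota X α := rfl

lemma extD_iota_iota {k : ℕ} (ω : Form A (k + 2)) (hω : extD _ ω = 0) (X Y : VF A)
    (hX : extD _ (iota X ω) = 0) (hY : extD _ (iota Y ω) = 0) :
    extD k (iota Y (iota X ω)) = - iota ⁅X, Y⁆ ω := by
  have hLX : lieDeriv X ω = 0 := by
    have := iota_extD_succ X ω
    rw [hω, hX, sub_zero] at this
    rw [← this]; rfl
  have h1 := iota_extD_succ Y (iota X ω)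
  have h2 := iota_lieDeriv X Y ω
  have hLY : lieDeriv Y ω = 0 := by
    have := iota_extD_succ Y ω
    rw [hω, hY, sub_zero] at this
    rw [← this]; rfl
  have h3 := iota_lieDeriv Y X ω
  rw [hLY] at h3
  rw [hX] at h1
  have z : ∀ Z : VF A, ∀ j, iota Z (0 : Form A (j + 1)) = 0 := fun _ _ => rfl
  rw [z] at h1 h3
  have h4 : iota ⁅Y, X⁆ ω = - iota ⁅X, Y⁆ ω := by 
    rw [← lie_skew Y X]; simp only [iota, map_neg]
  rw [← sub_eq_zero.1 h1.symm, ← h4, ← sub_eq_zero.1 h3.symm]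

lemma extD_iota_iota_of_hamiltonian {k : ℕ} (ω : Form A (k + 2)) (hω : extD _ ω = 0) {X Y : VF A}
    {α β : Form A k} (hX : extD k α = -iota X ω) (hY : extD k β = -iota Y ω) :
    extD k (iota Y (iota X ω)) = -iota ⁅X, Y⁆ ω := by
  refine extD_iota_iota ω hω X Y ?_ ?_
  · rw [← neg_neg (iota X ω), ← hX, map_neg, extD_extD, neg_zero]
  · rw [← neg_neg (iota Y ω), ← hY, map_neg, extD_extD, neg_zero]

end Forms

/-! ### Graded vector spaces with multibrackets, `L∞`-algebras and their morphisms -/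

section LInfinity

/-- A family of subspaces `gr i = Lⁱ` (`i ∈ ℤ`) of a real vector space `L`, together with maps
`br k = l_k` of `k` arguments. -/
structure MultiBrackets (L : Type*) [AddCommGroup L] [Module ℝ L] where
  gr : ℤ → Submodule ℝ L
  br : (k : ℕ) → (Fin k → L) → L

variable {X : Type*} {L : Type*} [AddCommGroup L] [Module ℝ L] {L' : Type*} [AddCommGroup L']
  [Module ℝ L'] {L'' : Type*} [AddCommGroup L''] [Module ℝ L'']

/-- The Koszul sign `ε(σ; x₁, …, x_m)` of elements of degrees `d₁, …, d_m`, determined by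
`x₁ ⋯ x_m = ε(σ) x_σ(1) ⋯ x_σ(m)` in the free graded commutative algebra. -/
def koszulSign {m : ℕ} (σ : Equiv.Perm (Fin m)) (d : Fin m → ℤ) : ℤˣ :=
  ∏ a, ∏ b, if a < b ∧ σ b < σ a then (d (σ a) * d (σ b)).negOnePow else 1

/-- The tuple `y` is homogeneous of degrees `d`. -/
def IsHomog {m : ℕ} (gr : ℤ → Submodule ℝ L) (d : Fin m → ℤ) (x : Fin m → L) : Prop :=
  ∀ a, x a ∈ gr (d a)

/-- Multilinearity of a map of `k` arguments. -/
def IsMultilin {k : ℕ} (f : (Fin k → L) → L') : Prop :=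
  ∃ φ : MultilinearMap ℝ (fun _ : Fin k => L) L', ∀ x, f x = φ x

/-- Graded skew-symmetry: `f(x_σ(1), …, x_σ(k)) = (-1)^σ ε(σ) f(x₁, …, x_k)`. -/
def IsGradedSkew (gr : ℤ → Submodule ℝ L) {k : ℕ} (f : (Fin k → L) → L') : Prop :=
  ∀ (d : Fin k → ℤ) (x : Fin k → L), IsHomog gr d x → ∀ σ : Equiv.Perm (Fin k),
    f (x ∘ σ) = (Equiv.Perm.sign σ * koszulSign σ d) • f x

/-- `f` has degree `r`. -/
def HasDegree (gr : ℤ → Submodule ℝ L) (gr' : ℤ → Submodule ℝ L') {k : ℕ}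
    (f : (Fin k → L) → L') (r : ℤ) : Prop :=
  ∀ (d : Fin k → ℤ) (x : Fin k → L), IsHomog gr d x → f x ∈ gr' (∑ a, d a + r)

/-- The first `i` entries of a tuple. -/
def headArgs {m i : ℕ} (h : i ≤ m) (y : Fin m → X) : Fin i → X := fun a => y (Fin.castLE h a)

/-- The entries of a tuple after the first `i` ones. -/
def tailArgs {m i : ℕ} (h : i ≤ m) (y : Fin m → X) : Fin (m - i) → X :=
  fun b => y (Fin.cast (Nat.add_sub_cancel' h) (Fin.natAdd i b))

/-- The `(i, m - i)`-unshuffles: permutations increasing on the first `i` and on the last `m - i`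
indices. -/
def unshuffles (i m : ℕ) : Finset (Equiv.Perm (Fin m)) :=
  {σ | ∀ a b : Fin m, a < b → (b.val < i ∨ i ≤ a.val) → σ a < σ b}

/-- The `(k₁, …, k_p)`-unshuffles for a composition `m = k₁ + ⋯ + k_p`: permutations increasing on
each of the consecutive blocks of sizes `k₁, …, k_p`. -/
def blockUnshuffles {m : ℕ} (c : Composition m) : Finset (Equiv.Perm (Fin m)) :=
  {σ | ∀ (b : Fin c.length) (a a' : Fin (c.blocksFun b)), a < a' →
    σ (c.embedding b a) < σ (c.embedding b a')}

/-- The structure `(L, l_k)` is an `L∞`-algebra: `L = ⨁ Lⁱ`, the `l_k` (`k ≥ 1`) are multilinear,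
graded skew-symmetric of degree `2 - k`, and for every `m ≥ 1` the generalized Jacobi identity
`∑_{i+j=m+1} ∑_{σ ∈ Sh(i,m-i)} (-1)^σ ε(σ) (-1)^{i(j-1)}
  l_j(l_i(x_σ(1), …, x_σ(i)), x_σ(i+1), …, x_σ(m)) = 0` holds (below `i` is `i + 1`). -/
structure IsLInfinityAlgebra (𝓛 : MultiBrackets L) : Prop where
  internal : DirectSum.IsInternal 𝓛.gr
  multilinear : ∀ k, 1 ≤ k → IsMultilin (𝓛.br k)
  degree : ∀ k, 1 ≤ k → HasDegree 𝓛.gr 𝓛.gr (𝓛.br k) (2 - k)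
  skew : ∀ k, 1 ≤ k → IsGradedSkew 𝓛.gr (𝓛.br k)
  jacobi : ∀ m, 1 ≤ m → ∀ (d : Fin m → ℤ) (x : Fin m → L), IsHomog 𝓛.gr d x →
    ∑ i : Fin m, ∑ σ ∈ unshuffles (i + 1) m,
      (Equiv.Perm.sign σ * koszulSign σ d * (((i : ℤ) + 1) * ((m - (i + 1) : ℕ) : ℤ)).negOnePow) •
        𝓛.br (m - (i + 1) + 1)
          (Fin.cons (𝓛.br (i + 1) (headArgs i.isLt (x ∘ σ))) (tailArgs i.isLt (x ∘ σ))) = 0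

/-- A Lie `n`-algebra: an `L∞`-algebra concentrated in degrees `0, -1, …, 1 - n`. -/
structure IsLieNAlgebra (n : ℕ) (𝓛 : MultiBrackets L) : Prop extends IsLInfinityAlgebra 𝓛 where
  concentrated : ∀ i : ℤ, (0 < i ∨ i < 1 - n) → 𝓛.gr i = ⊥

/-- The sign relating a `k`-ary graded skew-symmetric map `f` on `L` to the graded symmetric map
`(-1)^{k(k-1)/2} s⁻¹ ∘ f ∘ s^{⊗k}` on the desuspension `s⁻¹L`: the latter sends
`s⁻¹x₁ ⊙ ⋯ ⊙ s⁻¹x_k` to `(-1)^{∑ a, (k-a) d_a} s⁻¹ f(x₁, …, x_k)`, `d_a` being the degree of `x_a`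
(in the code `a` starts at `0`). -/
def decSign {k : ℕ} (d : Fin k → ℤ) : ℤˣ :=
  ∏ a : Fin k, (((k : ℤ) - 1 - (a : ℤ)) * d a).negOnePow

/-- The corestriction to `s⁻¹L'` of `F ∘ Q`, where `Q` is the coderivation of the reduced symmetric
coalgebra of `s⁻¹L` given by the brackets `l_k` and `F` the coalgebra morphism given by the structure
maps `f_k`, evaluated on `s⁻¹x₁ ⊙ ⋯ ⊙ s⁻¹x_m` with `x_a` of degree `d_a`:
`∑_i ∑_{σ ∈ Sh(i,m-i)} ε(σ) F_{m-i+1}(Q_i(s⁻¹x_σ(1) ⊙ ⋯ ⊙ s⁻¹x_σ(i)) ⊙ s⁻¹x_σ(i+1) ⊙ ⋯ ⊙ s⁻¹x_σ(m))`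
(below `i` is `i + 1`). -/
def morphismLHS (𝓛 : MultiBrackets L) (f : (k : ℕ) → (Fin k → L) → L') {m : ℕ} (d : Fin m → ℤ)
    (x : Fin m → L) : L' :=
  ∑ i : Fin m, ∑ σ ∈ unshuffles (i + 1) m,
    (koszulSign σ (fun a => d a - 1) *
      decSign (headArgs i.isLt (d ∘ σ)) *
      decSign (Fin.cons (∑ a, headArgs i.isLt (d ∘ σ) a + (2 - ((i : ℤ) + 1)))
        (tailArgs i.isLt (d ∘ σ)) : Fin (m - (i + 1) + 1) → ℤ)) •
      f (m - (i + 1) + 1)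
        (Fin.cons (𝓛.br (i + 1) (headArgs i.isLt (x ∘ σ))) (tailArgs i.isLt (x ∘ σ)))

/-- The corestriction to `s⁻¹L''` of `G ∘ F`, where `F` is the coalgebra morphism of reduced symmetric
coalgebras given by structure maps `f_k` of degree `1 - k`, and `G` is a map out of the reduced
symmetric coalgebra of `s⁻¹L'` with components `g_p`, evaluated on `s⁻¹x₁ ⊙ ⋯ ⊙ s⁻¹x_m`:
`∑_{k₁+⋯+k_p=m} ∑_{σ ∈ Sh(k₁,…,k_p)} ε(σ)/p! G_p(F_{k₁}(s⁻¹x_σ(1) ⊙ ⋯) ⊙ ⋯ ⊙ F_{k_p}(⋯ ⊙ s⁻¹x_σ(m)))`.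
For the structure maps `g_p` of an `L∞`-morphism this is the `m`-th structure map of the composite
`L∞`-morphism; for `g_p = l'_p` it is the corestriction of `Q' ∘ F`. -/
def compStructure (g : (k : ℕ) → (Fin k → L') → L'') (f : (k : ℕ) → (Fin k → L) → L') {m : ℕ}
    (d : Fin m → ℤ) (x : Fin m → L) : L'' :=
  ∑ c : Composition m, ((c.length.factorial : ℝ)⁻¹) • ∑ σ ∈ blockUnshuffles c,
    (koszulSign σ (fun a => d a - 1) *
      (∏ b, decSign (fun a => d (σ (c.embedding b a)))) *
      decSign (fun b => ∑ a, d (σ (c.embedding b a)) + (1 - (c.blocksFun b : ℤ)))) •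
      g c.length (fun b => f (c.blocksFun b) (fun a => x (σ (c.embedding b a))))

/-- The maps `f_k : L^{⊗k} → L'` (`k ≥ 1`) are the structure maps of an `L∞`-morphism: they are
multilinear, graded skew-symmetric of degree `1 - k`, and the morphism `F` of graded coalgebras which
they determine satisfies `F ∘ Q = Q' ∘ F`. -/
structure IsLInfinityMorphism (𝓛 : MultiBrackets L) (𝓛' : MultiBrackets L')
    (f : (k : ℕ) → (Fin k → L) → L') : Prop where
  multilinear : ∀ k, 1 ≤ k → IsMultilin (f k)
  degree : ∀ k, 1 ≤ k → HasDegree 𝓛.gr 𝓛'.gr (f k) (1 - k)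
  skew : ∀ k, 1 ≤ k → IsGradedSkew 𝓛.gr (f k)
  compat : ∀ m, 1 ≤ m → ∀ (d : Fin m → ℤ) (x : Fin m → L), IsHomog 𝓛.gr d x →
    morphismLHS 𝓛 f d x = compStructure 𝓛'.br f d x

/-- A strict morphism: a degree `0` linear map with `l'_k ∘ φ^{⊗k} = φ ∘ l_k` for all `k ≥ 1`. -/
def IsStrictMorphism (𝓛 : MultiBrackets L) (𝓛' : MultiBrackets L') (φ : L →ₗ[ℝ] L') : Prop :=
  (∀ i, ∀ x ∈ 𝓛.gr i, φ x ∈ 𝓛'.gr i) ∧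
    ∀ k, 1 ≤ k → ∀ x : Fin k → L, 𝓛'.br k (φ ∘ x) = φ (𝓛.br k x)

/-- The structure maps of a strict morphism: `f₁ = φ` and `f_k = 0` for `k ≥ 2`. -/
def strictMaps (φ : L →ₗ[ℝ] L') : (k : ℕ) → (Fin k → L) → L'
  | 1, x => φ (x 0)
  | _, _ => 0

/-- A Lie algebra as an `L∞`-algebra concentrated in degree `0`. -/
def ofLieAlgebra (𝔤 : Type*) [LieRing 𝔤] [LieAlgebra ℝ 𝔤] : MultiBrackets 𝔤 where
  gr i := if i = 0 then ⊤ else ⊥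
  br
    | 2, x => ⁅x 0, x 1⁆
    | _, _ => 0

/-- The central `n`-extension of `𝔤` by a cochain `c` of degree `n + 1`: `𝔤` in degree `0`, `ℝ` in
degree `1 - n`, with `l₂ = [·,·]`, `l_{n+1} = c` and all other brackets zero (for `n = 1` the two
brackets add up). -/
def centralExtension (n : ℕ) {𝔤 : Type*} [LieRing 𝔤] [LieAlgebra ℝ 𝔤]
    (c : 𝔤 [⋀^Fin (n + 1)]→ₗ[ℝ] ℝ) : MultiBrackets (𝔤 × ℝ) where
  gr i := Submodule.prod (if i = 0 then ⊤ else ⊥) (if i = 1 - (n : ℤ) then ⊤ else ⊥)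
  br k x :=
    ((ofLieAlgebra 𝔤).br k (fun a => (x a).1),
      if h : k = n + 1 then c (fun a => (x (Fin.cast h.symm a)).1) else 0)

end LInfinity

section Observables

variable {A : Type*} [CommRing A] [Algebra ℝ A]

/-- The Lie algebra `𝔛_Ham` of Hamiltonian vector fields of a closed form `ω`: those `v` for which
there is `α` with `dα = -ι_v ω`. -/
def hamVectorFields {m : ℕ} (ω : Form A (m + 2)) (hω : extD (m + 2) ω = 0) :
    LieSubalgebra ℝ (VF A) where
  carrier := {v | ∃ α : Form A m, extD m α = -iota v ω}
  add_mem' := by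
    rintro v w ⟨α, hα⟩ ⟨β, hβ⟩
    exact ⟨α + β, by rw [map_add, hα, hβ, iota_add_left]; abel⟩
  zero_mem' := ⟨0, by rw [map_zero]; ext; simp [iota]⟩
  smul_mem' := by
    rintro r v ⟨α, hα⟩
    exact ⟨r • α, by rw [map_smul, hα, iota_smul_left_real, smul_neg]⟩
  lie_mem' := by
    rintro v w ⟨α, hα⟩ ⟨β, hβ⟩
    exact ⟨iota w (iota v ω), extD_iota_iota_of_hamiltonian ω hω hα hβ⟩

/-- The degree `0` part of the Lie `n`-algebra of observables: pairs `(v, α)` with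
`dα = -ι_v ω` (here `ω` has degree `n + 1 = m + 2` and `α` has degree `n - 1 = m`). -/
def hamPairs {m : ℕ} (ω : Form A (m + 2)) : Submodule ℝ (VF A × Form A m) where
  carrier := {x | extD m x.2 = -iota x.1 ω}
  add_mem' := by
    intro x y hx hy
    simp only [Set.mem_ofPred_eq, Prod.fst_add, Prod.snd_add, map_add, iota_add_left] at *
    rw [hx, hy]; abel
  zero_mem' := by
    simp only [Set.mem_ofPred_eq, Prod.fst_zero, Prod.snd_zero, map_zero]
    ext; simp [iota]
  smul_mem' := by
    intro r x hx
    simp only [Set.mem_ofPred_eq, Prod.smul_fst, Prod.smul_snd, map_smul,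
      iota_smul_left_real] at *
    rw [hx, smul_neg]

/-- Contraction with several vector fields: `ι(v₁ ∧ ⋯ ∧ v_k) α = ι_{v_k} ⋯ ι_{v₁} α`. -/
def iotaMulti {j : ℕ} : (k : ℕ) → (Fin k → VF A) → Form A (j + k) → Form A j
  | 0, _, α => α
  | k + 1, v, α => iotaMulti k (Fin.tail v) (iota (v 0) α)

/-- The sign `ς(k) = -(-1)^{k(k+1)/2}`. -/
def varsig (k : ℕ) : ℝ := -(-1) ^ (k * (k + 1) / 2)

/-- The sum of the degrees `< n - 1` of the space of observables: `⨁_{0 ≤ j < m} Ω^j`, with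
`m = n - 1`. -/
abbrev LowForms (A : Type*) [CommRing A] [Algebra ℝ A] (m : ℕ) : Type _ := (j : Fin m) → Form A j

/-- `d : Ω^{m-1} → Ω^m` on the top component of `LowForms A m`. -/
def dTop : (m : ℕ) → LowForms A m → Form A m
  | 0, _ => 0
  | m + 1, β => extD m (β (Fin.last m))

/-- `d` on the lower components of `LowForms A m`: the component of degree `j + 1` is `d β_j`. -/
def dLow {m : ℕ} (β : LowForms A m) : LowForms A m
  | ⟨0, _⟩ => 0
  | ⟨j + 1, h⟩ => extD j (β ⟨j, Nat.lt_of_succ_lt h⟩)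

lemma extD_dTop (m : ℕ) (β : LowForms A m) : extD m (dTop m β) = 0 := by
  cases m with
  | zero => simp [dTop]
  | succ m => exact extD_extD _

/-- The Lie `n`-algebra of observables `Ham_∞` of a closed form `ω` of degree `n + 1 = m + 2`:
`L⁰ = {(v, α) | dα = -ι_v ω}`, `Lⁱ = Ω^{n-1+i}` for `1 - n ≤ i < 0` (so `Ω^j` has degree `j - m`),
`l₁ = d` in negative degrees (`l₁ = (0, d)` in degree `-1`),
`l₂((v₁, α₁), (v₂, α₂)) = ([v₁, v₂], ι(v₁ ∧ v₂) ω)`, and, for `k ≥ 3`,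
`l_k((v₁, α₁), …, (v_k, α_k)) = ς(k) ι(v₁ ∧ ⋯ ∧ v_k) ω`; brackets `l_k` with `k ≥ 2` vanish as soon as
an argument has negative degree. -/
def observables {m : ℕ} (ω : Form A (m + 2)) (hω : extD (m + 2) ω = 0) :
    MultiBrackets (hamPairs ω × LowForms A m) where
  gr i := Submodule.prod (if i = 0 then ⊤ else ⊥)
    (Submodule.pi Set.univ fun j : Fin m => if ((j : ℕ) : ℤ) - m = i then ⊤ else ⊥)
  br
    | 0, _ => 0
    | 1, x => (⟨(0, dTop m (x 0).2), by
        change extD m (dTop m (x 0).2) = -iota 0 ω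
        rw [extD_dTop]; ext; simp [iota]⟩, dLow (x 0).2)
    | 2, x => (⟨(⁅(x 0).1.1.1, (x 1).1.1.1⁆, iota (x 1).1.1.1 (iota (x 0).1.1.1 ω)),
        extD_iota_iota_of_hamiltonian ω hω (x 0).1.2 (x 1).1.2⟩, 0)
    | k + 3, x => (0, fun j =>
        if h : j + (k + 3) = m + 2 then
          varsig (k + 3) •
            iotaMulti (k + 3) (fun a => (x a).1.1.1) (ω.domDomCongr (finCongr h.symm))
        else 0)

/-- The projection `π : Ham_∞ → 𝔛_Ham`, `(v, α) ↦ v` in degree `0` and zero in lower degrees. -/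
def observablesProj {m : ℕ} (ω : Form A (m + 2)) (hω : extD (m + 2) ω = 0) :
    (hamPairs ω × LowForms A m) →ₗ[ℝ] hamVectorFields ω hω where
  toFun x := ⟨x.1.1.1, x.1.1.2, x.1.2⟩
  map_add' _ _ := rfl
  map_smul' _ _ := rfl

/-- The de Rham cohomology `H^k = ker d / im d` vanishes. -/
def DeRhamVanishes (A : Type*) [CommRing A] [Algebra ℝ A] : ℕ → Prop
  | 0 => ∀ α : Form A 0, extD 0 α = 0 → α = 0
  | k + 1 => ∀ α : Form A (k + 1), extD (k + 1) α = 0 → ∃ β : Form A k, extD k β = α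

end Observables

section Manifold

variable {E : Type*} [NormedAddCommGroup E] [NormedSpace ℝ E] {M : Type*} [TopologicalSpace M]
  [ChartedSpace E M]

/-- The algebra `C^∞(M)` of smooth real functions on a manifold `M` modelled on `E`. On a Hausdorff
second countable finite-dimensional `M`, `VF (Smooth E M)` consists of the smooth vector fields and
`Form (Smooth E M) k` of the smooth differential `k`-forms. -/
abbrev Smooth (E : Type*) [NormedAddCommGroup E] [NormedSpace ℝ E] (M : Type*) [TopologicalSpace M]
    [ChartedSpace E M] : Type _ :=
  ContMDiffMap (modelWithCornersSelf ℝ E) (modelWithCornersSelf ℝ ℝ) M ℝ ((⊤ : ℕ∞) : WithTop ℕ∞)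

/-- Evaluation of smooth functions at `p`. -/
def evalAt (p : M) : Smooth E M →ₗ[ℝ] ℝ where
  toFun f := f p
  map_add' _ _ := rfl
  map_smul' _ _ := rfl

/-- A form as an `ℝ`-multilinear alternating map. -/
def Form.toReal {A : Type*} [CommRing A] [Algebra ℝ A] {k : ℕ} (ω : Form A k) :
    (VF A) [⋀^Fin k]→ₗ[ℝ] A :=
  { ω.toMultilinearMap.restrictScalars ℝ with
    map_eq_zero_of_eq' := fun x _ _ hx hij => ω.map_eq_zero_of_eq x hx hij }

/-- The `(n + 1)`-cochain `c_p(x₁, …, x_{n+1}) = (-1)^n ς(n + 1) ι(v_{x₁} ∧ ⋯ ∧ v_{x_{n+1}}) ω |_p`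
of a Lie algebra acting by `x ↦ v_x` (here `n = m + 1`). -/
def actionCocycle {m : ℕ} (ω : Form (Smooth E M) (m + 2)) (hω : extD (m + 2) ω = 0)
    {𝔤 : Type*} [LieRing 𝔤] [LieAlgebra ℝ 𝔤] (v : 𝔤 →ₗ⁅ℝ⁆ hamVectorFields ω hω) (p : M) :
    𝔤 [⋀^Fin (m + 2)]→ₗ[ℝ] ℝ :=
  ((-1) ^ (m + 1) * varsig (m + 2)) • (evalAt p).compAlternatingMap
    ((Form.toReal ω).compLinearMap
      ((hamVectorFields ω hω).toSubmodule.subtype ∘ₗ (v : 𝔤 →ₗ[ℝ] hamVectorFields ω hω)))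

lemma actionCocycle_apply {m : ℕ} (ω : Form (Smooth E M) (m + 2)) (hω : extD (m + 2) ω = 0)
    {𝔤 : Type*} [LieRing 𝔤] [LieAlgebra ℝ 𝔤] (v : 𝔤 →ₗ⁅ℝ⁆ hamVectorFields ω hω) (p : M)
    (x : Fin (m + 2) → 𝔤) :
    actionCocycle ω hω v p x = (-1) ^ (m + 1) * varsig (m + 2) *
      evalAt p (ω fun a => (v (x a) : VF (Smooth E M))) := rfl

/-- The central `n`-extension `ĝ` of `𝔤` by the cocycle `c_p` (with `n = m + 1`). -/
abbrev actionExtension {m : ℕ} (ω : Form (Smooth E M) (m + 2)) (hω : extD (m + 2) ω = 0)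
    {𝔤 : Type*} [LieRing 𝔤] [LieAlgebra ℝ 𝔤] (v : 𝔤 →ₗ⁅ℝ⁆ hamVectorFields ω hω) (p : M) :
    MultiBrackets (𝔤 × ℝ) :=
  centralExtension (m + 1) (actionCocycle ω hω v p)

end Manifold

end NPlectic
end

/-! Write n = m + 1, δ for the Chevalley–Eilenberg differential `ceD` with trivial coefficients, and
C_k(x₁, …, x_k) = ς(k) ι(v_{x₁} ∧ ⋯ ∧ v_{x_k}) ω, a cochain with values in forms of degree n + 1 -
k. Hamiltonian vector fields preserve ω, so Cartan calculus together with the choice of ς gives d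
C_{k+1} = -δ C_k (`dTot_contraction`, `dTot_varsig_contraction`).

All the structures involved are "grounded": from arity two on, the brackets see only the image of
their arguments in a Lie algebra placed in degree 0, and only l₂ has a nonzero image there. In a
generalized Jacobi identity or a morphism equation of arity at least 3, only the terms with inner
bracket l₂ or outer arity one then survive on the bracket side (`IsGrounded.sum_insertion`), and on
the target side only one block or all blocks of size one (`Covers.compStructure_degree_zero`). The
Jacobi identities become δ φ_k + D φ_{k+1} = 0. For the observables these are d C_{k+1} = -δ C_k and
the Jacobi identity for vector fields; for the central extension they say that the cochain is
closed.

A morphism covering v amounts to cochains F_k with values in Ω^{n-k} such that dF₁ = -C₁, δF_k =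
dF_{k+1} + C_{k+1} for 1 ≤ k < n, and δF_n + (-1)^n c = C_{n+1}, where c is read as a constant
function. They are found recursively (`exists_moment_step`). The form δF_k - C_{k+1} is closed
because of the preceding equation; it is exact by the Hamiltonian condition when k = 0 and by the
vanishing of cohomology when 1 ≤ k < n. Primitives are chosen by a linear section of d, so the
resulting cochain is again alternating. They are normalized: a primitive of degree 0 is made to
vanish at p. In the last equation both sides are functions with the same differential and, by
normalization and the definition of c, the same value at p; on a connected manifold they agree. -/

noncomputable section

namespace NPlectic

/-! ### Chevalley–Eilenberg cochains with trivial coefficients. -/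

section ChevalleyEilenberg

variable {𝔤 : Type*} [LieRing 𝔤] [LieAlgebra ℝ 𝔤] {V : Type*} [AddCommGroup V] [Module ℝ V]
  {V' : Type*} [AddCommGroup V'] [Module ℝ V']

open AlternatingMap

/-- The action of a Lie algebra on cochains, `(a F)(x₁, …, x_k) = ∑ i, F(x₁, …, [a, x_i], …, x_k)`. -/
def adAct : {k : ℕ} → (𝔤 [⋀^Fin k]→ₗ[ℝ] V) → 𝔤 →ₗ[ℝ] 𝔤 [⋀^Fin k]→ₗ[ℝ] V
  | 0, _ => 0
  | _ + 1, F => alternatizeUncurryFinLM ∘ₗ LinearMap.compRight ℝ F.curryLeft ∘ₗ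
      (LieAlgebra.ad ℝ 𝔤 : 𝔤 →ₗ[ℝ] Module.End ℝ 𝔤)

lemma map_update_eq {k : ℕ} (F : 𝔤 [⋀^Fin (k + 1)]→ₗ[ℝ] V) (x : Fin (k + 1) → 𝔤)
    (i : Fin (k + 1)) (y : 𝔤) :
    F (Function.update x i y) = (-1) ^ (i : ℕ) • F (Fin.cons y (i.removeNth x)) := by
  rw [← Fin.insertNth_removeNth i y x, F.map_insertNth]
  rfl

lemma adAct_apply {k : ℕ} (F : 𝔤 [⋀^Fin k]→ₗ[ℝ] V) (a : 𝔤) (x : Fin k → 𝔤) :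
    adAct F a x = ∑ i, F (Function.update x i ⁅a, x i⁆) := by
  cases k with
  | zero => simp [adAct]
  | succ k =>
    simp only [map_update_eq]
    exact alternatizeUncurryFin_apply _ _

lemma adAct_sub {k : ℕ} (F G : 𝔤 [⋀^Fin k]→ₗ[ℝ] V) : adAct (F - G) = adAct F - adAct G := by
  ext a x; simp [adAct_apply]

lemma adAct_smul {k : ℕ} (r : ℝ) (F : 𝔤 [⋀^Fin k]→ₗ[ℝ] V) : adAct (r • F) = r • adAct F := by
  ext a x; simp [adAct_apply, Finset.smul_sum]

/-- The Chevalley–Eilenberg differential with trivial coefficients,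
`(δF)(x₁, …, x_{k+1}) = ∑_{a<b} ± F([x_a, x_b], x₁, …)`, with sign `+` for `a = 1`, `b = 2`. -/
def ceD {k : ℕ} (F : 𝔤 [⋀^Fin k]→ₗ[ℝ] V) : 𝔤 [⋀^Fin (k + 1)]→ₗ[ℝ] V :=
  (1 / 2 : ℝ) • alternatizeUncurryFin (adAct F)

lemma ceD_sub {k : ℕ} (F G : 𝔤 [⋀^Fin k]→ₗ[ℝ] V) : ceD (F - G) = ceD F - ceD G := by
  have h : alternatizeUncurryFin (adAct F - adAct G) = alternatizeUncurryFin (adAct F) -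
    alternatizeUncurryFin (adAct G) := map_sub alternatizeUncurryFinLM (adAct F) (adAct G)
  rw [ceD, adAct_sub, h, smul_sub]; rfl

lemma ceD_smul {k : ℕ} (r : ℝ) (F : 𝔤 [⋀^Fin k]→ₗ[ℝ] V) : ceD (r • F) = r • ceD F := by
  rw [ceD, adAct_smul, alternatizeUncurryFin_smul, smul_comm]; rfl

lemma ceD_zero {k : ℕ} : ceD (0 : 𝔤 [⋀^Fin k]→ₗ[ℝ] V) = 0 := by
  rw [← zero_smul ℝ (0 : 𝔤 [⋀^Fin k]→ₗ[ℝ] V), ceD_smul, zero_smul]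

lemma ceD_of_fin_zero (F : 𝔤 [⋀^Fin 0]→ₗ[ℝ] V) : ceD F = 0 := by
  ext x; simp [ceD, alternatizeUncurryFin_apply, adAct_apply]

/-- Naturality in the coefficients: only the arguments are touched by `ceD`. This is what moves d,
evaluation at a point and component projections through the differential. -/
lemma ceD_comp {k : ℕ} (φ : V →ₗ[ℝ] V') (F : 𝔤 [⋀^Fin k]→ₗ[ℝ] V) :
    ceD (φ.compAlternatingMap F) = φ.compAlternatingMap (ceD F) := by
  ext x; simp [ceD, alternatizeUncurryFin_apply, adAct_apply]

lemma alt_ext {k : ℕ} {F G : 𝔤 [⋀^Fin (k + 1)]→ₗ[ℝ] V}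
    (h : ∀ x, F.curryLeft x = G.curryLeft x) : F = G := by
  ext x
  have := congrArg (fun H : 𝔤 [⋀^Fin k]→ₗ[ℝ] V => H (Fin.tail x)) (h (x 0))
  simpa [Matrix.vecCons] using this

lemma curryLeft_sub_apply {k : ℕ} (F G : 𝔤 [⋀^Fin (k + 1)]→ₗ[ℝ] V) (x : 𝔤) :
    (F - G).curryLeft x = F.curryLeft x - G.curryLeft x := rfl

lemma curryLeft_adAct {k : ℕ} (F : 𝔤 [⋀^Fin (k + 1)]→ₗ[ℝ] V) (a x : 𝔤) :
    (adAct F a).curryLeft x = adAct (F.curryLeft x) a + F.curryLeft ⁅a, x⁆ := by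
  ext y
  simp only [curryLeft_apply_apply, adAct_apply, AlternatingMap.add_apply, Fin.sum_univ_succ,
    Matrix.vecCons, Fin.cons_zero, Fin.cons_succ, Fin.update_cons_zero, Fin.cons_update]
  rw [add_comm]

/-- In the alternating sum, the term of index 0 uses x as the parameter of `T`; every other term
keeps x as first argument of the form and carries a sign shifted by one. -/
lemma curryLeft_alternatizeUncurryFin {k : ℕ} (T : 𝔤 →ₗ[ℝ] 𝔤 [⋀^Fin (k + 1)]→ₗ[ℝ] V) (x : 𝔤)
    (T' : 𝔤 →ₗ[ℝ] 𝔤 [⋀^Fin k]→ₗ[ℝ] V) (hT : ∀ a, T' a = (T a).curryLeft x) :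
    (alternatizeUncurryFin T).curryLeft x = T x - alternatizeUncurryFin T' := by
  ext y
  have h2 : ∀ i : Fin (k + 1), i.succ.removeNth (Fin.cons x y : Fin (k + 2) → 𝔤) =
      Fin.cons x (i.removeNth y) := by
    intro i
    ext1 j
    refine Fin.cases ?_ (fun j => ?_) j
    · simp [Fin.removeNth]
    · simp [Fin.removeNth]
  rw [AlternatingMap.sub_apply]
  simp only [curryLeft_apply_apply, alternatizeUncurryFin_apply, hT,
    Matrix.vecCons, Fin.sum_univ_succ (n := k + 1), h2, Fin.cons_zero, Fin.cons_succ, Fin.val_zero,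
    pow_zero, one_smul, Fin.val_succ, pow_succ, mul_neg, mul_one, neg_smul, Finset.sum_neg_distrib,
    Fin.removeNth_zero, Fin.tail_cons, sub_eq_add_neg]

/-- Cartan's formula for cochains, on which the later inductions on arity rest. Contracting
`alternatizeUncurryFin (adAct F)` produces `adAct F x` twice: from the term of index 0 and from the
bracket term of `curryLeft_adAct`. This compensates the factor 1/2. -/
lemma curryLeft_ceD {k : ℕ} (F : 𝔤 [⋀^Fin (k + 1)]→ₗ[ℝ] V) (x : 𝔤) :
    (ceD F).curryLeft x = adAct F x - ceD (F.curryLeft x) := by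
  have h : alternatizeUncurryFin (F.curryLeft ∘ₗ (LieAlgebra.ad ℝ 𝔤 x : 𝔤 →ₗ[ℝ] 𝔤)) =
      adAct F x := rfl
  have h1 := curryLeft_alternatizeUncurryFin (adAct F) x
    (adAct (F.curryLeft x) + (-1 : ℝ) • F.curryLeft ∘ₗ (LieAlgebra.ad ℝ 𝔤 x : 𝔤 →ₗ[ℝ] 𝔤)) (by
      intro a
      rw [curryLeft_adAct]
      simp [← map_neg])
  rw [alternatizeUncurryFin_add, alternatizeUncurryFin_smul, h] at h1
  have h2 : (ceD F).curryLeft x =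
    (1 / 2 : ℝ) • (alternatizeUncurryFin (adAct F)).curryLeft x := rfl
  rw [h2, h1, ceD]
  module

/-- No minus sign is built into `adAct`, so it is a right action and the two operators appear in
reversed order. -/
lemma adAct_lie {k : ℕ} (F : 𝔤 [⋀^Fin k]→ₗ[ℝ] V) (a b : 𝔤) :
    adAct F ⁅a, b⁆ = adAct (adAct F a) b - adAct (adAct F b) a := by
  induction k with
  | zero => ext x; simp [adAct_apply]
  | succ k ih =>
    refine alt_ext fun x => ?_
    have add : ∀ G H : 𝔤 [⋀^Fin k]→ₗ[ℝ] V, adAct (G + H) = adAct G + adAct H := by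
      intro G H; ext a x; simp [adAct_apply, Finset.sum_add_distrib]
    rw [curryLeft_sub_apply, curryLeft_adAct, curryLeft_adAct, curryLeft_adAct, curryLeft_adAct,
      curryLeft_adAct, curryLeft_adAct, curryLeft_adAct, ih, lie_lie, map_sub, add, add,
      LinearMap.add_apply, LinearMap.add_apply]
    abel

/-- After contraction with x, Cartan's formula reduces the claim to lower arity and to `adAct_lie`,
which absorbs the term with [a, x]. -/
lemma adAct_ceD {k : ℕ} (F : 𝔤 [⋀^Fin k]→ₗ[ℝ] V) (a : 𝔤) : adAct (ceD F) a = ceD (adAct F a) := by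
  induction k with
  | zero => rw [ceD_of_fin_zero, ceD_of_fin_zero]; ext x; simp [adAct_apply]
  | succ k ih =>
    have add : ∀ G H : 𝔤 [⋀^Fin k]→ₗ[ℝ] V, ceD (G + H) = ceD G + ceD H := by
      intro G H
      rw [← sub_neg_eq_add, ceD_sub, ← neg_one_smul ℝ H, ceD_smul]; simp
    refine alt_ext fun x => ?_
    rw [curryLeft_adAct, curryLeft_ceD, curryLeft_ceD, curryLeft_ceD, curryLeft_adAct, add,
      adAct_sub, LinearMap.sub_apply, ih, adAct_lie]
    abel

/-- By Cartan's formula the contraction of δδF with x is the commutator of `adAct · x` with δ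
applied to F, plus δδ of a cochain of lower arity. -/
lemma ceD_ceD {k : ℕ} (F : 𝔤 [⋀^Fin k]→ₗ[ℝ] V) : ceD (ceD F) = 0 := by
  induction k with
  | zero => rw [ceD_of_fin_zero, ceD_zero]
  | succ k ih =>
    refine alt_ext fun x => ?_
    rw [curryLeft_ceD, curryLeft_ceD, ceD_sub, ih, adAct_ceD, sub_zero, sub_self]; rfl

end ChevalleyEilenberg

/-! ### The sum over (2, k)-unshuffles as a Chevalley–Eilenberg differential. -/

section Unshuffles

/-- The permutation with values `a`, `a.succAbove b` and then the remaining indices in order. -/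
def pairPerm {k : ℕ} (a : Fin (k + 2)) (b : Fin (k + 1)) : Equiv.Perm (Fin (k + 2)) :=
  (Equiv.Perm.decomposeFin.symm (0, b.cycleRange.symm)).trans a.cycleRange.symm

lemma pairPerm_zero {k : ℕ} (a : Fin (k + 2)) (b : Fin (k + 1)) : pairPerm a b 0 = a := by
  simp [pairPerm]

lemma pairPerm_succ {k : ℕ} (a : Fin (k + 2)) (b j : Fin (k + 1)) :
    pairPerm a b j.succ = a.succAbove (b.cycleRange.symm j) := by
  simp [pairPerm, Equiv.Perm.decomposeFin_symm_apply_succ]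

lemma pairPerm_one {k : ℕ} (a : Fin (k + 2)) (b : Fin (k + 1)) :
    pairPerm a b 1 = a.succAbove b := by
  rw [← Fin.succ_zero_eq_one, pairPerm_succ, Fin.cycleRange_symm_zero]

lemma pairPerm_succ_succ {k : ℕ} (a : Fin (k + 2)) (b : Fin (k + 1)) (j : Fin k) :
    pairPerm a b j.succ.succ = a.succAbove (b.succAbove j) := by
  rw [pairPerm_succ, Fin.cycleRange_symm_succ]

lemma sign_pairPerm {k : ℕ} (a : Fin (k + 2)) (b : Fin (k + 1)) :
    Equiv.Perm.sign (pairPerm a b) = (-1) ^ (a : ℕ) * (-1) ^ (b : ℕ) := by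
  simp [pairPerm, Equiv.Perm.sign_trans]

/-- Permutations which are increasing on the indices after the first two. -/
def tailIncreasing (k : ℕ) : Finset (Equiv.Perm (Fin (k + 2))) :=
  {σ | StrictMono fun j : Fin k => σ j.succ.succ}

lemma pairPerm_mem {k : ℕ} (a : Fin (k + 2)) (b : Fin (k + 1)) :
    pairPerm a b ∈ tailIncreasing k := by
  simp only [tailIncreasing, Finset.mem_filter, Finset.mem_univ, true_and, pairPerm_succ_succ]
  exact (Fin.strictMono_succAbove a).comp (Fin.strictMono_succAbove b)

/-- The remaining values are enumerated increasingly, and a strictly increasing map is determined by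
its range, here the complement of the first two values. -/
lemma exists_pairPerm {k : ℕ} {σ : Equiv.Perm (Fin (k + 2))} (hσ : σ ∈ tailIncreasing k) :
    ∃ a b, pairPerm a b = σ := by
  obtain ⟨b, hb⟩ : ∃ b, (σ 0).succAbove b = σ 1 :=
    Fin.exists_succAbove_eq (by simp)
  refine ⟨σ 0, b, ?_⟩
  have h1 := (Finset.mem_filter.1 hσ).2
  have h2 := (Finset.mem_filter.1 (pairPerm_mem (σ 0) b)).2
  have h0 : pairPerm (σ 0) b 0 = σ 0 := pairPerm_zero _ _
  have h01 : pairPerm (σ 0) b 1 = σ 1 := by rw [pairPerm_one, hb]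
  have hr : ∀ τ : Equiv.Perm (Fin (k + 2)),
      Set.range (fun j : Fin k => τ j.succ.succ) = {τ 0, τ 1}ᶜ := by
    intro τ
    ext y
    obtain ⟨i, rfl⟩ := τ.surjective y
    simp only [Set.mem_range, EmbeddingLike.apply_eq_iff_eq, Set.mem_compl_iff,
      Set.mem_insert_iff, Set.mem_singleton_iff, not_or]
    constructor
    · rintro ⟨j, rfl⟩
      exact ⟨Fin.succ_ne_zero _, by
        rw [← Fin.succ_zero_eq_one]
        exact fun h => Fin.succ_ne_zero _ (Fin.succ_injective _ h)⟩
    · rintro ⟨hi, hi'⟩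
      obtain ⟨i, rfl⟩ := Fin.exists_succ_eq.2 hi
      have : i ≠ 0 := by rintro rfl; exact hi' rfl
      obtain ⟨j, rfl⟩ := Fin.exists_succ_eq.2 this
      exact ⟨j, rfl⟩
  have h3 := (h2.range_inj h1).1 (by rw [hr, hr, h0, h01])
  ext1 i
  induction i using Fin.cases with
  | zero => exact h0
  | succ i =>
    induction i using Fin.cases with
    | zero => exact h01
    | succ j => exact congrFun h3 j

lemma swap_succ_succ {k : ℕ} (j : Fin k) :
    Equiv.swap (0 : Fin (k + 2)) 1 j.succ.succ = j.succ.succ := by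
  refine Equiv.swap_apply_of_ne_of_ne (Fin.succ_ne_zero _) ?_
  rw [← Fin.succ_zero_eq_one]
  exact fun h => Fin.succ_ne_zero _ (Fin.succ_injective _ h)

lemma mem_unshuffles_two {k : ℕ} {σ : Equiv.Perm (Fin (k + 2))} :
    σ ∈ unshuffles 2 (k + 2) ↔ σ ∈ tailIncreasing k ∧ σ 0 < σ 1 := by
  simp only [unshuffles, tailIncreasing, Finset.mem_filter, Finset.mem_univ, true_and]
  constructor
  · intro h
    refine ⟨fun i j hij => h _ _ (by simpa using hij) (Or.inr (by simp)), h 0 1 (by simp) (Or.inl ?_)⟩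
    simp
  · rintro ⟨h, h01⟩ i j hij hor
    rcases hor with hj | hi
    · have hlt := Fin.lt_def.1 hij
      have hi0 : i = 0 := Fin.ext (show (i : ℕ) = 0 by omega)
      have hj1 : j = 1 := Fin.ext (by rw [Fin.val_one]; omega)
      rw [hi0, hj1]; exact h01
    · obtain ⟨i', rfl⟩ : ∃ i' : Fin k, i = i'.succ.succ :=
        ⟨⟨i - 2, by omega⟩, by ext; simp; omega⟩
      obtain ⟨j', rfl⟩ : ∃ j' : Fin k, j = j'.succ.succ :=
        ⟨⟨j - 2, by omega⟩, by ext; simp; omega⟩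
      exact h (by simpa using hij)

variable {𝔤 : Type*} [LieRing 𝔤] [LieAlgebra ℝ 𝔤] {V : Type*} [AddCommGroup V] [Module ℝ V]

/-- Both sides are compared with the sum over ordered pairs of distinct indices, that is, over
permutations increasing after the first two places. The sign of `pairPerm a b` is the product of the
signs in the two nested alternating sums. -/
lemma sum_unshuffles_two {k : ℕ} (F : 𝔤 [⋀^Fin (k + 1)]→ₗ[ℝ] V) (x : Fin (k + 2) → 𝔤) :
    ∑ σ ∈ unshuffles 2 (k + 2), Equiv.Perm.sign σ •
      F (Fin.cons ⁅x (σ 0), x (σ 1)⁆ fun j => x (σ j.succ.succ)) = ceD F x := by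
  set T : Equiv.Perm (Fin (k + 2)) → V := fun σ => Equiv.Perm.sign σ •
    F (Fin.cons ⁅x (σ 0), x (σ 1)⁆ fun j => x (σ j.succ.succ)) with hT
  have hswap : ∀ σ, T (σ * Equiv.swap 0 1) = T σ := by
    intro σ
    have h1 : F (Fin.cons ⁅x (σ 1), x (σ 0)⁆ fun j => x (σ j.succ.succ)) =
        - F (Fin.cons ⁅x (σ 0), x (σ 1)⁆ fun j => x (σ j.succ.succ)) := by
      rw [← lie_skew]
      exact congrArg (fun G : 𝔤 [⋀^Fin k]→ₗ[ℝ] V => G fun j => x (σ j.succ.succ))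
        (map_neg F.curryLeft ⁅x (σ 0), x (σ 1)⁆)
    simp only [hT, Equiv.Perm.mul_apply, Equiv.swap_apply_left, Equiv.swap_apply_right, swap_succ_succ, h1,
      Equiv.Perm.sign_mul, Equiv.Perm.sign_swap (zero_ne_one : (0 : Fin (k + 2)) ≠ 1)]
    simp [Units.smul_def]
  have hpair : ∑ p : Fin (k + 2) × Fin (k + 1), T (pairPerm p.1 p.2) =
      ∑ σ ∈ tailIncreasing k, T σ := by
    refine Finset.sum_bij (fun p _ => pairPerm p.1 p.2) (fun p _ => pairPerm_mem _ _) ?_ ?_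
      (fun _ _ => rfl)
    · rintro ⟨a, b⟩ _ ⟨a', b'⟩ _ h
      have ha : a = a' := by rw [← pairPerm_zero a b, ← pairPerm_zero a' b', h]
      subst ha
      have hb : a.succAbove b = a.succAbove b' := by rw [← pairPerm_one, ← pairPerm_one, h]
      rw [Fin.succAbove_right_injective hb]
    · intro σ hσ
      obtain ⟨a, b, h⟩ := exists_pairPerm hσ
      exact ⟨(a, b), Finset.mem_univ _, h⟩
  -- Exchanging the first two values preserves `T`, since the sign of the permutation and the sign
  -- of the bracket both change. Each unshuffle is therefore counted twice, which cancels the 1/2 in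
  -- `ceD`.
  have hsplit : ∑ σ ∈ tailIncreasing k, T σ = (2 : ℝ) • ∑ σ ∈ unshuffles 2 (k + 2), T σ := by
    rw [← Finset.sum_filter_add_sum_filter_not _ (fun σ => σ 0 < σ 1), two_smul]
    have hu : (tailIncreasing k).filter (fun σ => σ 0 < σ 1) = unshuffles 2 (k + 2) := by
      ext σ; rw [mem_unshuffles_two, Finset.mem_filter]
    rw [hu]
    congr 1
    have key : ∀ σ ∈ tailIncreasing k, σ * Equiv.swap 0 1 ∈ tailIncreasing k := by
      intro σ hσ
      simp only [tailIncreasing, Finset.mem_filter, Finset.mem_univ, true_and] at hσ ⊢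
      intro i j hij
      simpa [swap_succ_succ] using hσ hij
    refine Finset.sum_bij' (fun σ _ => σ * Equiv.swap 0 1) (fun σ _ => σ * Equiv.swap 0 1)
      ?_ ?_ ?_ ?_ ?_
    · intro σ hσ
      rw [Finset.mem_filter] at hσ
      rw [mem_unshuffles_two]
      refine ⟨key σ hσ.1, ?_⟩
      have hne : σ 0 ≠ σ 1 := by simp
      simpa using lt_of_le_of_ne (not_lt.1 hσ.2) hne.symm
    · intro σ hσ
      rw [mem_unshuffles_two] at hσ
      rw [Finset.mem_filter]
      exact ⟨key σ hσ.1, by simpa using hσ.2.le⟩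
    · intro σ _; simp [mul_assoc]
    · intro σ _; simp [mul_assoc]
    · intro σ _; exact (hswap σ).symm
  have hce : (2 : ℝ) • ceD F x = ∑ p : Fin (k + 2) × Fin (k + 1), T (pairPerm p.1 p.2) := by
    have : (2 : ℝ) • ceD F x = AlternatingMap.alternatizeUncurryFin (adAct F) x := by
      simp [ceD, smul_smul]
    rw [this, AlternatingMap.alternatizeUncurryFin_apply, Fintype.sum_prod_type]
    refine Finset.sum_congr rfl fun a _ => ?_
    rw [adAct_apply, Finset.smul_sum]
    refine Finset.sum_congr rfl fun b _ => ?_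
    simp only [hT, sign_pairPerm, pairPerm_zero, pairPerm_one, pairPerm_succ_succ, map_update_eq,
      Units.smul_def, smul_smul]
    push_cast
    rfl
  rw [hsplit] at hpair
  rw [hpair] at hce
  exact (smul_right_injective V (two_ne_zero : (2 : ℝ) ≠ 0) hce).symm

end Unshuffles

/-! ### Cartan calculus on families of forms of all degrees, and contractions as cochains. -/

section TotalForms

variable {A : Type*} [CommRing A] [Algebra ℝ A]

/-- Families of forms, one in each degree. -/
abbrev TotalForm (A : Type*) [CommRing A] [Algebra ℝ A] : Type _ := (j : ℕ) → Form A j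

/-- The exterior derivative of a family of forms. -/
def dTot : TotalForm A →ₗ[ℝ] TotalForm A where
  toFun β
    | 0 => 0
    | j + 1 => extD j (β j)
  map_add' β γ := by
    funext j
    cases j with
    | zero => exact (add_zero _).symm
    | succ j => exact map_add (extD j) (β j) (γ j)
  map_smul' r β := by
    funext j
    cases j with
    | zero => exact (smul_zero r).symm
    | succ j => exact map_smul (extD j) r (β j)

lemma dTot_zero (β : TotalForm A) : dTot β 0 = 0 := rfl

lemma dTot_succ (β : TotalForm A) (j : ℕ) : dTot β (j + 1) = extD j (β j) := rfl

/-- The interior product of a family of forms. -/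
def iTot : VF A →ₗ[ℝ] TotalForm A →ₗ[ℝ] TotalForm A where
  toFun X :=
    { toFun := fun β j => iota X (β (j + 1))
      map_add' := fun _ _ => rfl
      map_smul' := fun _ _ => rfl }
  map_add' X Y := LinearMap.ext fun β => funext fun j => iota_add_left X Y (β (j + 1))
  map_smul' r X := LinearMap.ext fun β => funext fun j => iota_smul_left_real r X (β (j + 1))

lemma iTot_apply (X : VF A) (β : TotalForm A) (j : ℕ) : iTot X β j = iota X (β (j + 1)) := rfl

/-- The Lie derivative of a family of forms. -/
def lTot (X : VF A) : TotalForm A →ₗ[ℝ] TotalForm A where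
  toFun β j := lieDeriv X (β j)
  map_add' β γ := funext fun j => lieDeriv_add X (β j) (γ j)
  map_smul' r β := funext fun j => lieDeriv_smul X r (β j)

lemma dTot_dTot (β : TotalForm A) : dTot (dTot β) = 0 := by
  funext j
  match j with
  | 0 => rfl
  | 1 => exact map_zero (extD 0)
  | j + 2 => exact extD_extD (β j)

lemma iTot_dTot (X : VF A) (β : TotalForm A) : iTot X (dTot β) = lTot X β - dTot (iTot X β) := by
  funext j
  cases j with
  | zero => exact (iota_extD_zero X (β 0)).trans (sub_zero _).symm
  | succ j => exact iota_extD_succ X (β (j + 1))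

lemma iTot_lTot (X Y : VF A) (β : TotalForm A) :
    iTot Y (lTot X β) = lTot X (iTot Y β) - iTot ⁅X, Y⁆ β :=
  funext fun j => iota_lieDeriv X Y (β (j + 1))

lemma iTot_comm (X Y : VF A) (β : TotalForm A) : iTot X (iTot Y β) = -iTot Y (iTot X β) :=
  funext fun j => iota_iota_comm X Y (β (j + 2))

lemma iTot_self (X : VF A) (β : TotalForm A) : iTot X (iTot X β) = 0 :=
  funext fun j => iota_iota_self X (β (j + 2))

lemma dTot_single (j : ℕ) (α : Form A j) :
    dTot (Pi.single j α : TotalForm A) = Pi.single (j + 1) (extD j α) := by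
  funext l
  cases l with
  | zero => simp [dTot_zero]
  | succ l =>
    rw [dTot_succ]
    by_cases h : l = j
    · subst h; simp
    · rw [Pi.single_eq_of_ne h, Pi.single_eq_of_ne (by omega), map_zero]

lemma iTot_single (X : VF A) (j : ℕ) (α : Form A (j + 1)) :
    iTot X (Pi.single (j + 1) α : TotalForm A) = Pi.single j (iota X α) := by
  funext l
  rw [iTot_apply]
  by_cases h : l = j
  · subst h; simp
  · rw [Pi.single_eq_of_ne h, Pi.single_eq_of_ne (by omega)]; rfl

/-- Contraction of a family of forms with several vector fields, `β ↦ ι_{v_k} ⋯ ι_{v_1} β`. -/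
def iotaTot : (k : ℕ) → (Fin k → VF A) → TotalForm A →ₗ[ℝ] TotalForm A
  | 0, _ => LinearMap.id
  | k + 1, v => iotaTot k (Fin.tail v) ∘ₗ iTot (v 0)

lemma iotaTot_succ {k : ℕ} (v : Fin (k + 1) → VF A) (β : TotalForm A) :
    iotaTot (k + 1) v β = iotaTot k (Fin.tail v) (iTot (v 0) β) := rfl

lemma iotaTot_apply {k : ℕ} (v : Fin k → VF A) (β : TotalForm A) (j : ℕ) :
    iotaTot k v β j = iotaMulti k v (β (j + k)) := by
  induction k generalizing β with
  | zero => rfl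
  | succ k ih => rw [iotaTot_succ, ih]; rfl

/-- The first vector field is contracted innermost; moving it outside past k anticommuting
contractions costs the sign. -/
lemma iotaTot_cons {k : ℕ} (z : VF A) (v : Fin k → VF A) (β : TotalForm A) :
    iotaTot (k + 1) (Fin.cons z v) β = (-1 : ℝ) ^ k • iTot z (iotaTot k v β) := by
  rw [iotaTot_succ, Fin.tail_cons, Fin.cons_zero]
  induction k generalizing β with
  | zero => simp [iotaTot]
  | succ k ih =>
    rw [iotaTot_succ, iotaTot_succ, iTot_comm, map_neg, ih, pow_succ', mul_smul]
    exact (neg_one_smul ℝ _).symm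

/-- Contractions anticommute, so the one that kills β may be performed first. -/
lemma iotaTot_eq_zero_of_iTot {k : ℕ} (v : Fin k → VF A) (i : Fin k) (β : TotalForm A)
    (h : iTot (v i) β = 0) : iotaTot k v β = 0 := by
  induction k generalizing β with
  | zero => exact i.elim0
  | succ k ih =>
    rw [iotaTot_succ]
    induction i using Fin.cases with
    | zero => rw [h, map_zero]
    | succ i => exact ih (Fin.tail v) i _ (by rw [Fin.tail, iTot_comm, h, map_zero, neg_zero])

lemma iotaTot_eq_zero {k : ℕ} (v : Fin k → VF A) (i j : Fin k) (hij : i < j) (h : v i = v j)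
    (β : TotalForm A) : iotaTot k v β = 0 := by
  induction k generalizing β with
  | zero => exact i.elim0
  | succ k ih =>
    rw [iotaTot_succ]
    obtain ⟨j, rfl⟩ := Fin.exists_succ_eq.2 (Fin.ne_zero_of_lt hij)
    induction i using Fin.cases with
    | zero => exact iotaTot_eq_zero_of_iTot _ j _ (by rw [h]; exact iTot_self _ _)
    | succ i => exact ih (Fin.tail v) i j (by simpa using hij) h _

lemma iotaTot_update_add {k : ℕ} (v : Fin k → VF A) (i : Fin k) (X Y : VF A) (β : TotalForm A) :
    iotaTot k (Function.update v i (X + Y)) β =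
      iotaTot k (Function.update v i X) β + iotaTot k (Function.update v i Y) β := by
  induction k generalizing β with
  | zero => exact i.elim0
  | succ k ih =>
    simp only [iotaTot_succ]
    induction i using Fin.cases with
    | zero => simp
    | succ i => simp [Fin.tail_update_succ, ih, Function.update_of_ne (Fin.succ_ne_zero i).symm]

lemma iotaTot_update_smul {k : ℕ} (v : Fin k → VF A) (i : Fin k) (r : ℝ) (X : VF A)
    (β : TotalForm A) :
    iotaTot k (Function.update v i (r • X)) β = r • iotaTot k (Function.update v i X) β := by
  induction k generalizing β with
  | zero => exact i.elim0
  | succ k ih =>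
    simp only [iotaTot_succ]
    induction i using Fin.cases with
    | zero => simp
    | succ i => simp [Fin.tail_update_succ, ih, Function.update_of_ne (Fin.succ_ne_zero i).symm]

lemma lTot_iotaTot {k : ℕ} (X : VF A) (v : Fin k → VF A) (β : TotalForm A) :
    lTot X (iotaTot k v β) = iotaTot k v (lTot X β) +
      ∑ i, iotaTot k (Function.update v i ⁅X, v i⁆) β := by
  induction k generalizing β with
  | zero => simp [iotaTot]
  | succ k ih =>
    have h : lTot X (iTot (v 0) β) = iTot (v 0) (lTot X β) + iTot ⁅X, v 0⁆ β := by
      rw [iTot_lTot, sub_add_cancel]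
    rw [iotaTot_succ, ih, h, map_add, Fin.sum_univ_succ, iotaTot_succ, iotaTot_succ]
    simp only [Fin.tail_update_zero, Function.update_self, iotaTot_succ, Fin.tail_update_succ,
      Function.update_of_ne (Fin.succ_ne_zero _).symm, add_assoc]
    rfl

variable {𝔤 : Type*} [LieRing 𝔤] [LieAlgebra ℝ 𝔤]

/-- The cochain `(x₁, …, x_k) ↦ ι(v_{x₁} ∧ ⋯ ∧ v_{x_k}) β`. -/
def contraction (v : 𝔤 →ₗ⁅ℝ⁆ VF A) (β : TotalForm A) (k : ℕ) : 𝔤 [⋀^Fin k]→ₗ[ℝ] TotalForm A where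
  toFun x := iotaTot k (v ∘ x) β
  map_update_add' x i a b := by
    rename_i inst
    obtain rfl : inst = instDecidableEqFin k := Subsingleton.elim _ _
    simp only [Function.comp_update, map_add, iotaTot_update_add]
  map_update_smul' x i r a := by
    rename_i inst
    obtain rfl : inst = instDecidableEqFin k := Subsingleton.elim _ _
    simp only [Function.comp_update, map_smul, iotaTot_update_smul]
  map_eq_zero_of_eq' x i j h hij := by
    rcases lt_or_gt_of_ne hij with hlt | hlt
    · exact iotaTot_eq_zero _ i j hlt (congrArg v h) β
    · exact iotaTot_eq_zero _ j i hlt (congrArg v h.symm) β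

lemma contraction_apply (v : 𝔤 →ₗ⁅ℝ⁆ VF A) (β : TotalForm A) (k : ℕ) (x : Fin k → 𝔤) :
    contraction v β k x = iotaTot k (v ∘ x) β := rfl

lemma curryLeft_contraction (v : 𝔤 →ₗ⁅ℝ⁆ VF A) (β : TotalForm A) (k : ℕ) (z : 𝔤) :
    (contraction v β (k + 1)).curryLeft z =
      (-1 : ℝ) ^ k • (iTot (v z)).compAlternatingMap (contraction v β k) := by
  refine AlternatingMap.ext fun x => ?_
  have h : v ∘ (Fin.cons z x : Fin (k + 1) → 𝔤) = Fin.cons (v z) (v ∘ x) := by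
    ext1 i
    induction i using Fin.cases <;> rfl
  rw [AlternatingMap.curryLeft_apply_apply, Matrix.vecCons, contraction_apply, h, iotaTot_cons]
  rfl

/-- In the Leibniz rule for a Lie derivative of a contraction, invariance of β removes the term
differentiating β; the remaining terms bracket one argument at a time. -/
lemma lTot_contraction (v : 𝔤 →ₗ⁅ℝ⁆ VF A) (β : TotalForm A) (hβ : ∀ x, lTot (v x) β = 0) (k : ℕ)
    (a : 𝔤) : (lTot (v a)).compAlternatingMap (contraction v β k) =
      adAct (contraction v β k) a := by
  refine AlternatingMap.ext fun x => ?_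
  rw [LinearMap.compAlternatingMap_apply, contraction_apply, lTot_iotaTot, hβ, map_zero, zero_add,
    adAct_apply]
  simp only [contraction_apply, Function.comp_update, LieHom.map_lie]
  rfl

/-- For a closed form `β` invariant under `v`, `d ι(v_{x₁} ∧ ⋯ ∧ v_{x_{k+1}}) β` is, up to the sign
`(-1)^k`, the Chevalley–Eilenberg differential of the contractions with `k` vector fields. -/
theorem dTot_contraction (v : 𝔤 →ₗ⁅ℝ⁆ VF A) (β : TotalForm A) (hd : dTot β = 0)
    (hβ : ∀ x, lTot (v x) β = 0) (k : ℕ) :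
    dTot.compAlternatingMap (contraction v β (k + 1)) =
      (-1 : ℝ) ^ k • ceD (contraction v β k) := by
  -- The formula dι = L - ιd gives the left side the same recursion under contraction as
  -- `curryLeft_ceD` gives the right side.
  have hcartan : ∀ (k : ℕ) (z : 𝔤),
      (dTot.compAlternatingMap (contraction v β (k + 1))).curryLeft z =
      (-1 : ℝ) ^ k • (adAct (contraction v β k) z -
        (iTot (v z)).compAlternatingMap (dTot.compAlternatingMap (contraction v β k))) := by
    intro k z
    have h1 : (dTot.compAlternatingMap (contraction v β (k + 1))).curryLeft z =
        dTot.compAlternatingMap ((contraction v β (k + 1)).curryLeft z) := rfl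
    rw [h1, curryLeft_contraction, ← lTot_contraction v β hβ]
    refine AlternatingMap.ext fun x => ?_
    simp only [LinearMap.compAlternatingMap_apply, AlternatingMap.smul_apply,
      AlternatingMap.sub_apply, map_smul, iTot_dTot, sub_sub_cancel]
  induction k with
  | zero =>
    refine alt_ext fun z => ?_
    rw [hcartan, ceD_of_fin_zero]
    refine AlternatingMap.ext fun x => ?_
    simp [adAct_apply, contraction_apply, iotaTot, hd]
  | succ k ih =>
    refine alt_ext fun z => ?_
    have h2 : ((-1 : ℝ) ^ (k + 1) • ceD (contraction v β (k + 1))).curryLeft z =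
      (-1 : ℝ) ^ (k + 1) • (ceD (contraction v β (k + 1))).curryLeft z := rfl
    rw [hcartan, h2, curryLeft_ceD, curryLeft_contraction, ceD_smul, ceD_comp, ih]
    congr 2

end TotalForms

/-! ### Closed functions on a connected manifold are constant. -/

section Manifold

open scoped Manifold ContDiff Topology

variable {E : Type*} [NormedAddCommGroup E] [NormedSpace ℝ E] {M : Type*} [TopologicalSpace M]
  [ChartedSpace E M]

/-- A smooth function read in the chart at `c`. -/
def chartRep (c : M) (f : Smooth E M) : E → ℝ := f ∘ (extChartAt 𝓘(ℝ, E) c).symm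

lemma chartRep_apply_extChartAt {c q : M} (hq : q ∈ (chartAt E c).source) (f : Smooth E M) :
    chartRep c f (extChartAt 𝓘(ℝ, E) c q) = f q := by
  simp only [chartRep, Function.comp_apply]
  rw [(extChartAt 𝓘(ℝ, E) c).left_inv (by rwa [extChartAt_source])]

lemma extChartAt_mem_target {c q : M} (hq : q ∈ (chartAt E c).source) :
    extChartAt 𝓘(ℝ, E) c q ∈ (extChartAt 𝓘(ℝ, E) c).target :=
  (extChartAt 𝓘(ℝ, E) c).map_source (by rwa [extChartAt_source])

/-- The derivative of `f` along the coordinate vector field of direction `e`, cut off by `ρ`. -/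
def bumpDeriv [FiniteDimensional ℝ E] {c : M} (ρ : SmoothBumpFunction 𝓘(ℝ, E) c) (e : E)
    (f : Smooth E M) (q : M) : ℝ :=
  ρ q • fderiv ℝ (chartRep c f) (extChartAt 𝓘(ℝ, E) c q) e

/-- Outside the chart the derivative of `chartRep` has no meaning, but the cutoff vanishes there.
This settles the off-chart case of each derivation law. -/
lemma bumpDeriv_of_notMem [FiniteDimensional ℝ E] {c q : M} (hq : q ∉ (chartAt E c).source)
    (ρ : SmoothBumpFunction 𝓘(ℝ, E) c) (e : E) (f : Smooth E M) : bumpDeriv ρ e f q = 0 := by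
  have h0 : ρ q = 0 := by
    by_contra h
    exact hq (ρ.support_subset_source h)
  rw [bumpDeriv, h0, zero_smul]

variable [IsManifold 𝓘(ℝ, E) ∞ M]

lemma contDiffOn_chartRep (c : M) (f : Smooth E M) :
    ContDiffOn ℝ ∞ (chartRep c f) (extChartAt 𝓘(ℝ, E) c).target :=
  (f.contMDiff.comp_contMDiffOn (contMDiffOn_extChartAt_symm c)).contDiffOn

lemma differentiableAt_chartRep {c : M} (f : Smooth E M) {y : E}
    (hy : y ∈ (extChartAt 𝓘(ℝ, E) c).target) : DifferentiableAt ℝ (chartRep c f) y :=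
  ((contDiffOn_chartRep c f).differentiableOn (by simp)).differentiableAt
    ((isOpen_extChartAt_target c).mem_nhds hy)

variable [FiniteDimensional ℝ E]

lemma bumpDeriv_add {c : M} (ρ : SmoothBumpFunction 𝓘(ℝ, E) c) (e : E) (f g : Smooth E M) (q : M) :
    bumpDeriv ρ e (f + g) q = bumpDeriv ρ e f q + bumpDeriv ρ e g q := by
  by_cases hq : q ∈ (chartAt E c).source
  · have h := fderiv_add (differentiableAt_chartRep f (extChartAt_mem_target hq))
      (differentiableAt_chartRep g (extChartAt_mem_target hq))
    have h' : chartRep c (f + g) = chartRep c f + chartRep c g := rfl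
    rw [bumpDeriv, bumpDeriv, bumpDeriv, h', h, ← smul_add]; rfl
  · simp only [bumpDeriv_of_notMem hq, add_zero]

lemma bumpDeriv_smul {c : M} (ρ : SmoothBumpFunction 𝓘(ℝ, E) c) (e : E) (r : ℝ) (f : Smooth E M)
    (q : M) : bumpDeriv ρ e (r • f) q = r • bumpDeriv ρ e f q := by
  by_cases hq : q ∈ (chartAt E c).source
  · have h := fderiv_const_smul (differentiableAt_chartRep f (extChartAt_mem_target hq)) r
    have h' : chartRep c (r • f) = r • chartRep c f := rfl
    rw [bumpDeriv, bumpDeriv, h', h, smul_comm]; rfl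
  · simp only [bumpDeriv_of_notMem hq, smul_zero]

lemma bumpDeriv_mul {c : M} (ρ : SmoothBumpFunction 𝓘(ℝ, E) c) (e : E) (f g : Smooth E M) (q : M) :
    bumpDeriv ρ e (f * g) q = f q * bumpDeriv ρ e g q + g q * bumpDeriv ρ e f q := by
  by_cases hq : q ∈ (chartAt E c).source
  · have h := fderiv_mul (differentiableAt_chartRep f (extChartAt_mem_target hq))
      (differentiableAt_chartRep g (extChartAt_mem_target hq))
    have h' : chartRep c (f * g) = chartRep c f * chartRep c g := rfl
    rw [bumpDeriv, bumpDeriv, bumpDeriv, h', h, chartRep_apply_extChartAt hq,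
      chartRep_apply_extChartAt hq]
    simp only [add_apply, smul_apply, smul_eq_mul]
    ring
  · simp only [bumpDeriv_of_notMem hq, mul_zero, add_zero]

variable [T2Space M]

/-- The support of ρ lies inside the chart, so smoothness of the coordinate derivative on the chart
domain suffices. -/
lemma contMDiff_bumpDeriv {c : M} (ρ : SmoothBumpFunction 𝓘(ℝ, E) c) (e : E)
    (f : Smooth E M) : ContMDiff 𝓘(ℝ, E) 𝓘(ℝ, ℝ) ∞ (bumpDeriv ρ e f) := by
  refine ρ.contMDiff_smul ?_
  have h1 : ContDiffOn ℝ ∞ (fun y => fderiv ℝ (chartRep c f) y e)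
      (extChartAt 𝓘(ℝ, E) c).target :=
    ((contDiffOn_chartRep c f).fderiv_of_isOpen (isOpen_extChartAt_target c)
      (by simp)).clm_apply contDiffOn_const
  exact h1.contMDiffOn.comp contMDiffOn_extChartAt fun q hq => extChartAt_mem_target hq

/-- The derivation `ρ ∂_e`, cut off from a coordinate vector field in the chart at `c`. -/
def chartDerivation {c : M} (ρ : SmoothBumpFunction 𝓘(ℝ, E) c) (e : E) : VF (Smooth E M) :=
  Derivation.mk'
    { toFun := fun f => ⟨bumpDeriv ρ e f, contMDiff_bumpDeriv ρ e f⟩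
      map_add' := fun f g => ContMDiffMap.ext (bumpDeriv_add ρ e f g)
      map_smul' := fun r f => ContMDiffMap.ext (bumpDeriv_smul ρ e r f) }
    (fun f g => ContMDiffMap.ext (bumpDeriv_mul ρ e f g))

lemma chartDerivation_apply {c : M} (ρ : SmoothBumpFunction 𝓘(ℝ, E) c) (e : E) (f : Smooth E M)
    (q : M) : chartDerivation ρ e f q =
      ρ q • fderiv ℝ (chartRep c f) (extChartAt 𝓘(ℝ, E) c q) e := rfl

/-- A function killed by all derivations is locally constant. -/
theorem isLocallyConstant_of_forall_derivation (f : Smooth E M)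
    (hf : ∀ X : VF (Smooth E M), X f = 0) : IsLocallyConstant f := by
  rw [IsLocallyConstant.iff_eventually_eq]
  intro c
  obtain ⟨ρ⟩ : Nonempty (SmoothBumpFunction 𝓘(ℝ, E) c) := inferInstance
  set φ := extChartAt 𝓘(ℝ, E) c with hφ
  have hball : Metric.ball (φ c) ρ.rIn ⊆ φ.target := fun y hy =>
    ρ.ball_subset ⟨Metric.ball_subset_ball ρ.rIn_lt_rOut.le hy, by simp⟩
  have hzero : ∀ y ∈ Metric.ball (φ c) ρ.rIn, fderiv ℝ (chartRep c f) y = 0 := by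
    intro y hy
    ext e
    have hs : φ.symm y ∈ (chartAt E c).source := by
      have := φ.map_target (hball hy)
      rwa [hφ, extChartAt_source] at this
    have hy' : φ (φ.symm y) = y := φ.right_inv (hball hy)
    have h1 : chartDerivation ρ e f (φ.symm y) = 0 := by rw [hf]; rfl
    have hd : dist (φ (φ.symm y)) (φ c) ≤ ρ.rIn := by rw [hy']; exact (Metric.mem_ball.1 hy).le
    -- On the inner ball the cutoff equals 1, so the vanishing of this derivation is the vanishing
    -- of the coordinate derivative itself.
    rw [chartDerivation_apply, ρ.one_of_dist_le hs hd, one_smul, ← hφ, hy'] at h1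
    simpa using h1
  have hconst : ∀ y ∈ Metric.ball (φ c) ρ.rIn, chartRep c f y = chartRep c f (φ c) := by
    intro y hy
    refine Metric.isOpen_ball.is_const_of_fderiv_eq_zero (convex_ball _ _).isPreconnected
      (fun z hz => (differentiableAt_chartRep f (hball hz)).differentiableWithinAt) hzero hy
      (Metric.mem_ball_self ρ.rIn_pos)
  filter_upwards [(continuousAt_extChartAt (I := 𝓘(ℝ, E)) c).preimage_mem_nhds
    (Metric.ball_mem_nhds _ ρ.rIn_pos), chart_source_mem_nhds E c] with q hq hqs
  rw [← chartRep_apply_extChartAt hqs f, ← chartRep_apply_extChartAt (mem_chart_source E c) f]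
  exact hconst _ hq

/-- A closed `0`-form on a connected manifold is constant. -/
theorem eq_of_extD_zero_eq_zero [ConnectedSpace M] (α : Form (Smooth E M) 0)
    (hα : extD 0 α = 0) (Y : Fin 0 → VF (Smooth E M)) (p q : M) : α Y p = α Y q := by
  refine (isLocallyConstant_of_forall_derivation (α Y) fun X => ?_).apply_eq_of_preconnectedSpace
    p q
  have h := iota_extD_zero X α
  rw [hα] at h
  have h' := congrArg (fun β : Form (Smooth E M) 0 => β Y) h
  simpa [lieDeriv_apply, iota_apply] using h'.symm

end Manifold

/-! ### Koszul and desuspension signs on elements of degree zero. -/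

section Signs

lemma koszulSign_zero {m : ℕ} (σ : Equiv.Perm (Fin m)) : koszulSign σ (fun _ => 0) = 1 := by
  simp [koszulSign]

/-- Desuspended elements of degree 0 have degree -1, so each inversion contributes -1. -/
lemma koszulSign_neg_one {m : ℕ} (σ : Equiv.Perm (Fin m)) :
    koszulSign σ (fun _ => 0 - 1) = Equiv.Perm.sign σ := by
  rw [Equiv.Perm.sign_eq_prod_prod_Ioi, koszulSign]
  refine Finset.prod_congr rfl fun a _ => ?_
  rw [← Finset.filter_lt_eq_Ioi, Finset.prod_filter]
  refine Finset.prod_congr rfl fun b _ => ?_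
  by_cases hab : a < b
  · have hne : σ a ≠ σ b := fun h => hab.ne (σ.injective h)
    rcases lt_or_gt_of_ne hne with h | h
    · simp [hab, h, h.not_gt]
    · simp [hab, h, h.not_gt]
  · simp [hab]

lemma decSign_zero {k : ℕ} : decSign (fun _ : Fin k => 0) = 1 := by
  simp [decSign]

/-- The only exponent is multiplied by k - 1 - a = 0, whatever the degree of the argument. -/
lemma decSign_of_length_one {k : ℕ} (hk : k = 1) (d : Fin k → ℤ) : decSign d = 1 := by
  subst hk
  simp [decSign]

lemma strictMono_perm_eq_one {m : ℕ} {σ : Equiv.Perm (Fin m)} (h : StrictMono σ) : σ = 1 := by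
  have := (h.range_inj strictMono_id).1 (by simp [σ.surjective.range_eq])
  exact Equiv.ext (congrFun this)

lemma unshuffles_self (m : ℕ) : unshuffles m m = {1} := by
  ext σ
  simp only [unshuffles, Finset.mem_filter, Finset.mem_univ, true_and, Finset.mem_singleton]
  constructor
  · exact fun h => strictMono_perm_eq_one fun a b hab => h a b hab (Or.inl b.isLt)
  · rintro rfl a b hab _
    exact hab

end Signs

/-! ### Brackets that factor through a Lie algebra in degree zero. -/

section Grounded

variable {L : Type*} [AddCommGroup L] [Module ℝ L] {L' : Type*} [AddCommGroup L'] [Module ℝ L']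
  {𝔤 : Type*} [LieRing 𝔤] [LieAlgebra ℝ 𝔤] {𝔥 : Type*} [LieRing 𝔥] [LieAlgebra ℝ 𝔥]
  {V : Type*} [AddCommGroup V] [Module ℝ V]

/-- A family of maps whose first member is linear and whose members of arity `≥ 2` are alternating
maps composed with a projection `q`. -/
structure IsGroundedFamily (q : L →ₗ[ℝ] 𝔤) (g : (k : ℕ) → (Fin k → L) → V) (T : L →ₗ[ℝ] V)
    (ψ : (k : ℕ) → 𝔤 [⋀^Fin k]→ₗ[ℝ] V) : Prop where
  one : ∀ x, g 1 x = T (x 0)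
  higher : ∀ k, 2 ≤ k → ∀ x, g k x = ψ k fun a => q (x a)

namespace IsGroundedFamily

variable {q : L →ₗ[ℝ] 𝔤} {g : (k : ℕ) → (Fin k → L) → V} {T : L →ₗ[ℝ] V}
  {ψ : (k : ℕ) → 𝔤 [⋀^Fin k]→ₗ[ℝ] V}

lemma isMultilin (h : IsGroundedFamily q g T ψ) (k : ℕ) (hk : 1 ≤ k) : IsMultilin (g k) := by
  rcases hk.eq_or_lt with rfl | hk
  · exact ⟨MultilinearMap.ofSubsingleton ℝ L V (0 : Fin 1) T, h.one⟩
  · exact ⟨(ψ k).toMultilinearMap.compLinearMap fun _ => q, h.higher k hk⟩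

/-- If all degrees are zero the Koszul sign is 1 and alternation applies; otherwise some argument is
killed by `q` and both sides vanish. -/
lemma isGradedSkew (h : IsGroundedFamily q g T ψ) {gr : ℤ → Submodule ℝ L}
    (hq : ∀ d ≠ 0, ∀ x ∈ gr d, q x = 0) (k : ℕ) (hk : 1 ≤ k) : IsGradedSkew gr (g k) := by
  intro d x hx σ
  rcases hk.eq_or_lt with rfl | hk
  · have : σ = 1 := Subsingleton.elim _ _
    subst this
    simp [koszulSign]
  · rw [h.higher k hk, h.higher k hk]
    by_cases hd : ∀ a, d a = 0
    · obtain rfl : d = fun _ => 0 := funext hd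
      rw [koszulSign_zero, mul_one]
      exact (ψ k).map_perm (fun a => q (x a)) σ
    · push Not at hd
      obtain ⟨a, ha⟩ := hd
      have hxa := hq _ ha _ (hx a)
      have h1 : ψ k (fun a => q (x a)) = 0 := (ψ k).map_coord_zero a hxa
      have h2 : ψ k (fun a => q ((x ∘ σ) a)) = 0 :=
        (ψ k).map_coord_zero (σ.symm a) (by simpa using hxa)
      rw [h1, h2, smul_zero]

/-- The parameter r is 2 for brackets and 1 for components of a morphism. -/
lemma hasDegree (h : IsGroundedFamily q g T ψ) {gr : ℤ → Submodule ℝ L} {gr' : ℤ → Submodule ℝ V}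
    (hq : ∀ d ≠ 0, ∀ x ∈ gr d, q x = 0) (r : ℤ) (hT : ∀ d, ∀ x ∈ gr d, T x ∈ gr' (d + (r - 1)))
    (hψ : ∀ k : ℕ, 2 ≤ k → ∀ x, ψ k x ∈ gr' (r - k)) (k : ℕ) (hk : 1 ≤ k) :
    HasDegree gr gr' (g k) (r - k) := by
  intro d x hx
  rcases hk.eq_or_lt with rfl | hk
  · rw [h.one]
    simpa using hT _ _ (hx 0)
  · rw [h.higher k hk]
    by_cases hd : ∀ a, d a = 0
    · simpa [hd] using hψ k hk _
    · push Not at hd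
      obtain ⟨a, ha⟩ := hd
      rw [(ψ k).map_coord_zero a (hq _ ha _ (hx a))]
      exact Submodule.zero_mem _

lemma apply_of_eq_one (h : IsGroundedFamily q g T ψ) {l : ℕ} (hl : l = 1) (y : Fin l → L) :
    g l y = T (y ⟨0, hl ▸ one_pos⟩) := by
  subst hl
  exact h.one y

end IsGroundedFamily

/-- Multibrackets which vanish, from arity two on, unless all arguments have degree zero. Here `q` is
a projection of the degree zero part to a Lie algebra, `D = l₁` and `l_k = φ_k ∘ q^{⊗k}`. -/
structure IsGrounded (𝓛 : MultiBrackets L) (q : L →ₗ[ℝ] 𝔤) (D : L →ₗ[ℝ] L)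
    (φ : (k : ℕ) → 𝔤 [⋀^Fin k]→ₗ[ℝ] L) : Prop where
  family : IsGroundedFamily q 𝓛.br D φ
  proj_of_mem : ∀ d ≠ 0, ∀ x ∈ 𝓛.gr d, q x = 0
  proj_D : ∀ x, q (D x) = 0
  proj_two : ∀ y, q (φ 2 y) = ⁅y 0, y 1⁆
  proj_higher : ∀ k, 3 ≤ k → ∀ y, q (φ k y) = 0

variable {𝓛 : MultiBrackets L} {q : L →ₗ[ℝ] 𝔤} {D : L →ₗ[ℝ] L}
  {φ : (k : ℕ) → 𝔤 [⋀^Fin k]→ₗ[ℝ] L}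

namespace IsGrounded

lemma proj_br (h : IsGrounded 𝓛 q D φ) {k : ℕ} (hk : 1 ≤ k) (hk2 : k ≠ 2) (x : Fin k → L) :
    q (𝓛.br k x) = 0 := by
  rcases hk.eq_or_lt with rfl | hk
  · rw [h.family.one, h.proj_D]
  · rw [h.family.higher k hk, h.proj_higher k (by omega)]

variable {g : (k : ℕ) → (Fin k → L) → V} {T : L →ₗ[ℝ] V} {ψ : (k : ℕ) → 𝔤 [⋀^Fin k]→ₗ[ℝ] V}

/-- Insertion of a bracket into a map of a grounded family vanishes if an argument has nonzero
degree. -/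
lemma insertion_eq_zero (h : IsGrounded 𝓛 q D φ) (hg : IsGroundedFamily q g T ψ) {m : ℕ}
    (hm : 2 ≤ m) (i : Fin m) (σ : Equiv.Perm (Fin m)) (x : Fin m → L) (a : Fin m)
    (ha : q (x a) = 0) :
    g (m - (i + 1) + 1)
      (Fin.cons (𝓛.br (i + 1) (headArgs i.isLt (x ∘ σ))) (tailArgs i.isLt (x ∘ σ))) = 0 := by
  -- If the offending argument enters the inner bracket, that bracket vanishes, except for l₁, whose
  -- value is killed by `q` in an outer map of arity at least 2. Otherwise the outer map receives
  -- the argument directly.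
  by_cases hlt : (σ.symm a : ℕ) < i + 1
  · by_cases hi : (i : ℕ) = 0
    · rw [hg.higher _ (by omega)]
      exact (ψ _).map_coord_zero 0 (h.proj_br (by omega) (by omega) _)
    · have h0 : 𝓛.br (i + 1) (headArgs i.isLt (x ∘ σ)) = 0 := by
        rw [h.family.higher _ (by omega)]
        refine (φ _).map_coord_zero ⟨σ.symm a, hlt⟩ ?_
        have : headArgs i.isLt (x ∘ σ) ⟨σ.symm a, hlt⟩ = x (σ (σ.symm a)) := rfl
        rw [this, Equiv.apply_symm_apply, ha]
      rw [h0]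
      by_cases hl : m - (i + 1) + 1 = 1
      · rw [hg.apply_of_eq_one hl]
        exact map_zero T
      · rw [hg.higher _ (by omega)]
        exact (ψ _).map_coord_zero 0 (map_zero q)
  · have hb : (σ.symm a : ℕ) - (i + 1) < m - (i + 1) := by omega
    rw [hg.higher _ (by omega)]
    refine (ψ _).map_coord_zero (Fin.succ ⟨_, hb⟩) ?_
    have : tailArgs i.isLt (x ∘ σ) ⟨_, hb⟩ = x (σ (σ.symm a)) := by
      simp only [tailArgs, Function.comp_apply]
      congr 2
      ext
      simp
      omega
    rw [Fin.cons_succ, this, Equiv.apply_symm_apply, ha]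

/-- The inner arity is i + 1. Unless it is 2, the inner value is killed by `q`; unless i + 1 = m,
the outer map factors through `q`. -/
lemma insertion_middle (h : IsGrounded 𝓛 q D φ) (hg : IsGroundedFamily q g T ψ) {m : ℕ}
    (i : Fin m) (hi : (i : ℕ) ≠ 1) (him : (i : ℕ) + 1 ≠ m) (σ : Equiv.Perm (Fin m))
    (x : Fin m → L) :
    g (m - (i + 1) + 1)
      (Fin.cons (𝓛.br (i + 1) (headArgs i.isLt (x ∘ σ))) (tailArgs i.isLt (x ∘ σ))) = 0 := by
  rw [hg.higher _ (by omega)]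
  exact (ψ _).map_coord_zero 0 (h.proj_br (by omega) (by omega) _)

lemma insertion_last (h : IsGrounded 𝓛 q D φ) (hg : IsGroundedFamily q g T ψ) {k : ℕ}
    (hk : 1 ≤ k) (x : Fin (k + 1) → L) :
    g (k + 1 - ((Fin.last k : ℕ) + 1) + 1)
      (Fin.cons (𝓛.br ((Fin.last k : ℕ) + 1) (headArgs (Fin.last k).isLt (x ∘ (1 : Equiv.Perm (Fin (k + 1))))))
        (tailArgs (Fin.last k).isLt (x ∘ (1 : Equiv.Perm (Fin (k + 1)))))) =
      T (φ (k + 1) fun a => q (x a)) := by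
  rw [hg.apply_of_eq_one (by simp)]
  exact congrArg T (h.family.higher (k + 1) (by omega) x)

/-- In arity 2 the two possibly surviving positions, inner arity 2 and outer arity 1, coincide, so
there is a single term. -/
lemma sum_insertion_two (h : IsGrounded 𝓛 q D φ) (hg : IsGroundedFamily q g T ψ)
    (s : (i : Fin 2) → Equiv.Perm (Fin 2) → ℤˣ) (hs : s (Fin.last 1) 1 = 1) (x : Fin 2 → L) :
    ∑ i : Fin 2, ∑ σ ∈ unshuffles (i + 1) 2, s i σ •
      g (2 - (i + 1) + 1)
        (Fin.cons (𝓛.br (i + 1) (headArgs i.isLt (x ∘ σ))) (tailArgs i.isLt (x ∘ σ))) =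
      T (φ 2 fun a => q (x a)) := by
  rw [Fintype.sum_eq_single (Fin.last 1)]
  · have hu : unshuffles ((Fin.last 1 : ℕ) + 1) 2 = {1} := unshuffles_self 2
    rw [hu, Finset.sum_singleton, hs, one_smul]
    exact h.insertion_last hg le_rfl x
  · intro i hi
    refine Finset.sum_eq_zero fun σ _ => ?_
    have hi' : (i : ℕ) ≠ 1 := fun h => hi (Fin.ext h)
    rw [h.insertion_middle hg i hi' (by omega), smul_zero]

/-- The inner bracket l₂ contributes δψ through `sum_unshuffles_two`; outer arity one contributes
the other term. The signs are kept abstract so that the statement serves both the Jacobi identities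
and the morphism equations. -/
lemma sum_insertion (h : IsGrounded 𝓛 q D φ) (hg : IsGroundedFamily q g T ψ) {k : ℕ}
    (s : (i : Fin (k + 3)) → Equiv.Perm (Fin (k + 3)) → ℤˣ)
    (hs1 : ∀ σ, s ⟨1, by omega⟩ σ = Equiv.Perm.sign σ) (hs : s (Fin.last (k + 2)) 1 = 1)
    (x : Fin (k + 3) → L) :
    ∑ i : Fin (k + 3), ∑ σ ∈ unshuffles (i + 1) (k + 3), s i σ •
      g (k + 3 - (i + 1) + 1)
        (Fin.cons (𝓛.br (i + 1) (headArgs i.isLt (x ∘ σ))) (tailArgs i.isLt (x ∘ σ))) =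
      ceD (ψ (k + 2)) (fun a => q (x a)) + T (φ (k + 3) fun a => q (x a)) := by
  rw [Fintype.sum_eq_add ⟨1, by omega⟩ (Fin.last (k + 2)) (by simp [Fin.ext_iff])]
  · congr 1
    · rw [← sum_unshuffles_two]
      refine Finset.sum_congr rfl fun σ _ => ?_
      rw [hs1]
      congr 1
      refine (hg.higher (k + 2) (by omega) _).trans (congrArg (ψ (k + 2)) ?_)
      ext1 b
      induction b using Fin.cases with
      | zero =>
        rw [Fin.cons_zero, Fin.cons_zero]
        refine (congrArg q (h.family.higher 2 le_rfl _)).trans ?_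
        rw [h.proj_two]
        rfl
      | succ b =>
        rw [Fin.cons_succ, Fin.cons_succ]
        simp only [tailArgs, Function.comp_apply]
        congr 3
        ext
        simp
    · have hu : unshuffles ((Fin.last (k + 2) : ℕ) + 1) (k + 3) = {1} := unshuffles_self (k + 3)
      rw [hu, Finset.sum_singleton, hs, one_smul]
      exact h.insertion_last hg (by omega) x
  · rintro i ⟨hi, hi'⟩
    refine Finset.sum_eq_zero fun σ _ => ?_
    rw [h.insertion_middle hg i (fun h => hi (Fin.ext h)) (fun h => hi' (Fin.ext (by simpa using h))),
      smul_zero]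

/-- A grounded structure is an `L∞`-algebra as soon as `δ φ_k + D φ_{k+1} = 0` for `k ≥ 2`. -/
theorem isLInfinityAlgebra (h : IsGrounded 𝓛 q D φ) (internal : DirectSum.IsInternal 𝓛.gr)
    (hD : ∀ d, ∀ x ∈ 𝓛.gr d, D x ∈ 𝓛.gr (d + 1))
    (hφ : ∀ k : ℕ, 2 ≤ k → ∀ y, φ k y ∈ 𝓛.gr (2 - k))
    (hDD : ∀ x, D (D x) = 0) (hD2 : ∀ y, D (φ 2 y) = 0)
    (hmain : ∀ k, 2 ≤ k → ∀ y, ceD (φ k) y + D (φ (k + 1) y) = 0) : IsLInfinityAlgebra 𝓛 where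
  internal := internal
  multilinear := h.family.isMultilin
  degree := h.family.hasDegree h.proj_of_mem 2 (by simpa using hD) hφ
  skew := h.family.isGradedSkew h.proj_of_mem
  jacobi := by
    intro m hm d x hx
    match m, hm with
    | 1, _ =>
      rw [Fintype.sum_unique]
      refine Finset.sum_eq_zero fun σ _ => ?_
      have h1 : 𝓛.br (1 - ((default : Fin 1) + 1) + 1)
          (Fin.cons (𝓛.br ((default : Fin 1) + 1) (headArgs (default : Fin 1).isLt (x ∘ σ)))
            (tailArgs (default : Fin 1).isLt (x ∘ σ))) = 0 := by
        refine (h.family.one _).trans ?_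
        refine (congrArg D (h.family.one _)).trans (hDD _)
      rw [h1, smul_zero]
    | m + 2, _ =>
      by_cases hd : ∀ a, d a = 0
      · obtain rfl : d = fun _ => 0 := funext hd
        cases m with
        | zero =>
          refine (h.sum_insertion_two h.family _ ?_ x).trans (hD2 _)
          simp [koszulSign_zero]
        | succ k =>
          refine (h.sum_insertion h.family _ ?_ ?_ x).trans (hmain _ (by omega) _)
          · intro σ
            rw [koszulSign_zero, Int.negOnePow_even, mul_one, mul_one]
            -- For inner arity 2 the sign exponent i(j - 1) is even.
            exact Even.mul_right (by norm_num) _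
          · simp [koszulSign_zero]
      · push Not at hd
        obtain ⟨a, ha⟩ := hd
        refine Finset.sum_eq_zero fun i _ => Finset.sum_eq_zero fun σ _ => ?_
        rw [h.insertion_eq_zero h.family (by omega) i σ x a (h.proj_of_mem _ ha _ (hx a)),
          smul_zero]

end IsGrounded

end Grounded

/-! ### The central extension as a Lie n-algebra. -/

section CentralExtension

variable {L : Type*} [AddCommGroup L] [Module ℝ L]

lemma isInternal_of_projections {gr : ℤ → Submodule ℝ L} (s : Finset ℤ) (P : ℤ → L →ₗ[ℝ] L)
    (hmem : ∀ i x, P i x ∈ gr i) (hself : ∀ i, ∀ x ∈ gr i, P i x = x)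
    (hother : ∀ i j, j ≠ i → ∀ x ∈ gr j, P i x = 0) (hsum : ∀ x, ∑ i ∈ s, P i x = x) :
    DirectSum.IsInternal gr := by
  constructor
  · rw [injective_iff_map_eq_zero]
    intro w hw
    ext i
    have h1 : ∀ w : DirectSum ℤ fun i => gr i,
        P i (DirectSum.coeAddMonoidHom gr w) = w i := by
      intro w
      induction w using DirectSum.induction_on with
      | zero => simp
      | of j x =>
        rw [DirectSum.coeAddMonoidHom_of]
        by_cases hj : j = i
        · subst hj
          rw [hself _ _ x.2, DirectSum.of_eq_same]
        · rw [hother i j hj _ x.2, DirectSum.of_eq_of_ne _ _ _ (Ne.symm hj)]; rfl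
      | add w z hw hz => rw [map_add, map_add, hw, hz]; rfl
    rw [← h1, hw, map_zero]; rfl
  · intro x
    refine ⟨∑ i ∈ s, DirectSum.of (fun i => gr i) i ⟨P i x, hmem i x⟩, ?_⟩
    rw [map_sum]
    simpa only [DirectSum.coeAddMonoidHom_of] using hsum x

variable (𝔤 : Type*) [LieRing 𝔤] [LieAlgebra ℝ 𝔤]

/-- The Lie bracket as an alternating map of two arguments, and zero for other numbers of arguments. -/
def lieAlt : (k : ℕ) → 𝔤 [⋀^Fin k]→ₗ[ℝ] 𝔤
  -- Presenting the bracket as the coboundary of the identity cochain turns the Jacobi identity into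
  -- δδ = 0.
  | 2 => ceD (AlternatingMap.ofSubsingleton ℝ 𝔤 𝔤 (0 : Fin 1) LinearMap.id)
  | _ => 0

variable {𝔤}

lemma lieAlt_two (y : Fin 2 → 𝔤) : lieAlt 𝔤 2 y = ⁅y 0, y 1⁆ := by
  have h : lieAlt 𝔤 2 y = (lieAlt 𝔤 2).curryLeft (y 0) (Fin.tail y) := by
    rw [AlternatingMap.curryLeft_apply_apply, Matrix.vecCons, Fin.cons_self_tail]
  rw [h, lieAlt, curryLeft_ceD, ceD_of_fin_zero, sub_zero, adAct_apply]
  simp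
  rfl

lemma lieAlt_of_ne {k : ℕ} (hk : k ≠ 2) : lieAlt 𝔤 k = 0 := by
  match k, hk with
  | 0, _ => rfl
  | 1, _ => rfl
  | k + 3, _ => rfl

lemma ceD_lieAlt (k : ℕ) : ceD (lieAlt 𝔤 k) = 0 := by
  by_cases hk : k = 2
  · subst hk
    exact ceD_ceD _
  · rw [lieAlt_of_ne hk, ceD_zero]

lemma ofLieAlgebra_br (k : ℕ) (x : Fin k → 𝔤) : (ofLieAlgebra 𝔤).br k x = lieAlt 𝔤 k x := by
  match k with
  | 0 => rfl
  | 1 => rfl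
  | 2 => rw [lieAlt_two]; rfl
  | k + 3 => rfl

/-- The brackets of the central extension by `c`. -/
def extensionAlt (n : ℕ) (c : 𝔤 [⋀^Fin (n + 1)]→ₗ[ℝ] ℝ) (k : ℕ) : 𝔤 [⋀^Fin k]→ₗ[ℝ] (𝔤 × ℝ) :=
  (lieAlt 𝔤 k).prod (if h : k = n + 1 then c.domDomCongr (finCongr h.symm) else 0)

lemma centralExtension_br (n : ℕ) (c : 𝔤 [⋀^Fin (n + 1)]→ₗ[ℝ] ℝ) (k : ℕ) (x : Fin k → 𝔤 × ℝ) :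
    (centralExtension n c).br k x = extensionAlt n c k fun a => (x a).1 := by
  refine Prod.ext (ofLieAlgebra_br k _) ?_
  by_cases h : k = n + 1
  · simp only [centralExtension, extensionAlt, h, dif_pos, AlternatingMap.prod_apply]
    rfl
  · simp [centralExtension, extensionAlt, h]

lemma ceD_extensionAlt {n : ℕ} {c : 𝔤 [⋀^Fin (n + 1)]→ₗ[ℝ] ℝ} (hc : ceD c = 0) (k : ℕ) :
    ceD (extensionAlt n c k) = 0 := by
  refine AlternatingMap.ext fun y => Prod.ext ?_ ?_
  · have h := ceD_comp (LinearMap.fst ℝ 𝔤 ℝ) (extensionAlt n c k)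
    have h' : (LinearMap.fst ℝ 𝔤 ℝ).compAlternatingMap (extensionAlt n c k) = lieAlt 𝔤 k := rfl
    rw [h', ceD_lieAlt] at h
    exact congrArg (fun F : 𝔤 [⋀^Fin (k + 1)]→ₗ[ℝ] 𝔤 => F y) h.symm
  · have h := ceD_comp (LinearMap.snd ℝ 𝔤 ℝ) (extensionAlt n c k)
    have h' : ceD ((LinearMap.snd ℝ 𝔤 ℝ).compAlternatingMap (extensionAlt n c k)) = 0 := by
      have h1 : (LinearMap.snd ℝ 𝔤 ℝ).compAlternatingMap (extensionAlt n c k) =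
        if h : k = n + 1 then c.domDomCongr (finCongr h.symm) else 0 := rfl
      rw [h1]
      by_cases hk : k = n + 1
      · subst hk
        rw [dif_pos rfl]
        exact hc
      · rw [dif_neg hk, ceD_zero]
    rw [h'] at h
    exact congrArg (fun F : 𝔤 [⋀^Fin (k + 1)]→ₗ[ℝ] ℝ => F y) h.symm

/-- The condition 1 ≤ n keeps the cochain of arity n + 1 out of l₁, which is therefore zero. For n =
1 the centre also lies in degree 0, but the first projection still kills it. -/
lemma isGrounded_centralExtension {n : ℕ} (hn : 1 ≤ n) (c : 𝔤 [⋀^Fin (n + 1)]→ₗ[ℝ] ℝ) :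
    IsGrounded (centralExtension n c) (LinearMap.fst ℝ 𝔤 ℝ) 0 (extensionAlt n c) where
  family :=
    { one := fun x => by
        rw [centralExtension_br]
        refine Prod.ext rfl ?_
        have h1 : n ≠ 0 := by omega
        simp [extensionAlt, h1]
      higher := fun k _ x => centralExtension_br n c k x }
  proj_of_mem d hd x hx := by
    have := hx.1
    simpa [hd] using this
  proj_D _ := rfl
  proj_two y := lieAlt_two y
  proj_higher k hk y := by
    change lieAlt 𝔤 k y = 0
    rw [lieAlt_of_ne (by omega)]; rfl

theorem isLieNAlgebra_centralExtension {n : ℕ} (hn : 1 ≤ n) {c : 𝔤 [⋀^Fin (n + 1)]→ₗ[ℝ] ℝ}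
    (hc : ceD c = 0) : IsLieNAlgebra n (centralExtension n c) where
  toIsLInfinityAlgebra := by
    refine (isGrounded_centralExtension hn c).isLInfinityAlgebra ?_ ?_ ?_ ?_ ?_ ?_
    -- For n = 1 the two degrees coincide and the set has one element; the two components are
    -- projected separately, so nothing is counted twice.
    · refine isInternal_of_projections {0, 1 - (n : ℤ)}
        (fun i => LinearMap.prodMap (if i = 0 then LinearMap.id else 0)
          (if i = 1 - (n : ℤ) then LinearMap.id else 0)) ?_ ?_ ?_ ?_
      · intro i x
        refine ⟨?_, ?_⟩
        · by_cases h : i = 0 <;> simp [h]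
        · by_cases h : i = 1 - (n : ℤ) <;> simp [h]
      · rintro i x ⟨h1, h2⟩
        refine Prod.ext ?_ ?_
        · by_cases h : i = 0
          · simp [h]
          · simp only [h, if_false, SetLike.mem_coe, Submodule.mem_bot] at h1
            simp [h, h1]
        · by_cases h : i = 1 - (n : ℤ)
          · simp [h]
          · simp only [h, if_false, SetLike.mem_coe, Submodule.mem_bot] at h2
            simp [h, h2]
      · rintro i j hij x ⟨h1, h2⟩
        refine Prod.ext ?_ ?_
        · by_cases h : i = 0
          · have hj : j ≠ 0 := fun hj => hij (hj.trans h.symm)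
            simp only [hj, if_false, SetLike.mem_coe, Submodule.mem_bot] at h1
            simp [h, h1]
          · simp [h]
        · by_cases h : i = 1 - (n : ℤ)
          · have hj : j ≠ 1 - (n : ℤ) := fun hj => hij (hj.trans h.symm)
            simp only [hj, if_false, SetLike.mem_coe, Submodule.mem_bot] at h2
            simp [h, h2]
          · simp [h]
      · intro x
        have h1 : ∀ i : ℤ, (if i = 0 then (LinearMap.id : 𝔤 →ₗ[ℝ] 𝔤) else 0) x.1 =
            if i = 0 then x.1 else 0 := fun i => by split_ifs <;> rfl
        have h2 : ∀ i : ℤ, (if i = 1 - (n : ℤ) then (LinearMap.id : ℝ →ₗ[ℝ] ℝ) else 0) x.2 =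
            if i = 1 - (n : ℤ) then x.2 else 0 := fun i => by split_ifs <;> rfl
        refine Prod.ext ?_ ?_
        · simp only [Prod.fst_sum, LinearMap.prodMap_apply, h1, Finset.sum_ite_eq']
          simp
        · simp only [Prod.snd_sum, LinearMap.prodMap_apply, h2, Finset.sum_ite_eq']
          simp
    · intro d x _
      exact Submodule.zero_mem _
    · intro k hk y
      refine ⟨?_, ?_⟩
      · change lieAlt 𝔤 k y ∈ (if (2 : ℤ) - k = 0 then (⊤ : Submodule ℝ 𝔤) else ⊥)
        by_cases h : k = 2
        · subst h; simp
        · rw [lieAlt_of_ne h]; exact Submodule.zero_mem _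
      · by_cases h : k = n + 1
        · subst h
          have : (2 : ℤ) - ((n + 1 : ℕ) : ℤ) = 1 - n := by push_cast; ring
          rw [this]
          simp
        · simp [extensionAlt, h]
    · intro x; rfl
    · intro y; rfl
    · intro k _ y
      rw [ceD_extensionAlt hc]
      exact add_zero _
  concentrated i hi := by
    have h0 : i ≠ 0 := by omega
    have h1 : i ≠ 1 - (n : ℤ) := by omega
    simp [centralExtension, h0, h1]

lemma isStrictMorphism_fst {n : ℕ} (c : 𝔤 [⋀^Fin (n + 1)]→ₗ[ℝ] ℝ) :
    IsStrictMorphism (centralExtension n c) (ofLieAlgebra 𝔤) (LinearMap.fst ℝ 𝔤 ℝ) :=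
  ⟨fun _ _ hx => hx.1, fun _ _ _ => rfl⟩

lemma isStrictMorphism_lieHom {𝔥 : Type*} [LieRing 𝔥] [LieAlgebra ℝ 𝔥] (v : 𝔤 →ₗ⁅ℝ⁆ 𝔥) :
    IsStrictMorphism (ofLieAlgebra 𝔤) (ofLieAlgebra 𝔥) (v : 𝔤 →ₗ[ℝ] 𝔥) := by
  refine ⟨fun i x hx => ?_, fun k _ x => ?_⟩
  · by_cases hi : i = 0
    · simp [ofLieAlgebra, hi]
    · simp only [ofLieAlgebra, hi, if_false, Submodule.mem_bot] at hx ⊢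
      rw [hx, map_zero]
  · match k with
    | 0 => exact (map_zero v).symm
    | 1 => exact (map_zero v).symm
    | 2 => exact (v.map_lie _ _).symm
    | k + 3 => exact (map_zero v).symm

end CentralExtension

/-! ### The Lie n-algebra of observables. -/

section ObservablesAlgebra

lemma varsig_succ (k : ℕ) : varsig (k + 1) = (-1) ^ (k + 1) * varsig k := by
  have h : (k + 1) * (k + 1 + 1) / 2 = k * (k + 1) / 2 + (k + 1) := by
    have : (k + 1) * (k + 1 + 1) = k * (k + 1) + (k + 1) * 2 := by ring
    rw [this, Nat.add_mul_div_right _ _ two_pos]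
  rw [varsig, varsig, h, pow_add]
  ring

lemma varsig_two : varsig 2 = 1 := by norm_num [varsig]

lemma varsig_one : varsig 1 = 1 := by norm_num [varsig]

variable {A : Type*} [CommRing A] [Algebra ℝ A] {m : ℕ}

lemma Pi_single_eq_domDomCongr {N K : ℕ} (ω : Form A N) (h : K = N) :
    (Pi.single N ω : TotalForm A) K = ω.domDomCongr (finCongr h.symm) := by
  subst h
  rw [Pi.single_eq_same]
  rfl

lemma iotaTot_single {N k : ℕ} (ω : Form A N) (v : Fin k → VF A) (j : ℕ) (h : j + k ≠ N) :
    iotaTot k v (Pi.single N ω) j = 0 := by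
  have h0 : (Pi.single N ω : TotalForm A) (j + k) = (0 : TotalForm A) (j + k) :=
    Pi.single_eq_of_ne h ω
  rw [iotaTot_apply, h0, ← iotaTot_apply, map_zero]; rfl

/-- The purpose of ς: since ς(k + 1) = (-1)^{k+1} ς(k), the sign (-1)^k of `dTot_contraction`
becomes a uniform -1, as the generalized Jacobi identities require. -/
lemma dTot_varsig_contraction {𝔤 : Type*} [LieRing 𝔤] [LieAlgebra ℝ 𝔤] (v : 𝔤 →ₗ⁅ℝ⁆ VF A)
    (β : TotalForm A) (hd : dTot β = 0) (hβ : ∀ x, lTot (v x) β = 0) (k : ℕ)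
    (y : Fin (k + 1) → 𝔤) :
    dTot ((varsig (k + 1) • contraction v β (k + 1)) y) =
      -ceD (varsig k • contraction v β k) y := by
  have h : dTot (contraction v β (k + 1) y) = (-1 : ℝ) ^ k • ceD (contraction v β k) y :=
    DFunLike.congr_fun (dTot_contraction v β hd hβ k) y
  rw [AlternatingMap.smul_apply, map_smul, h, ceD_smul, smul_smul,
    AlternatingMap.smul_apply, ← neg_smul, varsig_succ]
  congr 1
  have : ((-1 : ℝ) ^ k) * (-1) ^ k = 1 := by rw [← mul_pow]; simp
  linear_combination (-varsig k) * this

variable {ω : Form A (m + 2)}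

lemma dTot_single_eq_zero (hω : extD (m + 2) ω = 0) :
    dTot (Pi.single (m + 2) ω : TotalForm A) = 0 := by
  rw [dTot_single, hω, Pi.single_zero]

/-- For X Hamiltonian, ι_X ω = -dα is closed, and ω is closed; Cartan's formula gives L_X ω = 0. -/
lemma lTot_single_eq_zero (hω : extD (m + 2) ω = 0) (X : hamVectorFields ω hω) :
    lTot (X : VF A) (Pi.single (m + 2) ω) = 0 := by
  obtain ⟨X, α, hα⟩ := X
  have h := iTot_dTot X (Pi.single (m + 2) ω)
  have hs : iTot X (Pi.single (m + 2) ω) = -dTot (Pi.single m α) := by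
    rw [dTot_single, hα, iTot_single, Pi.single_neg, neg_neg]
  rw [dTot_single_eq_zero hω, map_zero, hs, map_neg, dTot_dTot, neg_zero, sub_zero] at h
  exact h.symm

/-- The element of the space of observables with vector field `X` and components `β`. -/
def obsMk (X : VF A) (β : TotalForm A) (h : extD m (β m) = -iota X ω) :
    hamPairs ω × LowForms A m :=
  (⟨(X, β m), h⟩, fun j => β j)

lemma obsMk_eq_zero {X : VF A} {β : TotalForm A} {h : extD m (β m) = -iota X ω} (hX : X = 0)
    (hβ : ∀ j ≤ m, β j = 0) : obsMk X β h = 0 :=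
  Prod.ext (Subtype.ext (Prod.ext hX (hβ m le_rfl))) (funext fun j => hβ j j.isLt.le)

lemma obsMk_add_eq {X₁ X₂ Y : VF A} {β₁ β₂ γ : TotalForm A}
    {h₁ : extD m (β₁ m) = -iota X₁ ω} {h₂ : extD m (β₂ m) = -iota X₂ ω}
    {h : extD m (γ m) = -iota Y ω} (hX : X₁ + X₂ = Y) (hβ : β₁ + β₂ = γ) :
    obsMk X₁ β₁ h₁ + obsMk X₂ β₂ h₂ = obsMk Y γ h := by
  subst hX hβ; rfl

lemma obsMk_add_eq_add {X₁ X₂ Y₁ Y₂ : VF A} {β₁ β₂ γ₁ γ₂ : TotalForm A}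
    {h₁ : extD m (β₁ m) = -iota X₁ ω} {h₂ : extD m (β₂ m) = -iota X₂ ω}
    {h₃ : extD m (γ₁ m) = -iota Y₁ ω} {h₄ : extD m (γ₂ m) = -iota Y₂ ω}
    (hX : X₁ + X₂ = Y₁ + Y₂) (hβ : β₁ + β₂ = γ₁ + γ₂) :
    obsMk X₁ β₁ h₁ + obsMk X₂ β₂ h₂ = obsMk Y₁ γ₁ h₃ + obsMk Y₂ γ₂ h₄ :=
  Prod.ext (Subtype.ext (Prod.ext hX (congrFun hβ m))) (funext fun j => congrFun hβ j)

lemma iota_zero_left {k : ℕ} (α : Form A (k + 1)) : iota 0 α = 0 := map_zero α.curryLeft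

/-- The alternating map into the space of observables with given components. -/
def obsAlt {𝔤 : Type*} [AddCommGroup 𝔤] [Module ℝ 𝔤] {k : ℕ} (X : 𝔤 [⋀^Fin k]→ₗ[ℝ] VF A)
    (β : 𝔤 [⋀^Fin k]→ₗ[ℝ] TotalForm A) (h : ∀ y, extD m (β y m) = -iota (X y) ω) :
    𝔤 [⋀^Fin k]→ₗ[ℝ] (hamPairs ω × LowForms A m) :=
  ((X.prod ((LinearMap.proj m : TotalForm A →ₗ[ℝ] Form A m).compAlternatingMap β)).codRestrict
    (hamPairs ω) h).prod
    ((LinearMap.pi fun j : Fin m => LinearMap.proj (j : ℕ)).compAlternatingMap β)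

lemma obsAlt_apply {𝔤 : Type*} [AddCommGroup 𝔤] [Module ℝ 𝔤] {k : ℕ} (X : 𝔤 [⋀^Fin k]→ₗ[ℝ] VF A)
    (β : 𝔤 [⋀^Fin k]→ₗ[ℝ] TotalForm A) (h : ∀ y, extD m (β y m) = -iota (X y) ω)
    (y : Fin k → 𝔤) : obsAlt X β h y = obsMk (X y) (β y) (h y) := rfl

/-- The condition is an equality of two cochains obtained by applying linear maps to `X` and `β`,
and δ commutes with linear maps. -/
lemma ceD_obs_condition {𝔤 : Type*} [LieRing 𝔤] [LieAlgebra ℝ 𝔤] {k : ℕ}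
    (X : 𝔤 [⋀^Fin k]→ₗ[ℝ] VF A) (β : 𝔤 [⋀^Fin k]→ₗ[ℝ] TotalForm A)
    (h : ∀ y, extD m (β y m) = -iota (X y) ω) (y : Fin (k + 1) → 𝔤) :
    extD m (ceD β y m) = -iota (ceD X y) ω := by
  let S : TotalForm A →ₗ[ℝ] Form A (m + 1) := extD m ∘ₗ LinearMap.proj m
  let S' : VF A →ₗ[ℝ] Form A (m + 1) :=
    { toFun := fun X => -iota X ω
      map_add' := fun X Y => by rw [iota_add_left, neg_add]
      map_smul' := fun r X => by
        rw [iota_smul_left_real]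
        exact (smul_neg r (iota X ω)).symm }
  have hS : S.compAlternatingMap β = S'.compAlternatingMap X := AlternatingMap.ext h
  have h1 := ceD_comp S β
  rw [hS, ceD_comp S' X] at h1
  exact congrArg (fun F : 𝔤 [⋀^Fin (k + 1)]→ₗ[ℝ] Form A (m + 1) => F y) h1.symm

lemma ceD_obsAlt {𝔤 : Type*} [LieRing 𝔤] [LieAlgebra ℝ 𝔤] {k : ℕ} (X : 𝔤 [⋀^Fin k]→ₗ[ℝ] VF A)
    (β : 𝔤 [⋀^Fin k]→ₗ[ℝ] TotalForm A) (h : ∀ y, extD m (β y m) = -iota (X y) ω)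
    (y : Fin (k + 1) → 𝔤) :
    ceD (obsAlt X β h) y = obsMk (ceD X y) (ceD β y) (ceD_obs_condition X β h y) := by
  have comp : ∀ {W : Type _} [AddCommGroup W] [Module ℝ W]
      (p : (hamPairs ω × LowForms A m) →ₗ[ℝ] W),
      p (ceD (obsAlt X β h) y) = ceD (p.compAlternatingMap (obsAlt X β h)) y := by
    intro W _ _ p
    exact (DFunLike.congr_fun (ceD_comp (V := hamPairs ω × LowForms A m) p (obsAlt X β h)) y).symm
  have comp' : ∀ {W : Type _} [AddCommGroup W] [Module ℝ W] (p : TotalForm A →ₗ[ℝ] W),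
      p (ceD β y) = ceD (p.compAlternatingMap β) y := by
    intro W _ _ p
    rw [ceD_comp]; rfl
  refine Prod.ext (Subtype.ext (Prod.ext ?_ ?_)) ?_
  · exact comp (LinearMap.fst ℝ (VF A) (Form A m) ∘ₗ (hamPairs ω).subtype ∘ₗ
      LinearMap.fst ℝ (hamPairs ω) (LowForms A m))
  · refine (comp (LinearMap.snd ℝ (VF A) (Form A m) ∘ₗ (hamPairs ω).subtype ∘ₗ
      LinearMap.fst ℝ (hamPairs ω) (LowForms A m))).trans ?_
    exact (comp' (LinearMap.proj m : TotalForm A →ₗ[ℝ] Form A m)).symm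
  · refine (comp (LinearMap.snd ℝ (hamPairs ω) (LowForms A m))).trans ?_
    exact (comp' (LinearMap.pi fun j : Fin m => LinearMap.proj (j : ℕ))).symm

/-- A j-form sits in degree j - m, so the component paired with the vector field is the one of
degree 0. -/
lemma obsMk_mem (hω : extD (m + 2) ω = 0) {X : VF A} {β : TotalForm A}
    {h : extD m (β m) = -iota X ω} {d : ℤ} (hX : d ≠ 0 → X = 0)
    (hβ : ∀ j : ℕ, (j : ℤ) - m ≠ d → β j = 0) : obsMk X β h ∈ (observables ω hω).gr d := by
  refine ⟨?_, fun j _ => ?_⟩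
  · by_cases hd : d = 0
    · simp [hd]
    · simp only [hd, if_false, SetLike.mem_coe, Submodule.mem_bot]
      refine Subtype.ext (Prod.ext (hX hd) (hβ m ?_))
      simpa using Ne.symm hd
  · by_cases hj : ((j : ℕ) : ℤ) - m = d
    · simp [hj]
    · simp only [hj, if_false, SetLike.mem_coe, Submodule.mem_bot]
      exact hβ j hj

variable (ω) in
/-- The differential `l₁` of the Lie `n`-algebra of observables. -/
def obsD :
    (hamPairs ω × LowForms A m) →ₗ[ℝ] (hamPairs ω × LowForms A m) where
  toFun x := (⟨(0, dTop m x.2), by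
    change extD m (dTop m x.2) = -iota 0 ω
    rw [extD_dTop, iota_zero_left, neg_zero]⟩, dLow x.2)
  map_add' x y := by
    refine Prod.ext (Subtype.ext (Prod.ext (add_zero 0).symm ?_)) (funext fun j => ?_)
    · cases m with
      | zero => exact (add_zero 0).symm
      | succ m => exact map_add (extD m) _ _
    · match j with
      | ⟨0, _⟩ => exact (add_zero 0).symm
      | ⟨j + 1, _⟩ => exact map_add (extD j) _ _
  map_smul' r x := by
    refine Prod.ext (Subtype.ext (Prod.ext (smul_zero r).symm ?_)) (funext fun j => ?_)
    · cases m with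
      | zero => exact (smul_zero r).symm
      | succ m => exact map_smul (extD m) _ _
    · match j with
      | ⟨0, _⟩ => exact (smul_zero r).symm
      | ⟨j + 1, _⟩ => exact map_smul (extD j) _ _

lemma obsD_condition (β : TotalForm A) : extD m (dTot β m) = -iota 0 ω := by
  rw [iota_zero_left, neg_zero]
  exact congrFun (dTot_dTot β) (m + 1)

/-- The total differential also has a component of degree m + 1, which `obsMk` discards; this is how
l₁ = 0 on degree 0 is encoded. -/
lemma obsD_obsMk (X : VF A) (β : TotalForm A) (h : extD m (β m) = -iota X ω) :
    obsD ω (obsMk X β h) = obsMk 0 (dTot β) (obsD_condition β) := by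
  refine Prod.ext (Subtype.ext (Prod.ext rfl ?_)) (funext fun j => ?_)
  · cases m with
    | zero => rfl
    | succ m => rfl
  · match j with
    | ⟨0, _⟩ => rfl
    | ⟨j + 1, _⟩ => rfl

lemma obsD_obsD (x : hamPairs ω × LowForms A m) : obsD ω (obsD ω x) = 0 := by
  refine Prod.ext (Subtype.ext (Prod.ext rfl ?_)) (funext fun j => ?_)
  · cases m with
    | zero => rfl
    | succ m =>
      cases m with
      | zero => exact map_zero (extD 0)
      | succ m => exact extD_extD _
  · match j with
    | ⟨0, _⟩ => rfl
    | ⟨1, _⟩ => exact map_zero (extD 0)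
    | ⟨j + 2, _⟩ => exact extD_extD _

lemma obsD_mem (hω : extD (m + 2) ω = 0) {d : ℤ} {x : hamPairs ω × LowForms A m}
    (hx : x ∈ (observables ω hω).gr d) : obsD ω x ∈ (observables ω hω).gr (d + 1) := by
  have hx2 : ∀ j : Fin m, ((j : ℕ) : ℤ) - m ≠ d → x.2 j = 0 := by
    intro j hj
    have := hx.2 j (Set.mem_univ j)
    simpa [hj] using this
  refine ⟨?_, fun j _ => ?_⟩
  · by_cases hd : d + 1 = 0
    · simp [hd]
    · simp only [hd, if_false, SetLike.mem_coe, Submodule.mem_bot]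
      refine Subtype.ext (Prod.ext rfl ?_)
      cases m with
      | zero => rfl
      | succ m =>
        have : x.2 (Fin.last m) = 0 := hx2 _ (by simp; omega)
        change extD m (x.2 (Fin.last m)) = 0
        rw [this]
        exact map_zero (extD m)
  · by_cases hj : ((j : ℕ) : ℤ) - m = d + 1
    · simp [hj]
    · simp only [hj, if_false, SetLike.mem_coe, Submodule.mem_bot]
      match j, hj with
      | ⟨0, _⟩, _ => rfl
      | ⟨j + 1, h⟩, hj =>
        have : x.2 ⟨j, Nat.lt_of_succ_lt h⟩ = 0 := hx2 _ (by
          intro h'; apply hj; push_cast at h' ⊢; linarith)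
        change extD j (x.2 ⟨j, _⟩) = 0
        rw [this]
        exact map_zero (extD j)

variable (hω : extD (m + 2) ω = 0)

/-- The components `ς(k) ι(v₁ ∧ ⋯ ∧ v_k) ω` of the brackets of observables. -/
def obsContraction (k : ℕ) : hamVectorFields ω hω [⋀^Fin k]→ₗ[ℝ] TotalForm A :=
  varsig k • contraction (hamVectorFields ω hω).incl (Pi.single (m + 2) ω) k

lemma obsContraction_apply (k : ℕ) (y : Fin k → hamVectorFields ω hω) :
    obsContraction hω k y =
      varsig k • iotaTot k (fun a => (y a : VF A)) (Pi.single (m + 2) ω) := rfl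

lemma obsContraction_eq_zero {k j : ℕ} (h : j + k ≠ m + 2) (y : Fin k → hamVectorFields ω hω) :
    obsContraction hω k y j = 0 := by
  rw [obsContraction_apply, Pi.smul_apply, iotaTot_single _ _ _ h, smul_zero]

lemma dTot_obsContraction (k : ℕ) (y : Fin (k + 1) → hamVectorFields ω hω) :
    dTot (obsContraction hω (k + 1) y) = -ceD (obsContraction hω k) y :=
  dTot_varsig_contraction (hamVectorFields ω hω).incl _ (dTot_single_eq_zero hω)
    (lTot_single_eq_zero hω) k y

/-- The vector field components `[v₁, v₂]` of the brackets of observables. -/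
def obsLie (k : ℕ) : hamVectorFields ω hω [⋀^Fin k]→ₗ[ℝ] VF A :=
  ((hamVectorFields ω hω).incl : hamVectorFields ω hω →ₗ[ℝ] VF A).compAlternatingMap
    (lieAlt (hamVectorFields ω hω) k)

/-- A form of degree m arises only for k = 2, where the identity says that [X, Y] is Hamiltonian
with the expected potential. For other k both sides vanish. -/
lemma obs_condition (k : ℕ) (y : Fin k → hamVectorFields ω hω) :
    extD m (obsContraction hω k y m) = -iota (obsLie hω k y) ω := by
  by_cases hk : k = 2
  · subst hk
    have h1 : obsLie hω 2 y = ⁅(y 0 : VF A), (y 1 : VF A)⁆ := by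
      rw [obsLie, LinearMap.compAlternatingMap_apply, lieAlt_two]; rfl
    have h2 : obsContraction hω 2 y m = iota (y 1 : VF A) (iota (y 0 : VF A) ω) := by
      rw [obsContraction_apply, varsig_two, one_smul, iotaTot_apply, Pi.single_eq_same]; rfl
    obtain ⟨α, hα⟩ := (y 0).2
    obtain ⟨β, hβ⟩ := (y 1).2
    rw [h1, h2]
    exact extD_iota_iota_of_hamiltonian ω hω hα hβ
  · have h1 : obsLie hω k y = 0 := by
      rw [obsLie, lieAlt_of_ne hk]; rfl
    rw [h1, iota_zero_left, neg_zero, obsContraction_eq_zero hω (by omega), map_zero]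

/-- The brackets of the Lie `n`-algebra of observables. -/
def obsBr (k : ℕ) : hamVectorFields ω hω [⋀^Fin k]→ₗ[ℝ] (hamPairs ω × LowForms A m) :=
  obsAlt (obsLie hω k) (obsContraction hω k) (obs_condition hω k)

lemma obsBr_apply (k : ℕ) (y : Fin k → hamVectorFields ω hω) : obsBr hω k y =
    obsMk (obsLie hω k y) (obsContraction hω k y) (obs_condition hω k y) := rfl

lemma observables_br {k : ℕ} (hk : 2 ≤ k) (x : Fin k → hamPairs ω × LowForms A m) :
    (observables ω hω).br k x = obsBr hω k fun a => observablesProj ω hω (x a) := by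
  match k, hk with
  | 2, _ =>
    refine Prod.ext (Subtype.ext (Prod.ext ?_ ?_)) (funext fun j => ?_)
    · change _ = obsLie hω 2 _
      rw [obsLie, LinearMap.compAlternatingMap_apply, lieAlt_two]; rfl
    · change _ = obsContraction hω 2 _ m
      rw [obsContraction_apply, varsig_two, one_smul, iotaTot_apply, Pi.single_eq_same]; rfl
    · exact (obsContraction_eq_zero hω (by omega) _).symm
  | k + 3, _ =>
    refine Prod.ext (Subtype.ext (Prod.ext rfl ?_)) (funext fun j => ?_)
    · exact (obsContraction_eq_zero hω (by omega) _).symm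
    · change (if h : j + (k + 3) = m + 2 then varsig (k + 3) •
            iotaMulti (k + 3) (fun a => (x a).1.1.1) (ω.domDomCongr (finCongr h.symm)) else 0) =
        obsContraction hω (k + 3) _ j
      by_cases h : (j : ℕ) + (k + 3) = m + 2
      · rw [dif_pos h, obsContraction_apply, Pi.smul_apply, iotaTot_apply,
          Pi_single_eq_domDomCongr ω h]
        rfl
      · rw [dif_neg h, obsContraction_eq_zero hω h]

lemma isGrounded_observables :
    IsGrounded (observables ω hω) (observablesProj ω hω) (obsD ω) (obsBr hω) where
  family :=
    { one := fun _ => rfl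
      higher := fun _ hk x => observables_br hω hk x }
  proj_of_mem d hd x hx := by
    have h1 : x.1 = 0 := by simpa [hd] using hx.1
    refine Subtype.ext ?_
    change x.1.1.1 = 0
    rw [h1]; rfl
  proj_D _ := rfl
  proj_two y := Subtype.ext (congrArg Subtype.val (lieAlt_two y))
  proj_higher k hk y := by
    refine Subtype.ext ?_
    change obsLie hω k y = 0
    rw [obsLie, lieAlt_of_ne (by omega)]; rfl

lemma isInternal_prod_pi {H : Type*} [AddCommGroup H] [Module ℝ H] {m : ℕ} (K : Fin m → Type*)
    [∀ j, AddCommGroup (K j)] [∀ j, Module ℝ (K j)] :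
    DirectSum.IsInternal fun i : ℤ =>
      Submodule.prod (if i = 0 then (⊤ : Submodule ℝ H) else ⊥) (Submodule.pi Set.univ fun j : Fin m =>
        if ((j : ℕ) : ℤ) - m = i then (⊤ : Submodule ℝ (K j)) else ⊥) := by
  have key : ∀ i : ℤ, ∀ x ∈ Submodule.prod (if i = 0 then (⊤ : Submodule ℝ H) else ⊥)
      (Submodule.pi Set.univ fun j : Fin m =>
        if ((j : ℕ) : ℤ) - m = i then (⊤ : Submodule ℝ (K j)) else ⊥), (i ≠ 0 → x.1 = 0) ∧
      ∀ j : Fin m, ((j : ℕ) : ℤ) - m ≠ i → x.2 j = 0 := by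
    intro i x hx
    refine ⟨fun hi => by simpa [hi] using hx.1, fun j hj => ?_⟩
    have := hx.2 j (Set.mem_univ j)
    simpa [hj] using this
  let P : ℤ → (H × ((j : Fin m) → K j)) →ₗ[ℝ] (H × ((j : Fin m) → K j)) := fun i =>
    LinearMap.prodMap (if i = 0 then LinearMap.id else 0)
      (LinearMap.pi fun j : Fin m => if ((j : ℕ) : ℤ) - m = i then LinearMap.proj j else 0)
  have hP1 : ∀ i x, (P i x).1 = if i = 0 then x.1 else 0 := fun i x => by
    change (if i = 0 then LinearMap.id else (0 : H →ₗ[ℝ] H)) x.1 = _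
    split_ifs <;> rfl
  have hP2 : ∀ i x j, (P i x).2 j = if ((j : ℕ) : ℤ) - m = i then x.2 j else 0 := fun i x j => by
    change (if ((j : ℕ) : ℤ) - m = i then LinearMap.proj j
      else (0 : ((j : Fin m) → K j) →ₗ[ℝ] K j)) x.2 = _
    split_ifs <;> rfl
  refine isInternal_of_projections (Finset.Icc (-m : ℤ) 0) P ?_ ?_ ?_ ?_
  · intro i x
    refine ⟨?_, fun j _ => ?_⟩
    · rw [SetLike.mem_coe, hP1]
      by_cases hi : i = 0 <;> simp [hi]
    · rw [hP2]
      by_cases hj : ((j : ℕ) : ℤ) - m = i <;> simp [hj]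
  · intro i x hx
    refine Prod.ext ?_ (funext fun j => ?_)
    · rw [hP1]
      split_ifs with h
      · rfl
      · exact ((key i x hx).1 h).symm
    · rw [hP2]
      split_ifs with h
      · rfl
      · exact ((key i x hx).2 j h).symm
  · intro i j hij x hx
    refine Prod.ext ?_ (funext fun l => ?_)
    · rw [hP1]
      split_ifs with h
      · exact (key j x hx).1 (h ▸ hij)
      · rfl
    · rw [hP2]
      split_ifs with h
      · exact (key j x hx).2 l (h ▸ hij.symm)
      · rfl
  · intro x
    refine Prod.ext ?_ (funext fun j => ?_)
    · rw [Prod.fst_sum]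
      simp only [hP1, Finset.sum_ite_eq']
      simp
    · rw [Prod.snd_sum, Finset.sum_apply]
      simp only [hP2, Finset.sum_ite_eq]
      rw [if_pos]
      rw [Finset.mem_Icc]
      have := j.isLt
      omega

lemma isInternal_observables : DirectSum.IsInternal (observables ω hω).gr :=
  isInternal_prod_pi (H := hamPairs ω) (K := fun j : Fin m => Form A j)

theorem isLieNAlgebra_observables : IsLieNAlgebra (m + 1) (observables ω hω) where
  toIsLInfinityAlgebra := by
    refine (isGrounded_observables hω).isLInfinityAlgebra (isInternal_observables hω)
      (fun d x hx => obsD_mem hω hx) ?_ obsD_obsD ?_ ?_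
    · intro k hk y
      rw [obsBr_apply]
      refine obsMk_mem hω (fun hd => ?_) fun j hj => ?_
      · rw [obsLie, lieAlt_of_ne (by omega)]; rfl
      · exact obsContraction_eq_zero hω (by omega) y
    · intro y
      rw [obsBr_apply, obsD_obsMk]
      -- The contraction with two fields lives only in form degree m, so its differential lies in
      -- the discarded degree m + 1.
      refine obsMk_eq_zero rfl fun j hj => ?_
      cases j with
      | zero => rfl
      | succ j => rw [dTot_succ, obsContraction_eq_zero hω (by omega), map_zero]
    · intro k hk y
      rw [obsBr_apply, obsD_obsMk, obsBr, ceD_obsAlt]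
      -- Vector field components cancel by the Jacobi identity, form components by d C_{k+1} = -δ
      -- C_k.
      have h0 : ceD (obsLie hω k) y = 0 := by
        rw [obsLie, ceD_comp, ceD_lieAlt]; exact map_zero (hamVectorFields ω hω).incl
      have hz : extD m ((0 : TotalForm A) m) = -iota 0 ω := by
        rw [iota_zero_left, neg_zero]; exact map_zero (extD m)
      refine (obsMk_add_eq (h := hz) (by rw [h0, add_zero]) ?_).trans
        (obsMk_eq_zero rfl fun _ _ => rfl)
      rw [dTot_obsContraction, add_neg_cancel]
  concentrated i hi := by
    have h0 : i ≠ 0 := by omega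
    have h1 : ∀ j : Fin m, ((j : ℕ) : ℤ) - m ≠ i := fun j => by
      have := j.isLt
      omega
    refine eq_bot_iff.2 fun x hx => ?_
    refine Prod.ext ?_ (funext fun j => ?_)
    · simpa [h0] using hx.1
    · have := hx.2 j (Set.mem_univ j)
      simpa [h1 j] using this

lemma isStrictMorphism_observablesProj : IsStrictMorphism (observables ω hω)
    (ofLieAlgebra (hamVectorFields ω hω)) (observablesProj ω hω) := by
  refine ⟨fun i x hx => ?_, fun k hk x => ?_⟩
  · by_cases hi : i = 0
    · simp [ofLieAlgebra, hi]
    · rw [(isGrounded_observables hω).proj_of_mem i hi x hx]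
      exact Submodule.zero_mem _
  · match k, hk with
    | 1, _ => rfl
    | 2, _ => rfl
    | k + 3, _ => rfl

end ObservablesAlgebra

/-! ### Morphism equations between grounded structures. -/

section Morphisms

variable {L : Type*} [AddCommGroup L] [Module ℝ L] {L' : Type*} [AddCommGroup L'] [Module ℝ L']
  {L'' : Type*} [AddCommGroup L''] [Module ℝ L'']

lemma strictMaps_of_ne_one (φ : L →ₗ[ℝ] L') {k : ℕ} (hk : k ≠ 1) (x : Fin k → L) :
    strictMaps φ k x = 0 := by
  match k, hk with
  | 0, _ => rfl
  | k + 2, _ => rfl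

lemma strictMaps_of_eq_one (φ : L →ₗ[ℝ] L') {k : ℕ} (hk : k = 1) (x : Fin k → L) :
    strictMaps φ k x = φ (x ⟨0, hk ▸ one_pos⟩) := by
  subst hk; rfl

/-- A strict outer map sees only the composition with one block, so the composites agree as soon as
the images of all components do. -/
lemma compStructure_strictMaps_congr {X L₁ : Type*} [AddCommGroup L₁] [Module ℝ L₁]
    (φ : L' →ₗ[ℝ] L'') (f : (k : ℕ) → (Fin k → X) → L') (ψ : L₁ →ₗ[ℝ] L'')
    (g : (k : ℕ) → (Fin k → X) → L₁) (h : ∀ k, 1 ≤ k → ∀ x, φ (f k x) = ψ (g k x)) {m : ℕ}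
    (d : Fin m → ℤ) (x : Fin m → X) :
    compStructure (strictMaps φ) f d x = compStructure (strictMaps ψ) g d x := by
  refine Finset.sum_congr rfl fun c _ => ?_
  congr 1
  refine Finset.sum_congr rfl fun σ _ => ?_
  congr 1
  by_cases hc : c.length = 1
  · rw [strictMaps_of_eq_one φ hc, strictMaps_of_eq_one ψ hc]
    exact h _ (c.one_le_blocksFun _) _
  · rw [strictMaps_of_ne_one φ hc, strictMaps_of_ne_one ψ hc]

lemma single_embedding_val {m : ℕ} (hm : 0 < m) (b : Fin (Composition.single m hm).length)
    (a : Fin ((Composition.single m hm).blocksFun b)) :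
    ((Composition.single m hm).embedding b a : ℕ) = a := by
  have hb : (b : ℕ) = 0 := Nat.lt_one_iff.1 b.isLt
  rw [Composition.coe_embedding, hb, Composition.sizeUpTo_zero, zero_add]

lemma blockUnshuffles_single {m : ℕ} (hm : 0 < m) :
    blockUnshuffles (Composition.single m hm) = {1} := by
  ext σ
  simp only [blockUnshuffles, Finset.mem_filter, Finset.mem_univ, true_and, Finset.mem_singleton]
  have hb : (Composition.single m hm).blocksFun ⟨0, one_pos⟩ = m :=
    Composition.single_blocksFun hm _
  have he : ∀ a : Fin m,
      (Composition.single m hm).embedding ⟨0, one_pos⟩ (Fin.cast hb.symm a) = a :=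
    fun a => Fin.ext (single_embedding_val hm _ _)
  constructor
  · intro h
    refine strictMono_perm_eq_one fun a b hab => ?_
    have := h ⟨0, one_pos⟩ (Fin.cast hb.symm a) (Fin.cast hb.symm b) (Fin.lt_def.1 hab)
    rwa [he, he] at this
  · rintro rfl b a a' haa
    exact (Composition.embedding _ b).strictMono haa

lemma blockUnshuffles_ones (m : ℕ) : blockUnshuffles (Composition.ones m) = Finset.univ := by
  ext σ
  simp only [blockUnshuffles, Finset.mem_filter, Finset.mem_univ, true_and, iff_true]
  intro b a a' haa
  have h1 := a.isLt
  have h2 := a'.isLt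
  have h3 := Composition.ones_blocksFun m b
  have := Fin.lt_def.1 haa
  omega

variable {𝔤 : Type*} [LieRing 𝔤] [LieAlgebra ℝ 𝔤] {𝔥 : Type*} [LieRing 𝔥] [LieAlgebra ℝ 𝔥]
  {𝓛 : MultiBrackets L} {q : L →ₗ[ℝ] 𝔤} {D : L →ₗ[ℝ] L} {φ : (k : ℕ) → 𝔤 [⋀^Fin k]→ₗ[ℝ] L}
  {𝓛' : MultiBrackets L'} {q' : L' →ₗ[ℝ] 𝔥} {D' : L' →ₗ[ℝ] L'}
  {φ' : (k : ℕ) → 𝔥 [⋀^Fin k]→ₗ[ℝ] L'}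
  {f : (k : ℕ) → (Fin k → L) → L'} {T : L →ₗ[ℝ] L'} {F : (k : ℕ) → 𝔤 [⋀^Fin k]→ₗ[ℝ] L'}

/-- Maps between grounded structures which, up to homotopy components without image in `𝔥`, cover a
Lie algebra morphism `v`. -/
structure Covers (q : L →ₗ[ℝ] 𝔤) (q' : L' →ₗ[ℝ] 𝔥) (T : L →ₗ[ℝ] L')
    (F : (k : ℕ) → 𝔤 [⋀^Fin k]→ₗ[ℝ] L') (v : 𝔤 →ₗ⁅ℝ⁆ 𝔥) : Prop where
  proj_one : ∀ x, q' (T x) = v (q x)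
  proj_higher : ∀ k, 2 ≤ k → ∀ y, q' (F k y) = 0

variable {v : 𝔤 →ₗ⁅ℝ⁆ 𝔥}

namespace Covers

lemma proj_apply (hv : Covers q q' T F v) (hf : IsGroundedFamily q f T F) (k : ℕ) (hk : 1 ≤ k)
    (x : Fin k → L) : q' (f k x) = v (strictMaps q k x) := by
  rcases hk.eq_or_lt with rfl | hk
  · rw [hf.one, hv.proj_one]; rfl
  · rw [hf.higher k hk, hv.proj_higher k hk, strictMaps_of_ne_one q (by omega), map_zero]

/-- Such a composition has a block of size at least 2, on which the component of the family is
killed by `q'`. -/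
lemma br_comp_eq_zero_of_ne (h' : IsGrounded 𝓛' q' D' φ') (hv : Covers q q' T F v)
    (hf : IsGroundedFamily q f T F) {m : ℕ} (c : Composition m) (h1 : 2 ≤ c.length)
    (h2 : c ≠ Composition.ones m) (y : (b : Fin c.length) → Fin (c.blocksFun b) → L) :
    𝓛'.br c.length (fun b => f (c.blocksFun b) (y b)) = 0 := by
  rw [h'.family.higher _ h1]
  obtain ⟨i, hi, hlt⟩ := Composition.ne_ones_iff.1 h2
  obtain ⟨b, rfl⟩ : ∃ b, c.blocksFun b = i := by
    rw [← c.ofFn_blocksFun, List.mem_ofFn'] at hi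
    exact hi
  refine (φ' _).map_coord_zero b ?_
  rw [hv.proj_apply hf _ (by omega), strictMaps_of_ne_one q (by omega), map_zero]

lemma block_index (f : (k : ℕ) → (Fin k → L) → L') {m : ℕ} (c : Composition m)
    (x : Fin m → L) (a : Fin m) (hb : c.blocksFun (c.index a) = 1)
    (hf : IsGroundedFamily q f T F) :
    f (c.blocksFun (c.index a)) (fun l => x (c.embedding (c.index a) l)) = T (x a) := by
  rw [hf.apply_of_eq_one hb]
  have h0 : (⟨0, hb ▸ one_pos⟩ : Fin (c.blocksFun (c.index a))) = c.invEmbedding a := by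
    ext
    have := (c.invEmbedding a).isLt
    simp only
    omega
  rw [h0, c.embedding_comp_inv]

/-- With one block the component F_m receives an argument zero; with all blocks of size one the
bracket does. In every other case `br_comp_eq_zero_of_ne` applies. -/
lemma br_comp_eq_zero (h' : IsGrounded 𝓛' q' D' φ') (hv : Covers q q' T F v)
    (hf : IsGroundedFamily q f T F) {m : ℕ} (hm : 2 ≤ m) (c : Composition m) (x : Fin m → L)
    (a : Fin m) (ha : q (x a) = 0) :
    𝓛'.br c.length (fun b => f (c.blocksFun b) (fun l => x (c.embedding b l))) = 0 := by
  have hpos : 0 < c.length := c.length_pos_iff.2 (by omega)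
  by_cases h1 : c.length = 1
  · rw [h'.family.apply_of_eq_one h1]
    have hb : (⟨0, h1 ▸ one_pos⟩ : Fin c.length) = c.index a := by
      ext
      have := (c.index a).isLt
      simp only
      omega
    have hc : c = Composition.single m (by omega) :=
      (Composition.eq_single_iff_length (by omega)).2 h1
    have hsize : ∀ b, c.blocksFun b = m := by
      rw [hc]
      exact Composition.single_blocksFun _
    rw [hb, hf.higher _ (by rw [hsize]; exact hm)]
    have h0 : F (c.blocksFun (c.index a)) (fun l => q (x (c.embedding (c.index a) l))) = 0 := by
      refine (F _).map_coord_zero (c.invEmbedding a) ?_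
      rw [c.embedding_comp_inv, ha]
    rw [h0, map_zero]
  · by_cases hc : c = Composition.ones m
    · rw [h'.family.higher _ (by omega)]
      refine (φ' _).map_coord_zero (c.index a) ?_
      have hb : c.blocksFun (c.index a) = 1 := by
        subst hc
        exact Composition.ones_blocksFun _ _
      rw [block_index f c x a hb hf, hv.proj_one, ha, map_zero]
    · exact br_comp_eq_zero_of_ne h' hv hf c (by omega) hc _

lemma br_single (h' : IsGrounded 𝓛' q' D' φ') (hf : IsGroundedFamily q f T F) {m : ℕ}
    (hm : 2 ≤ m) (x : Fin m → L) :
    𝓛'.br (Composition.single m (by omega)).length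
      (fun b => f ((Composition.single m (by omega)).blocksFun b)
        (fun l => x ((Composition.single m (by omega)).embedding b l))) =
      D' (F m fun a => q (x a)) := by
  rw [h'.family.apply_of_eq_one (Composition.single_length _), ← hf.higher m hm]
  congr 1
  have key : ∀ (l : ℕ) (hl : l = m) (y : Fin l → L), (∀ a, y a = x (Fin.cast hl a)) →
      f l y = f m x := by
    rintro l rfl y hy
    congr 1
    exact funext hy
  refine key _ (Composition.single_blocksFun _ _) _ fun a => ?_
  congr 1
  exact Fin.ext (single_embedding_val _ _ _)

lemma br_ones (h' : IsGrounded 𝓛' q' D' φ') (hv : Covers q q' T F v)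
    (hf : IsGroundedFamily q f T F) {m : ℕ} (hm : 2 ≤ m) (x : Fin m → L) :
    𝓛'.br (Composition.ones m).length
      (fun b => f ((Composition.ones m).blocksFun b)
        (fun l => x ((Composition.ones m).embedding b l))) =
      φ' m fun a => v (q (x a)) := by
  have key : ∀ (l : ℕ) (hl : l = m) (y : Fin l → 𝔥), (∀ a, y a = v (q (x (Fin.cast hl a)))) →
      φ' l y = φ' m fun a => v (q (x a)) := by
    rintro l rfl y hy
    congr 1
    exact funext hy
  rw [h'.family.higher _ (by rw [Composition.ones_length]; exact hm)]
  refine key _ (Composition.ones_length m) _ fun a => ?_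
  rw [hv.proj_apply hf _ (by rw [Composition.ones_blocksFun]),
    strictMaps_of_eq_one q (Composition.ones_blocksFun m a), Composition.ones_embedding]
  rfl

lemma compStructure_eq_zero (h' : IsGrounded 𝓛' q' D' φ') (hv : Covers q q' T F v)
    (hf : IsGroundedFamily q f T F) {m : ℕ} (hm : 2 ≤ m) (d : Fin m → ℤ) (x : Fin m → L)
    (a : Fin m) (ha : q (x a) = 0) : compStructure 𝓛'.br f d x = 0 := by
  refine Finset.sum_eq_zero fun c _ => ?_
  rw [Finset.sum_eq_zero, smul_zero]
  intro σ _
  have := br_comp_eq_zero h' hv hf hm c (x ∘ σ) (σ.symm a) (by simpa using ha)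
  simp only [Function.comp_apply] at this
  rw [this, smul_zero]

/-- Two compositions survive. The single block gives the differential of `F`. The blocks of size one
give m! equal terms, because the Koszul sign cancels the sign of alternation, and the factor 1/m!
removes the multiplicity. -/
lemma compStructure_degree_zero (h' : IsGrounded 𝓛' q' D' φ') (hv : Covers q q' T F v)
    (hf : IsGroundedFamily q f T F) {m : ℕ} (hm : 2 ≤ m) (x : Fin m → L) :
    compStructure 𝓛'.br f (fun _ => 0) x =
      D' (F m fun a => q (x a)) + φ' m fun a => v (q (x a)) := by
  have hne : Composition.single m (by omega) ≠ Composition.ones m := by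
    intro h
    have := congrArg Composition.length h
    rw [Composition.single_length, Composition.ones_length] at this
    omega
  rw [compStructure, Fintype.sum_eq_add _ _ hne]
  · congr 1
    · have hl : ((Composition.single m (by omega)).length.factorial : ℝ)⁻¹ = 1 := by
        rw [Composition.single_length, Nat.factorial_one, Nat.cast_one, inv_one]
      rw [blockUnshuffles_single, Finset.sum_singleton, hl, one_smul,
        decSign_of_length_one (Composition.single_length _)]
      simp only [decSign_zero, Finset.prod_const_one, koszulSign_neg_one, map_one, mul_one,
        one_smul]
      exact br_single h' hf hm x
    · rw [blockUnshuffles_ones]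
      have hterm : ∀ σ : Equiv.Perm (Fin m),
          𝓛'.br (Composition.ones m).length
            (fun b => f ((Composition.ones m).blocksFun b)
              (fun l => x (σ ((Composition.ones m).embedding b l)))) =
          Equiv.Perm.sign σ • φ' m fun a => v (q (x a)) := by
        intro σ
        refine (br_ones h' hv hf hm (x ∘ σ)).trans ?_
        exact (φ' m).map_perm (fun a => v (q (x a))) σ
      simp only [hterm, Composition.ones_blocksFun, Nat.cast_one, sub_self, Finset.sum_const_zero,
        add_zero, decSign_zero, Finset.prod_const_one, koszulSign_neg_one, mul_one, smul_smul,
        Int.units_mul_self, one_smul, Composition.ones_length, Finset.sum_const,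
        Finset.card_univ, Fintype.card_perm, Fintype.card_fin]
      rw [← Nat.cast_smul_eq_nsmul ℝ, smul_smul,
        inv_mul_cancel₀ (Nat.cast_ne_zero.2 (Nat.factorial_ne_zero m)), one_smul]
  · rintro c ⟨h1, h2⟩
    have hpos : 0 < c.length := c.length_pos_iff.2 (by omega)
    have hl : c.length ≠ 1 := fun h => h1 ((Composition.eq_single_iff_length (by omega)).2 h)
    rw [Finset.sum_eq_zero, smul_zero]
    intro σ _
    rw [br_comp_eq_zero_of_ne h' hv hf c (by omega) h2, smul_zero]

/-- Criterion for a family covering a Lie algebra morphism to be an `L∞`-morphism from a grounded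
structure with `l₁ = 0`. -/
theorem isLInfinityMorphism (h : IsGrounded 𝓛 q 0 φ) (h' : IsGrounded 𝓛' q' D' φ')
    (hv : Covers q q' T F v) (hf : IsGroundedFamily q f T F)
    (hT : ∀ d, ∀ x ∈ 𝓛.gr d, T x ∈ 𝓛'.gr d)
    (hF : ∀ k : ℕ, 2 ≤ k → ∀ y, F k y ∈ 𝓛'.gr (1 - k))
    (hDT : ∀ x, D' (T x) = 0)
    (htwo : ∀ y, T (φ 2 y) = D' (F 2 y) + φ' 2 fun a => v (y a))
    (hmain : ∀ k y, ceD (F (k + 2)) y + T (φ (k + 3) y) =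
      D' (F (k + 3) y) + φ' (k + 3) fun a => v (y a)) : IsLInfinityMorphism 𝓛 𝓛' f where
  multilinear := hf.isMultilin
  degree := hf.hasDegree h.proj_of_mem 1 (by simpa using hT) hF
  skew := hf.isGradedSkew h.proj_of_mem
  compat := by
    intro m hm d x hx
    match m, hm with
    | 1, _ =>
      -- The source has l₁ = 0, so in arity one the equation only asks that `D'` annihilate the
      -- image of `T`.
      have hl : morphismLHS 𝓛 f d x = 0 := by
        rw [morphismLHS, Fintype.sum_unique]
        refine Finset.sum_eq_zero fun σ _ => ?_
        have h1 : f (1 - ((default : Fin 1) + 1) + 1)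
            (Fin.cons (𝓛.br ((default : Fin 1) + 1) (headArgs (default : Fin 1).isLt (x ∘ σ)))
              (tailArgs (default : Fin 1).isLt (x ∘ σ))) = 0 := by
          refine (hf.one _).trans ?_
          exact (congrArg T (h.family.one _)).trans (map_zero T)
        rw [h1, smul_zero]
      rw [hl]
      refine (Finset.sum_eq_zero fun c _ => ?_).symm
      have hpos : 0 < c.length := c.length_pos_iff.2 one_pos
      have hc1 : c.length = 1 := le_antisymm c.length_le hpos
      rw [Finset.sum_eq_zero, smul_zero]
      intro σ _
      have hb : ∀ b, c.blocksFun b = 1 := fun b =>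
        le_antisymm (c.blocksFun_le b) (c.one_le_blocksFun b)
      rw [h'.family.apply_of_eq_one hc1, hf.apply_of_eq_one (hb _), hDT, smul_zero]
    | m + 2, _ =>
      by_cases hd : ∀ a, d a = 0
      · obtain rfl : d = fun _ => 0 := funext hd
        rw [compStructure_degree_zero h' hv hf (by omega)]
        cases m with
        | zero =>
          refine (h.sum_insertion_two hf _ ?_ x).trans (htwo _)
          rw [koszulSign_neg_one, map_one, one_mul]
          exact (congrArg₂ (· * ·) decSign_zero (decSign_of_length_one (by simp) _)).trans
            (one_mul 1)
        | succ k =>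
          refine (h.sum_insertion hf _ ?_ ?_ x).trans (hmain _ _)
          · intro σ
            -- The bracket l₂ of elements of degree 0 again has degree 0, so the outer desuspension
            -- sign is trivial and only the sign of σ remains.
            have hcons : (Fin.cons (∑ a, headArgs (Fin.isLt (⟨1, by omega⟩ : Fin (k + 3)))
                ((fun _ => (0 : ℤ)) ∘ σ) a + (2 - (((⟨1, by omega⟩ : Fin (k + 3)) : ℕ) + 1 : ℤ)))
                (tailArgs (Fin.isLt (⟨1, by omega⟩ : Fin (k + 3))) ((fun _ => (0 : ℤ)) ∘ σ)) :
                Fin (k + 3 - (1 + 1) + 1) → ℤ) = fun _ => 0 := by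
              ext1 b
              induction b using Fin.cases with
              | zero => simp [headArgs]
              | succ b => rfl
            rw [koszulSign_neg_one]
            refine (congrArg₂ (· * ·) (congrArg (_ * ·) decSign_zero)
              ((congrArg decSign hcons).trans decSign_zero)).trans ?_
            rw [mul_one, mul_one]
          · rw [koszulSign_neg_one, map_one, one_mul]
            exact (congrArg₂ (· * ·) decSign_zero (decSign_of_length_one (by simp) _)).trans
              (one_mul 1)
      · push Not at hd
        obtain ⟨a, ha⟩ := hd
        have hxa := h.proj_of_mem _ ha _ (hx a)
        rw [compStructure_eq_zero h' hv hf (by omega) d x a hxa]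
        refine Finset.sum_eq_zero fun i _ => Finset.sum_eq_zero fun σ _ => ?_
        rw [h.insertion_eq_zero hf (by omega) i σ x a hxa, smul_zero]

end Covers

end Morphisms

/-! ### Recursive construction of the form-valued cochains. -/

section HomotopyMoment

/-- Over a field the restriction of `d` to `N` has a linear section over its range. Composing it
with `R` picks primitives multilinearly and alternatingly, which pointwise choice would not. -/
lemma exists_alternating_primitive {𝔤 V W : Type*} [AddCommGroup 𝔤] [Module ℝ 𝔤] [AddCommGroup V]
    [Module ℝ V] [AddCommGroup W] [Module ℝ W] (d : V →ₗ[ℝ] W) (N : Submodule ℝ V) {k : ℕ}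
    (R : 𝔤 [⋀^Fin k]→ₗ[ℝ] W) (h : ∀ y, ∃ γ ∈ N, d γ = R y) :
    ∃ F : 𝔤 [⋀^Fin k]→ₗ[ℝ] V, (∀ y, F y ∈ N) ∧ ∀ y, d (F y) = R y := by
  let dN : N →ₗ[ℝ] W := d ∘ₗ N.subtype
  obtain ⟨s, hs⟩ := dN.rangeRestrict.exists_rightInverse_of_surjective dN.range_rangeRestrict
  have hR : ∀ y, R y ∈ LinearMap.range dN := fun y => by
    obtain ⟨γ, hγ, h⟩ := h y
    exact ⟨⟨γ, hγ⟩, h⟩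
  refine ⟨(N.subtype ∘ₗ s).compAlternatingMap (R.codRestrict _ hR), fun y => (s _).2, fun y => ?_⟩
  exact congrArg Subtype.val (LinearMap.congr_fun hs (R.codRestrict _ hR y))

lemma ceD_apply_mem {𝔤 V : Type*} [LieRing 𝔤] [LieAlgebra ℝ 𝔤] [AddCommGroup V] [Module ℝ V]
    {V' : Type*} [AddCommGroup V'] [Module ℝ V'] (φ : V →ₗ[ℝ] V') {k : ℕ}
    (F : 𝔤 [⋀^Fin k]→ₗ[ℝ] V) (h : ∀ y, φ (F y) = 0) (y : Fin (k + 1) → 𝔤) :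
    φ (ceD F y) = 0 := by
  have h0 : φ.compAlternatingMap F = 0 := AlternatingMap.ext h
  have h1 := ceD_comp φ F
  rw [h0, ceD_zero] at h1
  exact (DFunLike.congr_fun h1 y).symm

lemma ceD_fin_one {𝔤 V : Type*} [LieRing 𝔤] [LieAlgebra ℝ 𝔤] [AddCommGroup V] [Module ℝ V]
    (F : 𝔤 [⋀^Fin 1]→ₗ[ℝ] V) (y : Fin 2 → 𝔤) : ceD F y = F fun _ => ⁅y 0, y 1⁆ := by
  have h : ((AlternatingMap.ofSubsingleton ℝ 𝔤 V (0 : Fin 1)).symm F).compAlternatingMap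
      (AlternatingMap.ofSubsingleton ℝ 𝔤 𝔤 (0 : Fin 1) LinearMap.id) = F := by
    ext x
    change F (fun _ => x 0) = F x
    congr 1
    ext1 i
    rw [Subsingleton.elim i 0]
  have h1 := ceD_comp ((AlternatingMap.ofSubsingleton ℝ 𝔤 V (0 : Fin 1)).symm F)
    (AlternatingMap.ofSubsingleton ℝ 𝔤 𝔤 (0 : Fin 1) LinearMap.id)
  rw [h] at h1
  rw [h1, LinearMap.compAlternatingMap_apply]
  have h2 := lieAlt_two y
  rw [lieAlt] at h2
  rw [h2]
  rfl

variable {A : Type*} [CommRing A] [Algebra ℝ A]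

lemma iotaTot_zero_apply {k : ℕ} (v : Fin k → VF A) (β : TotalForm A) (Y : Fin 0 → VF A) :
    iotaTot k v β 0 Y = β k v := by
  induction k generalizing β with
  | zero =>
    rw [Subsingleton.elim v Y]; rfl
  | succ k ih =>
    rw [iotaTot_succ, ih, iTot_apply, iota_apply, Fin.cons_self_tail]

variable (A) in
/-- Constants as families of forms. -/
def constTot : ℝ →ₗ[ℝ] TotalForm A where
  toFun r := Pi.single 0 (AlternatingMap.constOfIsEmpty A (VF A) (Fin 0) (algebraMap ℝ A r))
  map_add' r s := by
    rw [← Pi.single_add, map_add]; rfl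
  map_smul' r s := by
    rw [← Pi.single_smul]
    congr 1
    ext
    simp [Algebra.smul_def]

lemma constTot_zero_apply (r : ℝ) (Y : Fin 0 → VF A) : constTot A r 0 Y = algebraMap ℝ A r := by
  change (Pi.single 0 _ : TotalForm A) 0 Y = _
  rw [Pi.single_eq_same]; rfl

lemma constTot_apply_of_ne (r : ℝ) {j : ℕ} (hj : j ≠ 0) : constTot A r j = 0 :=
  Pi.single_eq_of_ne hj _

lemma dTot_constTot (r : ℝ) : dTot (constTot A r) = 0 := by
  change dTot (Pi.single 0 _) = 0
  rw [dTot_single]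
  have h : extD 0 (AlternatingMap.constOfIsEmpty A (VF A) (Fin 0) (algebraMap ℝ A r)) = 0 := by
    refine form_ext fun X => ?_
    rw [iota_extD_zero]
    ext Y
    simp [lieDeriv_apply, iota_apply]
  rw [h, Pi.single_zero]

/-- Evaluation of the component of degree zero with a functional on functions. -/
def evTot (ev : A →ₗ[ℝ] ℝ) : TotalForm A →ₗ[ℝ] ℝ where
  toFun β := ev (β 0 fun i => i.elim0)
  map_add' _ _ := map_add ev _ _
  map_smul' r β := map_smul ev r (β 0 fun i => i.elim0)

/-- Families of forms concentrated in degree `m + 1 - k` and, if that degree is zero, annihilated by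
`ev`. -/
def normalizedForms (m : ℕ) (ev : A →ₗ[ℝ] ℝ) (k : ℕ) : Submodule ℝ (TotalForm A) where
  carrier := {β | (∀ j, j + k ≠ m + 1 → β j = 0) ∧ evTot ev β = 0}
  add_mem' := by
    rintro β γ ⟨h1, h2⟩ ⟨h3, h4⟩
    exact ⟨fun j hj => by rw [Pi.add_apply, h1 j hj, h3 j hj, add_zero],
      by rw [map_add, h2, h4, add_zero]⟩
  zero_mem' := ⟨fun _ _ => rfl, map_zero _⟩
  smul_mem' := by
    rintro r β ⟨h1, h2⟩
    exact ⟨fun j hj => by rw [Pi.smul_apply, h1 j hj, smul_zero],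
      by rw [map_smul, h2, smul_zero]⟩

variable {m : ℕ} {ev : A →ₗ[ℝ] ℝ}

/-- Subtracting the constant with the same value under `ev` does not change the differential;
outside form degree zero that constant is 0. -/
lemma exists_normalized (hev : ∀ r, ev (algebraMap ℝ A r) = r) {k : ℕ} {β γ : TotalForm A}
    (hγ : ∀ j, j + k ≠ m + 1 → γ j = 0) (h : dTot γ = β) :
    ∃ γ ∈ normalizedForms m ev k, dTot γ = β := by
  refine ⟨γ - constTot A (evTot ev γ), ⟨fun j hj => ?_, ?_⟩, ?_⟩
  · rw [Pi.sub_apply, hγ j hj]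
    by_cases h0 : j = 0
    · subst h0
      have : evTot ev γ = 0 := by
        change ev (γ 0 _) = 0
        rw [hγ 0 hj]; exact map_zero ev
      rw [this, map_zero]; exact sub_zero _
    · rw [constTot_apply_of_ne _ h0, sub_zero]
  · have : evTot ev (constTot A (evTot ev γ)) = evTot ev γ := by
      change ev (constTot A _ 0 _) = _
      rw [constTot_zero_apply, hev]
    rw [map_sub, this, sub_self]
  · rw [map_sub, dTot_constTot, sub_zero, h]

variable {ω : Form A (m + 2)} {𝔤 : Type*} [LieRing 𝔤] [LieAlgebra ℝ 𝔤]

/-- The cochains `ς(k) ι(u_{x₁} ∧ ⋯ ∧ u_{x_k}) ω`. -/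
def actionContraction (ω : Form A (m + 2)) (u : 𝔤 →ₗ⁅ℝ⁆ VF A) (k : ℕ) :
    𝔤 [⋀^Fin k]→ₗ[ℝ] TotalForm A :=
  varsig k • contraction u (Pi.single (m + 2) ω) k

lemma actionContraction_eq_zero (u : 𝔤 →ₗ⁅ℝ⁆ VF A) {k j : ℕ} (h : j + k ≠ m + 2)
    (y : Fin k → 𝔤) : actionContraction ω u k y j = 0 := by
  change varsig k • iotaTot k (u ∘ y) (Pi.single (m + 2) ω) j = 0
  rw [iotaTot_single _ _ _ h, smul_zero]

lemma evTot_actionContraction (u : 𝔤 →ₗ⁅ℝ⁆ VF A) (y : Fin (m + 2) → 𝔤) :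
    evTot ev (actionContraction ω u (m + 2) y) = varsig (m + 2) * ev (ω fun a => u (y a)) := by
  change ev (varsig (m + 2) • iotaTot (m + 2) (u ∘ y) (Pi.single (m + 2) ω) 0 _) = _
  rw [map_smul, iotaTot_zero_apply, Pi.single_eq_same]
  rfl

variable (hω : extD (m + 2) ω = 0) (v : 𝔤 →ₗ⁅ℝ⁆ hamVectorFields ω hω)

/-- The vector fields of an action by Hamiltonian vector fields. -/
def actionField : 𝔤 →ₗ⁅ℝ⁆ VF A := (hamVectorFields ω hω).incl.comp v

lemma dTot_actionContraction (k : ℕ) (y : Fin (k + 1) → 𝔤) :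
    dTot (actionContraction ω (actionField hω v) (k + 1) y) =
      -ceD (actionContraction ω (actionField hω v) k) y :=
  dTot_varsig_contraction _ _ (dTot_single_eq_zero hω) (fun x => lTot_single_eq_zero hω (v x)) k y

lemma actionContraction_one (y : Fin 1 → 𝔤) :
    actionContraction ω (actionField hω v) 1 y =
      Pi.single (m + 1) (iota (v (y 0) : VF A) ω) := by
  change varsig 1 • iotaTot 1 _ (Pi.single (m + 2) ω) = _
  rw [varsig_one, one_smul]
  exact iTot_single _ _ _

variable {hω v}

/-- The normalized value of the cocycle of an action is closed for the Chevalley–Eilenberg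
differential. -/
lemma ceD_cocycle {c : 𝔤 [⋀^Fin (m + 2)]→ₗ[ℝ] ℝ}
    (hc : ∀ y, c y = (-1) ^ (m + 1) *
      evTot ev (actionContraction ω (actionField hω v) (m + 2) y)) : ceD c = 0 := by
  have h : c = ((-1 : ℝ) ^ (m + 1) • evTot ev).compAlternatingMap
      (actionContraction ω (actionField hω v) (m + 2)) := AlternatingMap.ext hc
  rw [h, ceD_comp]
  ext y
  have h1 := dTot_actionContraction hω v (m + 2) y
  -- Contracting an (m + 2)-form with m + 3 fields gives zero, and its differential is -δ of the
  -- preceding contraction.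
  have h2 : actionContraction ω (actionField hω v) (m + 2 + 1) y = 0 :=
    funext fun j => actionContraction_eq_zero _ (by omega) y
  rw [h2, map_zero] at h1
  rw [LinearMap.compAlternatingMap_apply, neg_eq_zero.1 h1.symm, map_zero]
  rfl

/-- The invariant of the recursive construction of the components of an `L∞`-morphism. -/
def IsPartialMoment (hω : extD (m + 2) ω = 0) (v : 𝔤 →ₗ⁅ℝ⁆ hamVectorFields ω hω) (ev : A →ₗ[ℝ] ℝ)
    {k : ℕ} (F : 𝔤 [⋀^Fin k]→ₗ[ℝ] TotalForm A) : Prop :=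
  (∀ y, F y ∈ normalizedForms m ev k) ∧
    ∀ y, dTot (ceD F y) = dTot (actionContraction ω (actionField hω v) (k + 1) y)

/-- The relation between consecutive components of the `L∞`-morphism. -/
def MomentRelation (hω : extD (m + 2) ω = 0) (v : 𝔤 →ₗ⁅ℝ⁆ hamVectorFields ω hω)
    (c : 𝔤 [⋀^Fin (m + 2)]→ₗ[ℝ] ℝ) {k : ℕ} (F : 𝔤 [⋀^Fin k]→ₗ[ℝ] TotalForm A)
    (F' : 𝔤 [⋀^Fin (k + 1)]→ₗ[ℝ] TotalForm A) : Prop :=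
  ∀ y, ceD F y + (-1 : ℝ) ^ (m + 1) • constTot A (extensionAlt (m + 1) c (k + 1) y).2 =
    dTot (F' y) + actionContraction ω (actionField hω v) (k + 1) y

lemma extensionAlt_snd_of_ne {n : ℕ} (c : 𝔤 [⋀^Fin (n + 1)]→ₗ[ℝ] ℝ) {k : ℕ} (hk : k ≠ n + 1)
    (y : Fin k → 𝔤) : (extensionAlt n c k y).2 = 0 := by
  simp [extensionAlt, hk]

lemma extensionAlt_snd {n : ℕ} (c : 𝔤 [⋀^Fin (n + 1)]→ₗ[ℝ] ℝ) (y : Fin (n + 1) → 𝔤) :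
    (extensionAlt n c (n + 1) y).2 = c y := by
  simp [extensionAlt]

/-- Apply δ to the relation: δδF and the constant term drop out, since c is a cocycle, and what is
left is d δF' = -δ C_{k+1} = d C_{k+2}. -/
lemma IsPartialMoment.next {c : 𝔤 [⋀^Fin (m + 2)]→ₗ[ℝ] ℝ} (hc : ceD c = 0) {k : ℕ}
    {F : 𝔤 [⋀^Fin k]→ₗ[ℝ] TotalForm A} {F' : 𝔤 [⋀^Fin (k + 1)]→ₗ[ℝ] TotalForm A}
    (hF' : ∀ y, F' y ∈ normalizedForms m ev (k + 1)) (h : MomentRelation hω v c F F') :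
    IsPartialMoment hω v ev F' := by
  refine ⟨hF', fun y => ?_⟩
  have h1 : dTot.compAlternatingMap F' = ceD F -
      actionContraction ω (actionField hω v) (k + 1) -
      (-1 : ℝ) • ((-1 : ℝ) ^ (m + 1) • constTot A ∘ₗ LinearMap.snd ℝ 𝔤 ℝ).compAlternatingMap
        (extensionAlt (m + 1) c (k + 1)) := by
    refine AlternatingMap.ext fun y => ?_
    have := h y
    change dTot (F' y) = ceD F y - actionContraction ω (actionField hω v) (k + 1) y -
      (-1 : ℝ) • ((-1 : ℝ) ^ (m + 1) • constTot A (extensionAlt (m + 1) c (k + 1) y).2)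
    generalize (-1 : ℝ) ^ (m + 1) • constTot A (extensionAlt (m + 1) c (k + 1) y).2 = Z at this ⊢
    rw [eq_sub_of_add_eq this.symm, (neg_one_smul ℝ Z : (-1 : ℝ) • Z = -Z)]
    abel
  have h2 := DFunLike.congr_fun (ceD_comp dTot F') y
  rw [h1, ceD_sub, ceD_sub, ceD_ceD, ceD_smul, ceD_comp, ceD_extensionAlt hc] at h2
  rw [dTot_actionContraction]
  refine h2.symm.trans ?_
  change 0 - ceD (actionContraction ω (actionField hω v) (k + 1)) y - (-1 : ℝ) • _ = _
  have h3 : ((-1 : ℝ) ^ (m + 1) • constTot A ∘ₗ LinearMap.snd ℝ 𝔤 ℝ).compAlternatingMap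
      (0 : 𝔤 [⋀^Fin (k + 1 + 1)]→ₗ[ℝ] (𝔤 × ℝ)) y = 0 :=
    map_zero ((-1 : ℝ) ^ (m + 1) • constTot A ∘ₗ LinearMap.snd ℝ 𝔤 ℝ)
  refine (congrArg (fun Z => 0 - ceD (actionContraction ω (actionField hω v) (k + 1)) y -
    (-1 : ℝ) • Z) h3).trans ?_
  simp only [smul_zero, sub_zero, zero_sub]

/-- Existence of the next component. -/
theorem exists_moment_step (hev : ∀ r, ev (algebraMap ℝ A r) = r)
    (hclosed : ∀ α : Form A 0, extD 0 α = 0 → ev (α fun i => i.elim0) = 0 → α = 0)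
    (hM : ∀ k, 1 ≤ k → k ≤ m → DeRhamVanishes A k) {c : 𝔤 [⋀^Fin (m + 2)]→ₗ[ℝ] ℝ}
    (hc : ∀ y, c y = (-1) ^ (m + 1) *
      evTot ev (actionContraction ω (actionField hω v) (m + 2) y)) {k : ℕ}
    (F : 𝔤 [⋀^Fin k]→ₗ[ℝ] TotalForm A) (hF : IsPartialMoment hω v ev F) :
    ∃ F' : 𝔤 [⋀^Fin (k + 1)]→ₗ[ℝ] TotalForm A,
      IsPartialMoment hω v ev F' ∧ MomentRelation hω v c F F' := by
  suffices h : ∃ F' : 𝔤 [⋀^Fin (k + 1)]→ₗ[ℝ] TotalForm A,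
      (∀ y, F' y ∈ normalizedForms m ev (k + 1)) ∧ MomentRelation hω v c F F' by
    obtain ⟨F', h1, h2⟩ := h
    exact ⟨F', IsPartialMoment.next (ceD_cocycle hc) h1 h2, h2⟩
  have hceD : ∀ y j, j + k ≠ m + 1 → ceD F y j = 0 := fun y j hj =>
    ceD_apply_mem (LinearMap.proj j : TotalForm A →ₗ[ℝ] Form A j) F (fun y => (hF.1 y).1 j hj) y
  have hev0 : ∀ y, evTot ev (ceD F y) = 0 := ceD_apply_mem (evTot ev) F fun y => (hF.1 y).2
  set B := actionContraction ω (actionField hω v) (k + 1) with hB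
  by_cases hk : k ≤ m
  · obtain ⟨F', h1, h2⟩ := exists_alternating_primitive dTot (normalizedForms m ev (k + 1))
      (ceD F - B) (fun y => by
        -- For k = 0 the form has degree m + 1, beyond the range of the cohomological hypothesis;
        -- the Hamiltonian potential is the primitive. For k ≥ 1 its degree m + 1 - k lies between 1
        -- and m.
        rcases Nat.eq_zero_or_pos k with rfl | hpos
        · obtain ⟨α, hα⟩ := (v (y 0)).2
          refine exists_normalized hev (γ := Pi.single m α)
            (fun j hj => Pi.single_eq_of_ne (by omega) _) ?_
          rw [dTot_single, hα, ceD_of_fin_zero, hB]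
          change _ = 0 - actionContraction ω (actionField hω v) 1 y
          rw [actionContraction_one, zero_sub, Pi.single_neg]
        · obtain ⟨l, hl⟩ : ∃ l, l + (k + 1) = m + 1 := ⟨m - k, by omega⟩
          have hR : ∀ j, j ≠ l + 1 → (ceD F - B) y j = 0 := by
            intro j hj
            change ceD F y j - B y j = 0
            rw [hceD y j (by omega), hB, actionContraction_eq_zero _ (by omega), sub_zero]
          have hdR : extD (l + 1) ((ceD F - B) y (l + 1)) = 0 := by
            have : dTot ((ceD F - B) y) = 0 := by
              change dTot (ceD F y - B y) = 0
              rw [map_sub, hF.2, sub_self]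
            exact congrFun this (l + 2)
          obtain ⟨γ, hγ⟩ := hM (l + 1) (by omega) (by omega) _ hdR
          refine exists_normalized hev (γ := Pi.single l γ)
            (fun j hj => Pi.single_eq_of_ne (by omega) _) ?_
          rw [dTot_single, hγ]
          funext j
          by_cases hj : j = l + 1
          · subst hj; rw [Pi.single_eq_same]
          · rw [Pi.single_eq_of_ne hj, hR j hj])
    refine ⟨F', h1, fun y => ?_⟩
    rw [extensionAlt_snd_of_ne c (by omega), map_zero, smul_zero, add_zero, h2]
    exact (sub_add_cancel _ _).symm
  · refine ⟨0, fun y => Submodule.zero_mem _, fun y => ?_⟩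
    rw [AlternatingMap.zero_apply, map_zero, zero_add]
    -- From here on no primitive is available below degree 0, so the next component is 0. Only k = m
    -- + 1 carries content; for larger k all terms vanish by degree.
    by_cases hk' : k = m + 1
    · subst hk'
      rw [extensionAlt_snd, hc]
      funext j
      cases j with
      | succ j =>
        rw [Pi.add_apply, Pi.smul_apply, constTot_apply_of_ne _ (by omega), smul_zero, add_zero,
          hceD y _ (by omega), actionContraction_eq_zero _ (by omega)]
      | zero =>
        set e := evTot ev (actionContraction ω (actionField hω v) (m + 2) y) with he
        have hsign : (-1 : ℝ) ^ (m + 1) • constTot A ((-1) ^ (m + 1) * e) = constTot A e := by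
          rw [← smul_eq_mul, map_smul, smul_smul, ← mul_pow]
          simp
        -- The difference is a closed 0-form. It is annihilated by `ev`: δF is, since F is
        -- normalized, and e was defined as the value of the contraction.
        rw [hsign, ← sub_eq_zero]
        refine hclosed ((ceD F y + constTot A e -
          actionContraction ω (actionField hω v) (m + 1 + 1) y) 0) ?_ ?_
        · refine (dTot_succ _ 0).symm.trans ?_
          rw [map_sub, map_add, dTot_constTot, hF.2, add_zero, sub_self]; rfl
        · change evTot ev (ceD F y + constTot A e -
            actionContraction ω (actionField hω v) (m + 1 + 1) y) = 0
          rw [map_sub, map_add, hev0, zero_add]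
          have : evTot ev (constTot A e) = e := by
            change ev (constTot A _ 0 _) = _
            rw [constTot_zero_apply, hev]
          rw [this, he, sub_self]
    · rw [extensionAlt_snd_of_ne c (by omega), map_zero, smul_zero, add_zero]
      funext j
      rw [hceD y _ (by omega), actionContraction_eq_zero _ (by omega)]

theorem exists_moment_sequence (hev : ∀ r, ev (algebraMap ℝ A r) = r)
    (hclosed : ∀ α : Form A 0, extD 0 α = 0 → ev (α fun i => i.elim0) = 0 → α = 0)
    (hM : ∀ k, 1 ≤ k → k ≤ m → DeRhamVanishes A k) {c : 𝔤 [⋀^Fin (m + 2)]→ₗ[ℝ] ℝ}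
    (hc : ∀ y, c y = (-1) ^ (m + 1) *
      evTot ev (actionContraction ω (actionField hω v) (m + 2) y)) :
    ∃ F : (k : ℕ) → 𝔤 [⋀^Fin k]→ₗ[ℝ] TotalForm A,
      (∀ k y j, j + k ≠ m + 1 → F k y j = 0) ∧ ∀ k, MomentRelation hω v c (F k) (F (k + 1)) := by
  have h0 : IsPartialMoment hω v ev (0 : 𝔤 [⋀^Fin 0]→ₗ[ℝ] TotalForm A) := by
    refine ⟨fun y => Submodule.zero_mem _, fun y => ?_⟩
    rw [dTot_actionContraction, ceD_of_fin_zero, ceD_of_fin_zero, AlternatingMap.zero_apply,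
      map_zero, neg_zero]
  choose! next hnext hrel using fun (k : ℕ) (F : 𝔤 [⋀^Fin k]→ₗ[ℝ] TotalForm A)
    (hF : IsPartialMoment hω v ev F) => exists_moment_step hev hclosed hM hc F hF
  let G : (k : ℕ) → 𝔤 [⋀^Fin k]→ₗ[ℝ] TotalForm A := fun k => Nat.rec 0 (fun k F => next k F) k
  have hG : ∀ k, IsPartialMoment hω v ev (G k) := by
    intro k
    induction k with
    | zero => exact h0
    | succ k ih => exact hnext k _ ih
  exact ⟨G, fun k y j hj => ((hG k).1 y).1 j hj, fun k => hrel k _ (hG k)⟩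

end HomotopyMoment

/-! ### From the cochains to the morphism. -/

section MomentMorphism

variable {A : Type*} [CommRing A] [Algebra ℝ A] {m : ℕ} {ω : Form A (m + 2)}

/-- The linear map into the space of observables with given components. -/
def obsLin {V : Type*} [AddCommGroup V] [Module ℝ V] (X : V →ₗ[ℝ] VF A) (β : V →ₗ[ℝ] TotalForm A)
    (h : ∀ x, extD m (β x m) = -iota (X x) ω) : V →ₗ[ℝ] (hamPairs ω × LowForms A m) :=
  ((X.prod ((LinearMap.proj m : TotalForm A →ₗ[ℝ] Form A m) ∘ₗ β)).codRestrict
    (hamPairs ω) h).prod ((LinearMap.pi fun j : Fin m => LinearMap.proj (j : ℕ)) ∘ₗ β)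

variable {𝔤 : Type*} [LieRing 𝔤] [LieAlgebra ℝ 𝔤] {hω : extD (m + 2) ω = 0}
  {v : 𝔤 →ₗ⁅ℝ⁆ hamVectorFields ω hω} {c : 𝔤 [⋀^Fin (m + 2)]→ₗ[ℝ] ℝ}

/-- The linear component of the morphism, before restriction to observables. -/
def momentLinear (F : 𝔤 [⋀^Fin 1]→ₗ[ℝ] TotalForm A) : (𝔤 × ℝ) →ₗ[ℝ] TotalForm A :=
  (AlternatingMap.ofSubsingleton ℝ 𝔤 (TotalForm A) (0 : Fin 1)).symm F ∘ₗ LinearMap.fst ℝ 𝔤 ℝ +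
    ((-1 : ℝ) ^ (m + 1) • constTot A) ∘ₗ LinearMap.snd ℝ 𝔤 ℝ

lemma momentLinear_apply (F : 𝔤 [⋀^Fin 1]→ₗ[ℝ] TotalForm A) (x : 𝔤 × ℝ) :
    momentLinear (m := m) F x = F (fun _ => x.1) + (-1 : ℝ) ^ (m + 1) • constTot A x.2 := rfl

lemma dTot_momentLinear {F₀ : 𝔤 [⋀^Fin 0]→ₗ[ℝ] TotalForm A} {F : 𝔤 [⋀^Fin 1]→ₗ[ℝ] TotalForm A}
    (h : MomentRelation hω v c F₀ F) (x : 𝔤 × ℝ) :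
    dTot (momentLinear (m := m) F x) = -Pi.single (m + 1) (iota (v x.1 : VF A) ω) := by
  have h1 := h fun _ => x.1
  rw [ceD_of_fin_zero, extensionAlt_snd_of_ne c (by omega), map_zero, smul_zero, add_zero,
    actionContraction_one] at h1
  rw [momentLinear_apply, map_add, map_smul, dTot_constTot, smul_zero, add_zero]
  exact eq_neg_of_add_eq_zero_left h1.symm

lemma extD_momentLinear {F₀ : 𝔤 [⋀^Fin 0]→ₗ[ℝ] TotalForm A} {F : 𝔤 [⋀^Fin 1]→ₗ[ℝ] TotalForm A}
    (h : MomentRelation hω v c F₀ F) (x : 𝔤 × ℝ) :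
    extD m (momentLinear (m := m) F x m) = -iota (actionField hω v x.1) ω := by
  have h1 := congrFun (dTot_momentLinear h x) (m + 1)
  rw [dTot_succ] at h1
  rw [h1, Pi.neg_apply, Pi.single_eq_same]
  rfl

/-- An alternating map with values in forms of degree below `m`, as a map into observables. -/
def momentHigher (F : (k : ℕ) → 𝔤 [⋀^Fin k]→ₗ[ℝ] TotalForm A)
    (hF : ∀ k y j, j + k ≠ m + 1 → F k y j = 0) (k : ℕ) :
    𝔤 [⋀^Fin k]→ₗ[ℝ] (hamPairs ω × LowForms A m) :=
  if hk : 2 ≤ k then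
    obsAlt 0 (F k) fun y => by
      rw [hF k y m (by omega), AlternatingMap.zero_apply, iota_zero_left, neg_zero, map_zero]
  else 0

/-- The components of the morphism. -/
def momentMaps (T : (𝔤 × ℝ) →ₗ[ℝ] (hamPairs ω × LowForms A m))
    (F : (k : ℕ) → 𝔤 [⋀^Fin k]→ₗ[ℝ] (hamPairs ω × LowForms A m)) :
    (k : ℕ) → (Fin k → 𝔤 × ℝ) → hamPairs ω × LowForms A m
  | 1, x => T (x 0)
  | k, x => F k fun a => (x a).1

lemma isGroundedFamily_momentMaps (T : (𝔤 × ℝ) →ₗ[ℝ] (hamPairs ω × LowForms A m))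
    (F : (k : ℕ) → 𝔤 [⋀^Fin k]→ₗ[ℝ] (hamPairs ω × LowForms A m)) :
    IsGroundedFamily (LinearMap.fst ℝ 𝔤 ℝ) (momentMaps T F) T F where
  one _ := rfl
  higher k hk x := by
    match k, hk with
    | k + 2, _ => rfl

lemma momentHigher_condition {F : (k : ℕ) → 𝔤 [⋀^Fin k]→ₗ[ℝ] TotalForm A}
    (hF : ∀ k y j, j + k ≠ m + 1 → F k y j = 0) {k : ℕ} (hk : 2 ≤ k) (y : Fin k → 𝔤) :
    extD m (F k y m) = -iota ((0 : 𝔤 [⋀^Fin k]→ₗ[ℝ] VF A) y) ω := by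
  rw [hF k y m (by omega), AlternatingMap.zero_apply, iota_zero_left, neg_zero, map_zero]

lemma momentHigher_eq {F : (k : ℕ) → 𝔤 [⋀^Fin k]→ₗ[ℝ] TotalForm A}
    (hF : ∀ k y j, j + k ≠ m + 1 → F k y j = 0) {k : ℕ} (hk : 2 ≤ k) :
    momentHigher (ω := ω) F hF k = obsAlt 0 (F k) (momentHigher_condition hF hk) := dif_pos hk

lemma obsContraction_comp (k : ℕ) (y : Fin k → 𝔤) :
    obsContraction hω k (fun a => v (y a)) = actionContraction ω (actionField hω v) k y := rfl

/-- The relation for k = 0 makes the linear component land in Hamiltonian pairs. The relations for k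
≥ 1 are the morphism equations of arity k + 1; the constants (-1)^{m+1} r in the linear component
account for the central bracket. -/
theorem exists_morphism_of_moment_sequence {F : (k : ℕ) → 𝔤 [⋀^Fin k]→ₗ[ℝ] TotalForm A}
    (hF : ∀ k y j, j + k ≠ m + 1 → F k y j = 0)
    (hrel : ∀ k, MomentRelation hω v c (F k) (F (k + 1))) :
    ∃ f : (k : ℕ) → (Fin k → 𝔤 × ℝ) → hamPairs ω × LowForms A m,
      IsLInfinityMorphism (centralExtension (m + 1) c) (observables ω hω) f ∧
      ∀ k, 1 ≤ k → ∀ x, observablesProj ω hω (f k x) =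
        v (strictMaps (LinearMap.fst ℝ 𝔤 ℝ) k x) := by
  have hcond : ∀ x, extD m (momentLinear (m := m) (F 1) x m) = -iota (actionField hω v x.1) ω :=
    extD_momentLinear (hrel 0)
  let T : (𝔤 × ℝ) →ₗ[ℝ] (hamPairs ω × LowForms A m) :=
    obsLin ((actionField hω v : 𝔤 →ₗ[ℝ] VF A) ∘ₗ LinearMap.fst ℝ 𝔤 ℝ) (momentLinear (m := m) (F 1)) hcond
  have hTx : ∀ x, T x = obsMk (actionField hω v x.1) (momentLinear (m := m) (F 1) x)
      (hcond x) := fun _ => rfl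
  have hfam := isGroundedFamily_momentMaps T (momentHigher (ω := ω) F hF)
  have hcov : Covers (L' := hamPairs ω × LowForms A m) (LinearMap.fst ℝ 𝔤 ℝ)
      (observablesProj ω hω) T (momentHigher F hF) v := by
    refine ⟨fun _ => rfl, fun k hk y => ?_⟩
    rw [momentHigher_eq hF hk]; rfl
  refine ⟨momentMaps T (momentHigher F hF), ?_, hcov.proj_apply hfam⟩
  refine hcov.isLInfinityMorphism (isGrounded_centralExtension (by omega) c)
    (isGrounded_observables hω) hfam ?_ ?_ ?_ ?_ ?_
  · intro d x hx
    have hx1 : d ≠ 0 → x.1 = 0 := fun hd => by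
      have := hx.1
      simpa [hd] using this
    have hx2 : d ≠ 1 - ((m + 1 : ℕ) : ℤ) → x.2 = 0 := fun hd => by
      have := hx.2
      simpa only [hd, if_false, SetLike.mem_coe, Submodule.mem_bot] using this
    rw [hTx]
    refine obsMk_mem hω (fun hd => ?_) fun j hj => ?_
    · rw [hx1 hd, map_zero]
    · rw [momentLinear_apply, Pi.add_apply, Pi.smul_apply]
      have h1 : F 1 (fun _ => x.1) j = 0 := by
        -- F₁ has values in degree m forms only, hence in degree 0, where it matches the 𝔤 summand;
        -- constants match the centre in degree -m.
        by_cases hjm : j = m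
        · have : x.1 = 0 := hx1 fun hd => hj (by rw [hjm, hd, sub_self])
          rw [(F 1).map_coord_zero 0 this]; rfl
        · exact hF 1 _ j (by omega)
      have h2 : constTot A x.2 j = 0 := by
        by_cases hj0 : j = 0
        · have : x.2 = 0 := hx2 fun hd => hj (by rw [hj0, hd]; push_cast; ring)
          rw [this, map_zero]; rfl
        · exact constTot_apply_of_ne _ hj0
      rw [h1, h2, smul_zero, add_zero]
  · intro k hk y
    rw [momentHigher_eq hF hk, obsAlt_apply]
    exact obsMk_mem hω (fun _ => rfl) fun j hj => hF k y j (by omega)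
  · intro x
    rw [hTx, obsD_obsMk]
    refine obsMk_eq_zero rfl fun j hj => ?_
    rw [dTot_momentLinear (hrel 0), Pi.neg_apply, Pi.single_eq_of_ne (by omega), neg_zero]
  · intro y
    rw [hTx, momentHigher_eq hF le_rfl, obsAlt_apply, obsD_obsMk, obsBr_apply]
    refine (obsMk_add_eq ?_ ?_).symm
    · rw [zero_add]
      change _ = (v (lieAlt 𝔤 2 y) : VF A)
      change (lieAlt (hamVectorFields ω hω) 2 _ : VF A) = _
      rw [lieAlt_two, lieAlt_two, LieHom.map_lie]
    -- On two arguments δF₁ is F₁ of their bracket, which is the first part of the linear component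
    -- applied to l₂; the central part is already in the relation.
    · rw [obsContraction_comp, momentLinear_apply, ← hrel 1 y, ceD_fin_one]
      congr 2
      exact funext fun _ => (lieAlt_two y).symm
  · intro k y
    rw [hTx, momentHigher_eq hF (by omega), momentHigher_eq hF (by omega), obsAlt_apply,
      obsD_obsMk, obsBr_apply, ceD_obsAlt]
    have hlie : (extensionAlt (m + 1) c (k + 3) y).1 = 0 := by
      change lieAlt 𝔤 (k + 3) y = 0
      rw [lieAlt_of_ne (by omega)]; rfl
    refine obsMk_add_eq_add ?_ ?_
    · rw [ceD_zero, obsLie, lieAlt_of_ne (by omega)]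
      change 0 + actionField hω v (extensionAlt (m + 1) c (k + 3) y).1 = 0 + 0
      rw [hlie, map_zero]
    -- From arity 3 on the bracket of the extension is purely central, so F₁ contributes nothing and
    -- only the constant remains.
    · rw [obsContraction_comp, momentLinear_apply, hlie, ← hrel (k + 2) y,
        (F 1).map_coord_zero 0 rfl, zero_add]

end MomentMorphism

end NPlectic

end

theorem mainTheorem7 {E : Type*} [NormedAddCommGroup E] [NormedSpace ℝ E] [FiniteDimensional ℝ E]
    {M : Type*} [TopologicalSpace M] [ChartedSpace E M]
    [IsManifold (modelWithCornersSelf ℝ E) ((⊤ : ℕ∞) : WithTop ℕ∞) M]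
    [T2Space M] [SecondCountableTopology M] [ConnectedSpace M]
    (m : ℕ) (ω : NPlectic.Form (NPlectic.Smooth E M) (m + 2)) (hω : NPlectic.extD (m + 2) ω = 0)
    (hM : ∀ k : ℕ, 1 ≤ k → k ≤ m → NPlectic.DeRhamVanishes (NPlectic.Smooth E M) k)
    {𝔤 : Type*} [LieRing 𝔤] [LieAlgebra ℝ 𝔤]
    (v : 𝔤 →ₗ⁅ℝ⁆ NPlectic.hamVectorFields ω hω) (p : M) :
    NPlectic.IsLieNAlgebra (m + 1) (NPlectic.actionExtension ω hω v p) ∧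
    NPlectic.IsLieNAlgebra (m + 1) (NPlectic.observables ω hω) ∧
    NPlectic.IsStrictMorphism (NPlectic.actionExtension ω hω v p) (NPlectic.ofLieAlgebra 𝔤)
      (LinearMap.fst ℝ 𝔤 ℝ) ∧
    NPlectic.IsStrictMorphism (NPlectic.observables ω hω)
      (NPlectic.ofLieAlgebra (NPlectic.hamVectorFields ω hω)) (NPlectic.observablesProj ω hω) ∧
    NPlectic.IsStrictMorphism (NPlectic.ofLieAlgebra 𝔤)
      (NPlectic.ofLieAlgebra (NPlectic.hamVectorFields ω hω)) (v : 𝔤 →ₗ[ℝ] _) ∧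
    ∃ f : (k : ℕ) → (Fin k → 𝔤 × ℝ) →
        NPlectic.hamPairs ω × NPlectic.LowForms (NPlectic.Smooth E M) m,
      NPlectic.IsLInfinityMorphism (NPlectic.actionExtension ω hω v p)
        (NPlectic.observables ω hω) f ∧
      ∀ k : ℕ, 1 ≤ k → ∀ (d : Fin k → ℤ) (x : Fin k → 𝔤 × ℝ),
        NPlectic.IsHomog (NPlectic.actionExtension ω hω v p).gr d x →
        NPlectic.compStructure (NPlectic.strictMaps (NPlectic.observablesProj ω hω)) f d x =
          NPlectic.compStructure (NPlectic.strictMaps (v : 𝔤 →ₗ[ℝ] _))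
            (NPlectic.strictMaps (LinearMap.fst ℝ 𝔤 ℝ)) d x := by
  have hc : ∀ y, NPlectic.actionCocycle ω hω v p y = (-1) ^ (m + 1) *
      NPlectic.evTot (NPlectic.evalAt p)
        (NPlectic.actionContraction ω (NPlectic.actionField hω v) (m + 2) y) := fun y => by
    rw [NPlectic.actionCocycle_apply, NPlectic.evTot_actionContraction, mul_assoc]
    rfl
  have hc0 := NPlectic.ceD_cocycle hc
  -- The functional used for normalization is evaluation at p: it fixes constants, and by
  -- connectedness a closed function vanishing at p is zero.
  obtain ⟨F, hF, hrel⟩ := NPlectic.exists_moment_sequence (fun r => rfl)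
    (fun α hα hp => by
      ext Y q
      rw [Subsingleton.elim Y fun i => i.elim0]
      exact (NPlectic.eq_of_extD_zero_eq_zero α hα _ q p).trans hp) hM hc
  obtain ⟨f, hf, hproj⟩ := NPlectic.exists_morphism_of_moment_sequence hF hrel
  exact ⟨NPlectic.isLieNAlgebra_centralExtension (by omega) hc0,
    NPlectic.isLieNAlgebra_observables hω, NPlectic.isStrictMorphism_fst _,
    NPlectic.isStrictMorphism_observablesProj hω, NPlectic.isStrictMorphism_lieHom v, f, hf,
    fun k _ d x _ => NPlectic.compStructure_strictMaps_congr _ _ _ _ hproj d x⟩
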